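/- Let $\Phi_F>0$ and let $K\in C^2(\mathbb R)$ have bounded derivatives $K',K''$ on $\mathbb R$ and satisfy $K>0$ on $[0,\Phi_F]$. Consider, for $Q=Q(\tau,\eta)$ and $N=N(\tau)$, the system $$\partial_\tau Q+\partial_\eta Q=\frac1{N(\tau)}+K(Q)\quad(\eta\in(0,1)),\qquad Q(\tau,0)=0,\qquad \frac1{N(\tau)}=\partial_\eta Q(\tau,1)-K(\Phi_F),\qquad Q(0,\eta)=Q_{\rm init}(\eta)\quad(\eta\in[0,1]),$$ where $Q_{\rm init}\in C^1[0,1]$ is non-decreasing with $Q_{\rm init}(0)=0$, $Q_{\rm init}(1)=\Phi_F$ and $Q_{\rm init}'(1)>K(\Phi_F)$. For $0<T\le\infty$, a classical solution on $[0,T)$ is a pair $(Q,N)$ such that $Q\in C^1([0,T)\times[0,1])$ is non-decreasing in $\eta$, $N\in C[0,T)$ is positive, the equations hold for all $\tau\in[0,T)$, and $K(\Phi_F)<\partial_\eta Q(\tau,1)<\infty$ for all $\tau\in[0,T)$. It is global if $T=\infty$. A steady state $(Q^*,N^*)$ is a global classical solution that does not depend on $\tau$ (with initial datum $Q^*$).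 Put $$k_{\max}:=K'(0)+\int_0^{\Phi_F}\max(K''(\phi),0)\,d\phi .$$ Suppose that $k_{\max}<0$ and $\int_0^{\Phi_F}\frac{d\phi}{K(\phi)}>1$. Suppose moreover that the initial datum satisfies the compatibility condition $$Q_{\rm init}'(1)-Q_{\rm init}'(0)=K(\Phi_F)-K(0)$$ and that $$H_{\rm init}(\eta):=Q_{\rm init}'(\eta)-K(Q_{\rm init}(\eta))>0\qquad\text{for all }\eta\in[0,1].$$ Then there is a global classical solution $(Q,N)$ with initial datum $Q_{\rm init}$, and it is unique: every classical solution with this initial datum on an interval $[0,T)$, $0<T\le\infty$, coincides with $(Q,N)$ there. There is exactly one steady state $(Q^*,N^*)$. The solution converges to it exponentially in the sense that, for all $\tau\ge0$, $$\|\partial_\eta Q(\tau,\cdot)-\partial_\eta Q^*\|_{L^1(0,1)}\le e^{k_{\max}\tau}\,\|\partial_\eta Q(0,\cdot)-\partial_\eta Q^*\|_{L^1(0,1)} .$$ -/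

import Mathlib

open Set

namespace PulseCoupled

/-- Standing assumption on the phase response function `K` with firing phase `Φ`:
`K` is `C²` on `ℝ` with `K'` and `K''` bounded on `ℝ`, and `K > 0` on `[0, Φ]`. -/
structure IsPhaseResponse (Φ : ℝ) (K : ℝ → ℝ) : Prop where
  contDiff : ContDiff ℝ 2 K
  deriv_bounded : ∃ C : ℝ, ∀ φ : ℝ, |deriv K φ| ≤ C
  deriv_deriv_bounded : ∃ C : ℝ, ∀ φ : ℝ, |deriv (deriv K) φ| ≤ C
  pos : ∀ φ ∈ Icc 0 Φ, 0 < K φ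

/-- `k_max = K'(0) + ∫₀^Φ (K''(φ))₊ dφ`, with `(x)₊ = max x 0`. -/
noncomputable def kMax (Φ : ℝ) (K : ℝ → ℝ) : ℝ :=
  deriv K 0 + ∫ φ in (0 : ℝ)..Φ, max (deriv (deriv K) φ) 0

/-- The derivative of a function on the closed interval `[0, 1]`, one-sided at the end points. -/
noncomputable def dEta (q : ℝ → ℝ) (η : ℝ) : ℝ := derivWithin q (Icc 0 1) η

/-- The time interval `[0, T)` for `T ∈ (0, ∞]`. -/
def timeInterval (T : EReal) : Set ℝ := {τ : ℝ | 0 ≤ τ ∧ (τ : EReal) < T}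

/-- The data for which classical solutions are considered: non-decreasing `C¹` functions on
`[0, 1]` with `q(0) = 0`, `q(1) = Φ` and `q'(1) > K(Φ)`. -/
structure IsInitialDatum (Φ : ℝ) (K : ℝ → ℝ) (q : ℝ → ℝ) : Prop where
  contDiffOn : ContDiffOn ℝ 1 q (Icc 0 1)
  monotoneOn : MonotoneOn q (Icc 0 1)
  left : q 0 = 0
  right : q 1 = Φ
  flux : K Φ < dEta q 1

/-- Initial data that moreover satisfy the first order compatibility condition
`q'(1) - q'(0) = K(Φ) - K(0)`. -/
structure IsCompatibleDatum (Φ : ℝ) (K : ℝ → ℝ) (q : ℝ → ℝ) : Prop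
    extends IsInitialDatum Φ K q where
  compat : dEta q 1 - dEta q 0 = K Φ - K 0

/-- `H_init(η) = q'(η) - K(q(η))`. -/
noncomputable def hInit (K : ℝ → ℝ) (q : ℝ → ℝ) (η : ℝ) : ℝ := dEta q η - K (q η)

/-- `(Q, N)` is a classical solution on `[0, T)`, `0 < T ≤ ∞`, with initial datum `q`, of
`∂_τ Q + ∂_η Q = 1/N(τ) + K(Q)`, `Q(τ, 0) = 0`, `1/N(τ) = ∂_η Q(τ, 1) - K(Φ)`.
Only the values of `Q` on `[0, T) × [0, 1]` and of `N` on `[0, T)` matter. -/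
structure IsClassicalSolution (Φ : ℝ) (K : ℝ → ℝ) (T : EReal) (q : ℝ → ℝ)
    (Q : ℝ → ℝ → ℝ) (N : ℝ → ℝ) : Prop where
  time_pos : 0 < T
  datum : IsInitialDatum Φ K q
  contDiffOn : ContDiffOn ℝ 1 (fun p : ℝ × ℝ => Q p.1 p.2) (timeInterval T ×ˢ Icc 0 1)
  monotoneOn : ∀ τ ∈ timeInterval T, MonotoneOn (Q τ) (Icc 0 1)
  continuousOn_rate : ContinuousOn N (timeInterval T)
  rate_pos : ∀ τ ∈ timeInterval T, 0 < N τ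
  pde : ∀ τ ∈ timeInterval T, ∀ η ∈ Ioo (0 : ℝ) 1,
    derivWithin (fun s => Q s η) (timeInterval T) τ + dEta (Q τ) η = 1 / N τ + K (Q τ η)
  left : ∀ τ ∈ timeInterval T, Q τ 0 = 0
  rate : ∀ τ ∈ timeInterval T, 1 / N τ = dEta (Q τ) 1 - K Φ
  initial : ∀ η ∈ Icc (0 : ℝ) 1, Q 0 η = q η
  flux : ∀ τ ∈ timeInterval T, K Φ < dEta (Q τ) 1

/-- A steady state `(Qs, Ns)`: a global classical solution that does not depend on time. -/
def IsSteadyState (Φ : ℝ) (K : ℝ → ℝ) (Qs : ℝ → ℝ) (Ns : ℝ) : Prop :=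
  IsClassicalSolution Φ K ⊤ Qs (fun _ => Qs) (fun _ => Ns)

/-- `‖∂_η q₁ - ∂_η q₂‖_{L¹(0,1)}`. -/
noncomputable def bvDist (q₁ q₂ : ℝ → ℝ) : ℝ :=
  ∫ η in (0 : ℝ)..1, |dEta q₁ η - dEta q₂ η|

end PulseCoupled

namespace PulseCoupled

open Filter Topology MeasureTheory

/-! Write `u = ∂_η Q` and `n = 1 / N`. The density `u` is transported at unit speed, `∂_τ u + ∂_η u
= K'(Q) u`, with boundary values `n + K 0` and `n + K Φ`. For two solutions the difference `w = u₁ -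
u₂` therefore has the same value `n₁ - n₂` at both ends, and the unknown rates drop out of the time
derivative of `∫ |w|`.

Contraction (`IsRegularSolution.integral_abs_sub_le`). On `[0, Φ]` split `K' = kMax - D₁ - D₂` with
`D₁ ≥ 0` non-increasing and `D₂ ≥ 0` non-decreasing (`IsPhaseResponse.exists_deriv_eq_sub`). The
constant contributes `kMax * ∫ |w|`. For the other two terms, since `u₁, u₂ ≥ 0`, replacing `sign
(u₁ - u₂)` by `± sign (Q₁ - Q₂)` gives a pointwise bound in the favourable direction. If `G' = D ≥
0`, then `sign (Q₁ - Q₂) * ∂_η (G(Q₁) - G(Q₂))` is the derivative of `|G(Q₁) - G(Q₂)|`, which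
vanishes at both ends, so these terms integrate to zero. Contraction gives uniqueness of the
solution and of the steady state, and it gives convergence on taking the steady state as the second
solution.

Existence. In Lagrangian coordinates `Θ τ x` is the phase at time `τ` of the oscillator with initial
phase `x`. Its spatial derivative `V` satisfies `∂_τ V = K'(Θ) V`, and the condition that the
oscillator at `η = 1` has phase `Φ` gives `Θ τ x = Φ + ∫ V` from `p (1 - τ)` to `x`. The rate has
disappeared: `V` solves an ODE in a space of bounded continuous functions, on a time interval
controlled by `sup |K'|` alone (`exists_isFlow`). Oscillators that enter at phase `0` later receive
virtual negative labels, and the compatibility condition makes the labels `C¹`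
(`exists_isStrongSolution_Icc`). Since the time step does not depend on the datum, it can be
iterated for ever (`exists_isStrongSolution_Ici`).

Positivity (`IsRegularSolution.rate_pos`). `H = u - K(Q)` equals `n` at both ends and satisfies `∂_τ
H + ∂_η H = K'(Q) H - K'(Q) n`. As `K' ≤ kMax < 0` on `[0, Φ]`, the source is non-negative while `n
≥ 0`, so `n` cannot reach zero for the first time.

The steady state solves `Q' = K(Q) + c`, where `c > 0` is fixed by `∫ 1 / (K + c) = 1`
(`exists_isSteadyState`). -/

/-! ### Calculus on products and transport along unit-speed characteristics. -/

/-- Partial derivatives that are continuous on a product of convex sets give the total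
derivative within that product. -/
lemma hasFDerivWithinAt_of_partials {f A B : ℝ → ℝ → ℝ} {s t : Set ℝ} (hs : Convex ℝ s)
    (hA : ∀ x ∈ s, ∀ y ∈ t, HasDerivWithinAt (fun x => f x y) (A x y) s x)
    (hB : ∀ x ∈ s, ∀ y ∈ t, HasDerivWithinAt (f x) (B x y) t y)
    (cA : ContinuousOn (fun p : ℝ × ℝ => A p.1 p.2) (s ×ˢ t))
    {p : ℝ × ℝ} (hp : p ∈ s ×ˢ t) :
    HasFDerivWithinAt (fun p : ℝ × ℝ => f p.1 p.2)
      (A p.1 p.2 • ContinuousLinearMap.fst ℝ ℝ ℝ + B p.1 p.2 • ContinuousLinearMap.snd ℝ ℝ ℝ)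
      (s ×ˢ t) p := by
  obtain ⟨x, y⟩ := p
  obtain ⟨hx, hy⟩ := hp
  simp only at hx hy ⊢
  rw [hasFDerivWithinAt_iff_isLittleO, Asymptotics.isLittleO_iff]
  intro c hc
  obtain ⟨δ, hδ, hAδ⟩ := Metric.continuousWithinAt_iff.1 (cA (x, y) ⟨hx, hy⟩) (c / 2) (by positivity)
  have h2 := (hasDerivWithinAt_iff_isLittleO.1 (hB x hx y hy))
  rw [Asymptotics.isLittleO_iff] at h2
  have h2' := h2 (show 0 < c / 2 by positivity)
  rw [eventually_nhdsWithin_iff, Metric.eventually_nhds_iff] at h2' ⊢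
  obtain ⟨δ', hδ', hBδ⟩ := h2'
  refine ⟨min δ δ', lt_min hδ hδ', ?_⟩
  rintro ⟨x', y'⟩ hd ⟨hx', hy'⟩
  simp only at hx' hy'
  have hdx : dist x' x < min δ δ' := lt_of_le_of_lt (le_max_left _ _) hd
  have hdy : dist y' y < min δ δ' := lt_of_le_of_lt (le_max_right _ _) hd
  have e1 := hBδ (lt_of_lt_of_le hdy (min_le_right _ _)) hy'
  have e2 : ‖(f x' y' - A x y * x') - (f x y' - A x y * x)‖ ≤ c / 2 * ‖x' - x‖ := by
    refine Convex.norm_image_sub_le_of_norm_hasDerivWithin_le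
      (f := fun z => f z y' - A x y * z) (f' := fun z => A z y' - A x y)
      (s := s ∩ Metric.ball x δ) ?_ ?_ (hs.inter (convex_ball x δ)) ?_ ?_
    · intro z hz
      have := ((hA z hz.1 y' hy').mono (inter_subset_left (t := Metric.ball x δ))).sub
        (((hasDerivWithinAt_id z _).const_mul (A x y)))
      rw [mul_one] at this
      exact this
    · intro z hz
      have := hAδ (x := (z, y')) ⟨hz.1, hy'⟩ (max_lt hz.2 (lt_of_lt_of_le hdy (min_le_left _ _)))
      rw [Real.dist_eq] at this
      exact this.le
    · exact ⟨hx, Metric.mem_ball_self hδ⟩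
    · exact ⟨hx', lt_of_lt_of_le hdx (min_le_left _ _)⟩
  have e3 : ‖x' - x‖ ≤ ‖(x', y') - (x, y)‖ := le_max_left _ _
  have e4 : ‖y' - y‖ ≤ ‖(x', y') - (x, y)‖ := le_max_right _ _
  have e5 : f x' y' - f x y - (A x y • ContinuousLinearMap.fst ℝ ℝ ℝ +
      B x y • ContinuousLinearMap.snd ℝ ℝ ℝ) ((x', y') - (x, y))
      = ((f x' y' - A x y * x') - (f x y' - A x y * x)) + (f x y' - f x y - (y' - y) • B x y) := by
    simp; ring
  rw [e5]
  refine (norm_add_le _ _).trans ?_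
  have := mul_le_mul_of_nonneg_left e3 (show 0 ≤ c / 2 by positivity)
  have := mul_le_mul_of_nonneg_left e4 (show 0 ≤ c / 2 by positivity)
  linarith

lemma contDiffOn_of_partials {f A B : ℝ → ℝ → ℝ} {s t : Set ℝ} (hs : Convex ℝ s)
    (us : UniqueDiffOn ℝ s) (ut : UniqueDiffOn ℝ t)
    (hA : ∀ x ∈ s, ∀ y ∈ t, HasDerivWithinAt (fun x => f x y) (A x y) s x)
    (hB : ∀ x ∈ s, ∀ y ∈ t, HasDerivWithinAt (f x) (B x y) t y)
    (cA : ContinuousOn (fun p : ℝ × ℝ => A p.1 p.2) (s ×ˢ t))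
    (cB : ContinuousOn (fun p : ℝ × ℝ => B p.1 p.2) (s ×ˢ t)) :
    ContDiffOn ℝ 1 (fun p : ℝ × ℝ => f p.1 p.2) (s ×ˢ t) := by
  have key := fun p (hp : p ∈ s ×ˢ t) => hasFDerivWithinAt_of_partials hs hA hB cA hp
  have hu := us.prod ut
  rw [show (1 : WithTop ℕ∞) = 0 + 1 by simp, contDiffOn_succ_iff_fderivWithin hu]
  refine ⟨fun p hp => (key p hp).differentiableWithinAt, by simp, ?_⟩
  rw [contDiffOn_zero]
  refine ContinuousOn.congr (f := fun p : ℝ × ℝ => A p.1 p.2 • ContinuousLinearMap.fst ℝ ℝ ℝ +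
    B p.1 p.2 • ContinuousLinearMap.snd ℝ ℝ ℝ) (by fun_prop) ?_
  intro p hp
  exact (key p hp).fderivWithin (hu p hp)

/-- A function that is `C¹` on `[0, 1]` extends to a `C¹` function on the line. -/
lemma exists_contDiff_extension {q q' : ℝ → ℝ}
    (hq : ∀ y ∈ Icc (0 : ℝ) 1, HasDerivWithinAt q (q' y) (Icc 0 1) y)
    (hq' : ContinuousOn q' (Icc 0 1)) :
    ∃ p p' : ℝ → ℝ, (∀ y, HasDerivAt p (p' y) y) ∧ Continuous p' ∧ EqOn p q (Icc 0 1) ∧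
      EqOn p' q' (Icc 0 1) := by
  have hc : Continuous (IccExtend zero_le_one ((Icc (0 : ℝ) 1).domRestrict q')) :=
    (continuousOn_iff_continuous_domRestrict.1 hq').Icc_extend'
  set p' := IccExtend zero_le_one ((Icc (0 : ℝ) 1).domRestrict q') with hp'
  have hE : EqOn p' q' (Icc 0 1) := fun y hy => by
    rw [hp', IccExtend_of_mem _ _ hy]; rfl
  refine ⟨fun y => q 0 + ∫ z in (0 : ℝ)..y, p' z, p', fun y => ?_, hc, ?_, hE⟩
  · exact ((hc.integral_hasStrictDerivAt 0 y).hasDerivAt).const_add _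
  · intro y hy
    have : ∫ z in (0 : ℝ)..y, q' z = q y - q 0 := by
      refine intervalIntegral.integral_eq_sub_of_hasDerivAt_of_le hy.1 ?_ ?_ ?_
      · exact fun z hz => ((hq z ⟨hz.1, hz.2.trans hy.2⟩).continuousWithinAt).mono
          (Icc_subset_Icc_right hy.2)
      · exact fun z hz => (hq z ⟨hz.1.le, hz.2.le.trans hy.2⟩).hasDerivAt
          (Icc_mem_nhds hz.1 (hz.2.trans_le hy.2))
      · refine ContinuousOn.intervalIntegrable ?_
        rw [uIcc_of_le hy.1]
        exact hq'.mono (Icc_subset_Icc_right hy.2)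
    have h2 : ∫ z in (0 : ℝ)..y, p' z = ∫ z in (0 : ℝ)..y, q' z := by
      refine intervalIntegral.integral_congr ?_
      rw [uIcc_of_le hy.1]
      exact hE.mono (Icc_subset_Icc_right hy.2)
    simp only [h2, this]; ring

/-- The slope of a function along a unit-speed characteristic is a value of its directional
derivative. -/
lemma exists_characteristic_slope {v γ : ℝ → ℝ → ℝ} {τ b y h : ℝ}
    (cv : ContinuousOn (fun p : ℝ × ℝ => v p.1 p.2) (Icc τ b ×ˢ Icc 0 1))
    (hd : ∀ t ∈ Ioo τ b, ∀ x ∈ Ioo (0 : ℝ) 1,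
      HasDerivAt (fun r => v (t + r) (x + r)) (γ t x) 0)
    (hh : 0 < h) (hb : τ + h ≤ b) (hy : 0 ≤ y) (hy1 : y + h ≤ 1) :
    ∃ r ∈ Ioo 0 h, v (τ + h) (y + h) - v τ y = γ (τ + r) (y + r) * h := by
  have hc : ContinuousOn (fun r => v (τ + r) (y + r)) (Icc 0 h) := by
    refine cv.comp (f := fun r : ℝ => (τ + r, y + r)) (by fun_prop) ?_
    intro r hr
    exact ⟨⟨by linarith [hr.1], by linarith [hr.2]⟩, ⟨by linarith [hr.1], by linarith [hr.2]⟩⟩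
  have hderiv : ∀ r ∈ Ioo 0 h,
      HasDerivAt (fun r => v (τ + r) (y + r)) (γ (τ + r) (y + r)) r := by
    intro r hr
    have := hd (τ + r) ⟨by linarith [hr.1], by linarith [hr.2]⟩ (y + r)
      ⟨by linarith [hr.1], by linarith [hr.2]⟩
    have h2 := this.comp_of_eq r ((hasDerivAt_id r).sub_const r) (by simp)
    rw [mul_one] at h2
    refine h2.congr_of_eventuallyEq (Eventually.of_forall fun s => ?_)
    simp
  obtain ⟨r, hr, e⟩ := exists_hasDerivAt_eq_slope _ _ hh hc hderiv
  refine ⟨r, hr, ?_⟩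
  rw [e]
  simp only [add_zero, sub_zero]
  rw [div_mul_cancel₀ _ hh.ne']

/-- Densities are only continuous, so just the derivative along the characteristic is available.
Comparing `v (τ + h) (y + h)` with `v τ y` for `y ∈ [0, 1 - h]` leaves an inflow and an outflow
strip of width `h`; since the boundary values agree at time `τ`, the strips cancel up to `o(h)`. -/
lemma hasDerivWithinAt_integral_transport {v γ : ℝ → ℝ → ℝ} {τ b : ℝ} (hb : τ < b)
    (cv : ContinuousOn (fun p : ℝ × ℝ => v p.1 p.2) (Icc τ b ×ˢ Icc 0 1))
    (cγ : ContinuousOn (fun p : ℝ × ℝ => γ p.1 p.2) (Icc τ b ×ˢ Icc 0 1))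
    (hper : v τ 0 = v τ 1)
    (hd : ∀ t ∈ Ioo τ b, ∀ x ∈ Ioo (0 : ℝ) 1,
      HasDerivAt (fun r => v (t + r) (x + r)) (γ t x) 0) :
    HasDerivWithinAt (fun t => ∫ η in (0 : ℝ)..1, v t η) (∫ η in (0 : ℝ)..1, γ τ η)
      (Ici τ) τ := by
  have hcomp : IsCompact (Icc τ b ×ˢ Icc (0 : ℝ) 1) := isCompact_Icc.prod isCompact_Icc
  have uv := Metric.uniformContinuousOn_iff.1 (hcomp.uniformContinuousOn_of_continuous cv)
  have uγ := Metric.uniformContinuousOn_iff.1 (hcomp.uniformContinuousOn_of_continuous cγ)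
  have sv : ∀ t ∈ Icc τ b, ContinuousOn (v t) (Icc 0 1) := fun t ht =>
    cv.comp (f := fun x : ℝ => (t, x)) (by fun_prop) fun x hx => ⟨ht, hx⟩
  have sγ : ∀ t ∈ Icc τ b, ContinuousOn (γ t) (Icc 0 1) := fun t ht =>
    cγ.comp (f := fun x : ℝ => (t, x)) (by fun_prop) fun x hx => ⟨ht, hx⟩
  have ht0 : τ ∈ Icc τ b := ⟨le_rfl, hb.le⟩
  obtain ⟨C, hC⟩ := (isCompact_Icc.image_of_continuousOn (sγ τ ht0)).isBounded.exists_norm_le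
  have hC' : ∀ x ∈ Icc (0 : ℝ) 1, |γ τ x| ≤ C := fun x hx => hC _ ⟨x, hx, rfl⟩
  have hC0 : 0 ≤ C := (abs_nonneg _).trans (hC' 0 (by simp))
  rw [hasDerivWithinAt_iff_isLittleO, Asymptotics.isLittleO_iff]
  intro c hc
  obtain ⟨δ1, hδ1, H1⟩ := uv (c / 4) (by positivity)
  obtain ⟨δ2, hδ2, H2⟩ := uγ (c / 4) (by positivity)
  have hδ3 : 0 < c / 4 / (C + 1) := by positivity
  rw [eventually_nhdsWithin_iff, Metric.eventually_nhds_iff]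
  -- Four errors share `c * h`: the bulk term, the two boundary strips, and the part of `∫ γ` over
  -- the outflow strip, which is at most `C * h * h`.
  refine ⟨min (min (min δ1 δ2) (c / 4 / (C + 1))) (min 1 (b - τ)),
    by simp [hδ1, hδ2, hδ3, hb], ?_⟩
  intro t hdist (ht : τ ≤ t)
  obtain ⟨h, rfl⟩ : ∃ h, t = τ + h := ⟨t - τ, by ring⟩
  have hh0 : 0 ≤ h := by linarith
  rcases hh0.eq_or_lt with rfl | hh
  · simp
  rw [Real.dist_eq, show τ + h - τ = h by ring, abs_of_pos hh] at hdist
  simp only [lt_min_iff] at hdist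
  obtain ⟨⟨⟨h1, h2⟩, h3⟩, h4, h5⟩ := hdist
  have h3' : C * h ≤ c / 4 := by
    rw [lt_div_iff₀ (by positivity)] at h3
    nlinarith
  have hth : τ + h ∈ Icc τ b := ⟨by linarith, by linarith⟩
  have ii : ∀ {f : ℝ → ℝ} {p q : ℝ}, ContinuousOn f (Icc 0 1) → 0 ≤ p → p ≤ 1 → 0 ≤ q → q ≤ 1 →
      IntervalIntegrable f volume p q := by
    intro f p q hf hp hp1 hq hq1
    refine (hf.mono ?_).intervalIntegrable
    rintro x ⟨hx1, hx2⟩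
    exact ⟨(le_min hp hq).trans hx1, hx2.trans (max_le hp1 hq1)⟩
  have hh1 : h ≤ 1 := h4.le
  have e1 : ∫ η in (0 : ℝ)..1, v (τ + h) η =
      (∫ η in (0 : ℝ)..h, v (τ + h) η) + ∫ y in (0 : ℝ)..(1 - h), v (τ + h) (y + h) := by
    rw [intervalIntegral.integral_comp_add_right (fun x => v (τ + h) x) h]
    simp only [zero_add, sub_add_cancel]
    exact (intervalIntegral.integral_add_adjacent_intervals
      (ii (sv _ hth) le_rfl zero_le_one hh0 hh1) (ii (sv _ hth) hh0 hh1 zero_le_one le_rfl)).symm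
  have e2 : ∫ η in (0 : ℝ)..1, v τ η =
      (∫ η in (0 : ℝ)..(1 - h), v τ η) + ∫ y in (1 - h)..1, v τ y :=
    (intervalIntegral.integral_add_adjacent_intervals
      (ii (sv _ ht0) le_rfl zero_le_one (by linarith) (by linarith))
      (ii (sv _ ht0) (by linarith) (by linarith) zero_le_one le_rfl)).symm
  have e3 : ∫ η in (0 : ℝ)..1, γ τ η =
      (∫ η in (0 : ℝ)..(1 - h), γ τ η) + ∫ y in (1 - h)..1, γ τ y :=
    (intervalIntegral.integral_add_adjacent_intervals
      (ii (sγ _ ht0) le_rfl zero_le_one (by linarith) (by linarith))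
      (ii (sγ _ ht0) (by linarith) (by linarith) zero_le_one le_rfl)).symm
  have cshift : ContinuousOn (fun y => v (τ + h) (y + h)) (Icc 0 (1 - h)) :=
    (sv _ hth).comp (by fun_prop) fun y hy => ⟨by linarith [hy.1], by linarith [hy.2]⟩
  have ishift : IntervalIntegrable (fun y => v (τ + h) (y + h)) volume 0 (1 - h) := by
    refine ContinuousOn.intervalIntegrable ?_
    rwa [uIcc_of_le (by linarith)]
  have b1 : ‖∫ y in (0 : ℝ)..(1 - h), (v (τ + h) (y + h) - v τ y - h * γ τ y)‖
      ≤ c / 4 * h * |1 - h - 0| := by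
    refine intervalIntegral.norm_integral_le_of_norm_le_const (fun y hy => ?_)
    rw [uIoc_of_le (by linarith)] at hy
    obtain ⟨r, hr, e⟩ := exists_characteristic_slope cv hd hh hth.2 hy.1.le
      (by linarith [hy.2])
    rw [e, show γ (τ + r) (y + r) * h - h * γ τ y = (γ (τ + r) (y + r) - γ τ y) * h by ring,
      Real.norm_eq_abs, abs_mul, abs_of_pos hh]
    refine mul_le_mul_of_nonneg_right ?_ hh0
    have := H2 (τ + r, y + r) ⟨⟨by linarith [hr.1], by linarith [hr.2]⟩,
      ⟨by linarith [hr.1, hy.1], by linarith [hr.2, hy.2]⟩⟩ (τ, y)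
      ⟨ht0, ⟨by linarith [hy.1], by linarith [hy.2]⟩⟩ (by
        simp only [Prod.dist_eq, Real.dist_eq, add_sub_cancel_left, max_self, abs_of_pos hr.1]
        linarith [hr.2])
    exact this.le
  have b2 : ‖∫ η in (0 : ℝ)..h, (v (τ + h) η - v τ 0)‖ ≤ c / 4 * |h - 0| := by
    refine intervalIntegral.norm_integral_le_of_norm_le_const (fun y hy => ?_)
    rw [uIoc_of_le hh0] at hy
    refine (H1 (τ + h, y) ⟨hth, ⟨hy.1.le, hy.2.trans hh1⟩⟩ (τ, 0) ⟨ht0, by simp⟩ ?_).le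
    simp only [Prod.dist_eq, Real.dist_eq, add_sub_cancel_left, sub_zero, abs_of_pos hh,
      abs_of_pos hy.1]
    exact max_lt h1 (by linarith [hy.2])
  have b3 : ‖∫ η in (1 - h)..1, (v τ η - v τ 0)‖ ≤ c / 4 * |1 - (1 - h)| := by
    refine intervalIntegral.norm_integral_le_of_norm_le_const (fun y hy => ?_)
    rw [uIoc_of_le (by linarith)] at hy
    rw [hper]
    refine (H1 (τ, y) ⟨ht0, ⟨by linarith [hy.1], hy.2⟩⟩ (τ, 1) ⟨ht0, by simp⟩ ?_).le
    simp only [Prod.dist_eq, Real.dist_eq, sub_self, abs_zero]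
    refine max_lt hδ1 ?_
    rw [abs_lt]
    constructor <;> linarith [hy.1, hy.2]
  have b4 : ‖∫ η in (1 - h)..1, γ τ η‖ ≤ C * |1 - (1 - h)| := by
    refine intervalIntegral.norm_integral_le_of_norm_le_const (fun y hy => ?_)
    rw [uIoc_of_le (by linarith)] at hy
    exact hC' y ⟨by linarith [hy.1], hy.2⟩
  rw [intervalIntegral.integral_sub (ishift.sub (ii (sv _ ht0) le_rfl zero_le_one (by linarith)
      (by linarith))) ((ii (sγ _ ht0) le_rfl zero_le_one (by linarith) (by linarith)).const_mul h),
    intervalIntegral.integral_sub ishift (ii (sv _ ht0) le_rfl zero_le_one (by linarith)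
      (by linarith)), intervalIntegral.integral_const_mul] at b1
  rw [intervalIntegral.integral_sub (ii (sv _ hth) le_rfl zero_le_one hh0 hh1) (by simp),
    intervalIntegral.integral_const] at b2
  rw [intervalIntegral.integral_sub (ii (sv _ ht0) (by linarith) (by linarith) zero_le_one le_rfl)
    (by simp), intervalIntegral.integral_const] at b3
  rw [show τ + h - τ = h by ring, e1, e2, e3, Real.norm_eq_abs, Real.norm_eq_abs, abs_of_pos hh]
  rw [abs_of_nonneg (show 0 ≤ 1 - h - 0 by linarith)] at b1
  rw [sub_zero, abs_of_pos hh] at b2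
  rw [show 1 - (1 - h) = h by ring, abs_of_pos hh] at b3 b4
  simp only [smul_eq_mul, Real.norm_eq_abs, abs_le] at b1 b2 b3 b4 ⊢
  have b5 : C * h * h ≤ c / 4 * h := mul_le_mul_of_nonneg_right h3' hh0
  have b6 : c / 4 * h * (1 - h - 0) ≤ c / 4 * h := by nlinarith [mul_pos hc hh]
  constructor <;> nlinarith [b1.1, b1.2, b2.1, b2.2, b3.1, b3.2,
    mul_le_mul_of_nonneg_left b4.1 hh0, mul_le_mul_of_nonneg_left b4.2 hh0]

/-! ### Integrals of exact derivatives against a sign. -/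

lemma measurable_real_sign : Measurable Real.sign := by
  have : Real.sign = fun r : ℝ => if r < 0 then (-1 : ℝ) else if 0 < r then 1 else 0 := rfl
  rw [this]
  exact Measurable.ite measurableSet_Iio measurable_const
    (Measurable.ite measurableSet_Ioi measurable_const measurable_const)

lemma abs_real_sign_le (r : ℝ) : |Real.sign r| ≤ 1 := by
  rcases Real.sign_apply_eq r with h | h | h <;> simp [h]

lemma intervalIntegrable_sign_mul {W X : ℝ → ℝ} (hW : ContinuousOn W (Icc 0 1))
    (hX : ContinuousOn X (Icc 0 1)) :
    IntervalIntegrable (fun η => Real.sign (W η) * X η) volume 0 1 := by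
  have hXi : IntervalIntegrable X volume 0 1 := by
    refine ContinuousOn.intervalIntegrable ?_
    rwa [uIcc_of_le zero_le_one]
  rw [intervalIntegrable_iff_integrableOn_Icc_of_le zero_le_one] at hXi ⊢
  refine Integrable.bdd_mul (c := 1) hXi ?_ (Eventually.of_forall fun η => ?_)
  · exact (measurable_real_sign.comp_aemeasurable
      (hW.aemeasurable measurableSet_Icc)).aestronglyMeasurable
  · exact abs_real_sign_le _

/-- `∫ sign(f) f' = 0` for a `C¹` function vanishing at both end points. -/
lemma integral_sign_mul_deriv_eq_zero {f f' : ℝ → ℝ}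
    (hf : ∀ η ∈ Icc (0 : ℝ) 1, HasDerivWithinAt f (f' η) (Icc 0 1) η)
    (hf' : ContinuousOn f' (Icc 0 1)) (h0 : f 0 = 0) (h1 : f 1 = 0) :
    ∫ η in (0 : ℝ)..1, Real.sign (f η) * f' η = 0 := by
  have cf : ContinuousOn f (Icc 0 1) := fun η hη => (hf η hη).continuousWithinAt
  have pos : ∀ (n : ℕ) η, 0 < f η ^ 2 + (1 / ((n : ℝ) + 1)) ^ 2 := fun n η => by positivity
  have cint : ∀ n : ℕ, ContinuousOn
      (fun η => f η / √(f η ^ 2 + (1 / ((n : ℝ) + 1)) ^ 2) * f' η) (Icc 0 1) := fun n =>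
    (cf.div (Real.continuous_sqrt.comp_continuousOn ((cf.pow 2).add continuousOn_const))
      fun η _ => (Real.sqrt_pos.2 (pos n η)).ne').mul hf'
  -- With the sign regularised, the integrand is the derivative of `√(f² + δ²)`, `δ = 1 / (n + 1)`,
  -- which takes the same value at both ends. Dominated convergence with bound `|f'|` then passes to
  -- the sign.
  have hn : ∀ n : ℕ, ∫ η in (0 : ℝ)..1,
      f η / √(f η ^ 2 + (1 / ((n : ℝ) + 1)) ^ 2) * f' η = 0 := by
    intro n
    rw [intervalIntegral.integral_eq_sub_of_hasDerivAt_of_le zero_le_one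
      (f := fun η => √(f η ^ 2 + (1 / ((n : ℝ) + 1)) ^ 2))]
    · simp [h0, h1]
    · exact Real.continuous_sqrt.comp_continuousOn ((cf.pow 2).add continuousOn_const)
    · intro η hη
      have h := (hf η (Ioo_subset_Icc_self hη)).hasDerivAt (Icc_mem_nhds hη.1 hη.2)
      have := ((h.pow 2).add_const ((1 / ((n : ℝ) + 1)) ^ 2)).sqrt (pos n η).ne'
      refine this.congr_deriv ?_
      simp only [Pi.pow_apply]
      field_simp
      push_cast
      ring
    · refine ContinuousOn.intervalIntegrable ?_
      rw [uIcc_of_le zero_le_one]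
      exact cint n
  have lim : Tendsto (fun n : ℕ => ∫ η in (0 : ℝ)..1,
      f η / √(f η ^ 2 + (1 / ((n : ℝ) + 1)) ^ 2) * f' η) atTop
      (𝓝 (∫ η in (0 : ℝ)..1, Real.sign (f η) * f' η)) := by
    refine intervalIntegral.tendsto_integral_filter_of_dominated_convergence (fun η => |f' η|)
      (Eventually.of_forall fun n => ?_) (Eventually.of_forall fun n => ?_) ?_ ?_
    · rw [uIoc_of_le zero_le_one]
      exact ((cint n).mono Ioc_subset_Icc_self).aestronglyMeasurable measurableSet_Ioc
    · refine Eventually.of_forall fun η _ => ?_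
      rw [norm_mul, Real.norm_eq_abs, Real.norm_eq_abs]
      refine mul_le_of_le_one_left (abs_nonneg _) ?_
      rw [abs_div, abs_of_pos (Real.sqrt_pos.2 (pos n η)), div_le_one (Real.sqrt_pos.2 (pos n η))]
      refine Real.abs_le_sqrt ?_
      linarith [sq_nonneg (1 / ((n : ℝ) + 1))]
    · refine ContinuousOn.intervalIntegrable ?_
      rw [uIcc_of_le zero_le_one]
      exact hf'.abs
    · refine Eventually.of_forall fun η _ => ?_
      refine Tendsto.mul_const _ ?_
      rcases eq_or_ne (f η) 0 with h | h
      · simp [h]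
      · have e : Real.sign (f η) = f η / √(f η ^ 2 + 0 ^ 2) := by
          have : √(f η ^ 2 + 0 ^ 2) = |f η| := by simp [Real.sqrt_sq_eq_abs]
          rw [this]
          rcases h.lt_or_gt with h | h
          · rw [Real.sign_of_neg h, abs_of_neg h, div_neg, div_self h.ne]
          · rw [Real.sign_of_pos h, abs_of_pos h, div_self h.ne']
        rw [e]
        refine Tendsto.div tendsto_const_nhds ?_ (by
          rw [Ne, Real.sqrt_eq_zero']
          simpa using h)
        refine (Real.continuous_sqrt.tendsto _).comp ?_
        exact tendsto_const_nhds.add ((tendsto_one_div_add_atTop_nhds_zero_nat).pow 2)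
  simp only [hn] at lim
  exact (tendsto_nhds_unique lim tendsto_const_nhds)

/-- A primitive `G` of `D` is strictly increasing on `[0, Φ]`, so `Q₁ - Q₂` and `G(Q₁) - G(Q₂)` have
the same sign, and the integrand is `sign f * f'` for `f = G(Q₁) - G(Q₂)`. -/
lemma integral_sign_sub_mul_eq_zero_of_pos {Φ : ℝ} {D Q₁ Q₂ u₁ u₂ : ℝ → ℝ} (hD : Continuous D)
    (hpos : ∀ x ∈ Icc 0 Φ, 0 < D x)
    (h₁ : ∀ η ∈ Icc (0 : ℝ) 1, HasDerivWithinAt Q₁ (u₁ η) (Icc 0 1) η)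
    (h₂ : ∀ η ∈ Icc (0 : ℝ) 1, HasDerivWithinAt Q₂ (u₂ η) (Icc 0 1) η)
    (c₁ : ContinuousOn u₁ (Icc 0 1)) (c₂ : ContinuousOn u₂ (Icc 0 1))
    (m₁ : MapsTo Q₁ (Icc 0 1) (Icc 0 Φ)) (m₂ : MapsTo Q₂ (Icc 0 1) (Icc 0 Φ))
    (e0 : Q₁ 0 = Q₂ 0) (e1 : Q₁ 1 = Q₂ 1) :
    ∫ η in (0 : ℝ)..1, Real.sign (Q₁ η - Q₂ η) * (D (Q₁ η) * u₁ η - D (Q₂ η) * u₂ η) = 0 := by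
  set G : ℝ → ℝ := fun x => ∫ y in (0 : ℝ)..x, D y with hG
  have dG : ∀ x, HasDerivAt G (D x) x := fun x => (hD.integral_hasStrictDerivAt 0 x).hasDerivAt
  have sG : StrictMonoOn G (Icc 0 Φ) := by
    refine strictMonoOn_of_deriv_pos (convex_Icc _ _)
      (fun x _ => (dG x).continuousAt.continuousWithinAt) fun x hx => ?_
    rw [(dG x).deriv]
    exact hpos x (interior_subset hx)
  have cQ₁ : ContinuousOn Q₁ (Icc 0 1) := fun η hη => (h₁ η hη).continuousWithinAt
  have cQ₂ : ContinuousOn Q₂ (Icc 0 1) := fun η hη => (h₂ η hη).continuousWithinAt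
  have key := integral_sign_mul_deriv_eq_zero (f := fun η => G (Q₁ η) - G (Q₂ η))
    (f' := fun η => D (Q₁ η) * u₁ η - D (Q₂ η) * u₂ η)
    (fun η hη => ((dG _).comp_hasDerivWithinAt η (h₁ η hη)).sub
      ((dG _).comp_hasDerivWithinAt η (h₂ η hη)))
    (((hD.comp_continuousOn cQ₁).mul c₁).sub ((hD.comp_continuousOn cQ₂).mul c₂))
    (by simp [e0]) (by simp [e1])
  refine Eq.trans ?_ key
  refine intervalIntegral.integral_congr ?_
  intro η hη
  rw [uIcc_of_le zero_le_one] at hη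
  simp only
  congr 1
  rcases lt_trichotomy (Q₁ η) (Q₂ η) with h | h | h
  · rw [Real.sign_of_neg (sub_neg.2 h), Real.sign_of_neg (sub_neg.2 (sG (m₁ hη) (m₂ hη) h))]
  · simp [h]
  · rw [Real.sign_of_pos (sub_pos.2 h), Real.sign_of_pos (sub_pos.2 (sG (m₂ hη) (m₁ hη) h))]

/-- The integral is linear in `D`, and `D` is the difference of `D + (|C| + 1)` and `|C| + 1`, both
positive on `[0, Φ]` when `C` bounds `|D|` there. -/
lemma integral_sign_sub_mul_eq_zero {Φ : ℝ} {D Q₁ Q₂ u₁ u₂ : ℝ → ℝ} (hD : Continuous D)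
    (h₁ : ∀ η ∈ Icc (0 : ℝ) 1, HasDerivWithinAt Q₁ (u₁ η) (Icc 0 1) η)
    (h₂ : ∀ η ∈ Icc (0 : ℝ) 1, HasDerivWithinAt Q₂ (u₂ η) (Icc 0 1) η)
    (c₁ : ContinuousOn u₁ (Icc 0 1)) (c₂ : ContinuousOn u₂ (Icc 0 1))
    (m₁ : MapsTo Q₁ (Icc 0 1) (Icc 0 Φ)) (m₂ : MapsTo Q₂ (Icc 0 1) (Icc 0 Φ))
    (e0 : Q₁ 0 = Q₂ 0) (e1 : Q₁ 1 = Q₂ 1) :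
    ∫ η in (0 : ℝ)..1, Real.sign (Q₁ η - Q₂ η) * (D (Q₁ η) * u₁ η - D (Q₂ η) * u₂ η) = 0 := by
  obtain ⟨C, hC⟩ := (isCompact_Icc (a := (0 : ℝ)) (b := Φ)).exists_bound_of_continuousOn
    hD.continuousOn
  have cQ₁ : ContinuousOn Q₁ (Icc 0 1) := fun η hη => (h₁ η hη).continuousWithinAt
  have cQ₂ : ContinuousOn Q₂ (Icc 0 1) := fun η hη => (h₂ η hη).continuousWithinAt
  have k1 := integral_sign_sub_mul_eq_zero_of_pos (Φ := Φ) (D := fun x => D x + (|C| + 1))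
    (by fun_prop) (fun x hx => by
      have := hC x hx
      rw [Real.norm_eq_abs, abs_le] at this
      linarith [le_abs_self C]) h₁ h₂ c₁ c₂ m₁ m₂ e0 e1
  have k2 := integral_sign_sub_mul_eq_zero_of_pos (Φ := Φ) (D := fun _ => |C| + 1)
    (by fun_prop) (fun x hx => by positivity) h₁ h₂ c₁ c₂ m₁ m₂ e0 e1
  have := intervalIntegral.integral_sub (μ := volume)
    (intervalIntegrable_sign_mul (cQ₁.sub cQ₂)
      (X := fun η => (D (Q₁ η) + (|C| + 1)) * u₁ η - (D (Q₂ η) + (|C| + 1)) * u₂ η)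
      ((((hD.comp_continuousOn cQ₁).add continuousOn_const).mul c₁).sub
        (((hD.comp_continuousOn cQ₂).add continuousOn_const).mul c₂)))
    (intervalIntegrable_sign_mul (cQ₁.sub cQ₂)
      (X := fun η => (|C| + 1) * u₁ η - (|C| + 1) * u₂ η)
      ((continuousOn_const.mul c₁).sub (continuousOn_const.mul c₂)))
  simp only [Pi.sub_apply] at this
  rw [k1, k2, sub_zero] at this
  refine Eq.trans ?_ this
  refine intervalIntegral.integral_congr ?_
  intro η _
  simp only
  ring

/-! ### The regularised sign and the pointwise comparison of signs. -/

/-- The regularised sign `w / √(w² + ε²)`. -/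
noncomputable def softSign (ε w : ℝ) : ℝ := w / √(w ^ 2 + ε ^ 2)

lemma sqrt_sq_add_pos {ε : ℝ} (hε : 0 < ε) (w : ℝ) : 0 < √(w ^ 2 + ε ^ 2) := Real.sqrt_pos.2 (by positivity)

lemma abs_le_sqrt_sq_add (ε w : ℝ) : |w| ≤ √(w ^ 2 + ε ^ 2) :=
  Real.abs_le_sqrt (by linarith [sq_nonneg ε])

lemma sqrt_sq_add_le {ε : ℝ} (hε : 0 < ε) (w : ℝ) : √(w ^ 2 + ε ^ 2) ≤ |w| + ε := by
  rw [Real.sqrt_le_left (by positivity)]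
  nlinarith [sq_abs w, abs_nonneg w]

/-- The right side is `√(w² + ε²) - ε² / √(w² + ε²)`, and `ε ≤ √(w² + ε²)`. -/
lemma softSign_mul_self_ge {ε : ℝ} (hε : 0 < ε) (w : ℝ) : √(w ^ 2 + ε ^ 2) - ε ≤ softSign ε w * w := by
  have h := sqrt_sq_add_pos hε w
  have h2 : ε ≤ √(w ^ 2 + ε ^ 2) := Real.le_sqrt_of_sq_le (by linarith [sq_nonneg w])
  rw [softSign, div_mul_eq_mul_div, le_div_iff₀ h]
  nlinarith [Real.sq_sqrt (show 0 ≤ w ^ 2 + ε ^ 2 by positivity)]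

lemma abs_softSign_le {ε : ℝ} (hε : 0 < ε) (w : ℝ) : |softSign ε w| ≤ 1 := by
  rw [softSign, abs_div, abs_of_pos (sqrt_sq_add_pos hε w), div_le_one (sqrt_sq_add_pos hε w)]
  exact abs_le_sqrt_sq_add ε w

lemma softSign_neg (ε w : ℝ) : softSign ε (-w) = -softSign ε w := by
  simp [softSign, neg_div]

/-- If the weights satisfy `p ≤ r` then the regularised sign of `a - b` tests `p a - r b`
at least as well as the constant `1`, up to `O(ε)`. -/
lemma softSign_mul_ge_of_le {ε a b p r C : ℝ} (hε : 0 < ε) (hb : 0 ≤ b) (hp : 0 ≤ p)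
    (hpC : p ≤ C) (hpr : p ≤ r) :
    p * a - r * b - C * ε ≤ softSign ε (a - b) * (p * a - r * b) := by
  have h1 := abs_le.1 (abs_softSign_le hε (a - b))
  have h2 := (abs_le_sqrt_sq_add ε (a - b)).trans
    (sub_le_iff_le_add.1 (softSign_mul_self_ge hε (a - b)))
  have hC : 0 ≤ C := hp.trans hpC
  -- For `b ≤ a` the loss is `(1 - softSign) * (p a - r b) ≤ p * (1 - softSign) * (a - b) ≤ p * ε`.
  -- For `a ≤ b` both factors on the right are non-positive, so there is no loss.
  rcases le_total b a with h | h
  · have hX : p * a - r * b ≤ p * (a - b) := by nlinarith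
    rw [abs_of_nonneg (sub_nonneg.2 h)] at h2
    have h3 : (1 - softSign ε (a - b)) * (p * a - r * b)
        ≤ (1 - softSign ε (a - b)) * (p * (a - b)) :=
      mul_le_mul_of_nonneg_left hX (by linarith)
    have h4 : p * ((1 - softSign ε (a - b)) * (a - b)) ≤ p * ε :=
      mul_le_mul_of_nonneg_left (by linarith) hp
    have h5 : p * ε ≤ C * ε := mul_le_mul_of_nonneg_right hpC hε.le
    nlinarith
  · have hs : softSign ε (a - b) ≤ 0 :=
      div_nonpos_of_nonpos_of_nonneg (by linarith) (Real.sqrt_nonneg _)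
    have hX : p * a - r * b ≤ 0 := by nlinarith [mul_le_mul_of_nonneg_left h hp]
    nlinarith [mul_nonneg_of_nonpos_of_nonpos hs hX, mul_nonneg hC hε.le]

/-- Symmetry: exchange `(a, p)` with `(b, r)` and use that the regularised sign is odd. -/
lemma softSign_mul_ge_of_ge {ε a b p r C : ℝ} (hε : 0 < ε) (ha : 0 ≤ a) (hr : 0 ≤ r)
    (hrC : r ≤ C) (hpr : r ≤ p) :
    -(p * a - r * b) - C * ε ≤ softSign ε (a - b) * (p * a - r * b) := by
  have := softSign_mul_ge_of_le (a := b) hε ha hr hrC hpr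
  rw [← neg_sub a b, softSign_neg] at this
  nlinarith

/-- This trades the sign of the density difference for the sign of the phase difference, whose
integral is known to vanish. Monotonicity of `D` turns the order of `x` and `y` into the order of
the weights `D x` and `D y`. -/
lemma softSign_mul_ge_of_antitoneOn {ε Φ C : ℝ} {D : ℝ → ℝ} (hε : 0 < ε)
    (hD : AntitoneOn D (Icc 0 Φ))
    (h0 : ∀ x ∈ Icc 0 Φ, 0 ≤ D x) (hC : ∀ x ∈ Icc 0 Φ, D x ≤ C) {x y a b : ℝ}
    (hx : x ∈ Icc 0 Φ) (hy : y ∈ Icc 0 Φ) (ha : 0 ≤ a) (hb : 0 ≤ b) :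
    Real.sign (x - y) * (D x * a - D y * b) - C * ε
      ≤ softSign ε (a - b) * (D x * a - D y * b) := by
  rcases lt_trichotomy x y with h | rfl | h
  · rw [Real.sign_of_neg (sub_neg.2 h), neg_one_mul]
    exact softSign_mul_ge_of_ge hε ha (h0 y hy) (hC y hy) (hD hx hy h.le)
  · have h1 := abs_nonneg (a - b)
    have h2 : 0 ≤ softSign ε (a - b) * (a - b) := by
      rw [softSign, div_mul_eq_mul_div]
      exact div_nonneg (mul_self_nonneg _) (Real.sqrt_nonneg _)
    have h3 := mul_nonneg (h0 x hx) h2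
    have h4 := mul_nonneg ((h0 x hx).trans (hC x hx)) hε.le
    simp only [sub_self, Real.sign_zero, zero_mul]
    nlinarith
  · rw [Real.sign_of_pos (sub_pos.2 h), one_mul]
    exact softSign_mul_ge_of_le hε hb (h0 x hx) (hC x hx) (hD hy hx h.le)

/-- The order of the weights is reversed compared with the antitone case, hence the opposite sign of
the phase difference; its integral vanishes all the same. -/
lemma softSign_mul_ge_of_monotoneOn {ε Φ C : ℝ} {D : ℝ → ℝ} (hε : 0 < ε)
    (hD : MonotoneOn D (Icc 0 Φ))
    (h0 : ∀ x ∈ Icc 0 Φ, 0 ≤ D x) (hC : ∀ x ∈ Icc 0 Φ, D x ≤ C) {x y a b : ℝ}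
    (hx : x ∈ Icc 0 Φ) (hy : y ∈ Icc 0 Φ) (ha : 0 ≤ a) (hb : 0 ≤ b) :
    -(Real.sign (x - y) * (D x * a - D y * b)) - C * ε
      ≤ softSign ε (a - b) * (D x * a - D y * b) := by
  rcases lt_trichotomy x y with h | rfl | h
  · rw [Real.sign_of_neg (sub_neg.2 h), neg_one_mul, neg_neg]
    exact softSign_mul_ge_of_le hε hb (h0 x hx) (hC x hx) (hD hx hy h.le)
  · have h2 : 0 ≤ softSign ε (a - b) * (a - b) := by
      rw [softSign, div_mul_eq_mul_div]
      exact div_nonneg (mul_self_nonneg _) (Real.sqrt_nonneg _)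
    have h3 := mul_nonneg (h0 x hx) h2
    have h4 := mul_nonneg ((h0 x hx).trans (hC x hx)) hε.le
    simp only [sub_self, Real.sign_zero, zero_mul, neg_zero]
    nlinarith
  · rw [Real.sign_of_pos (sub_pos.2 h), one_mul]
    exact softSign_mul_ge_of_ge hε ha (h0 y hy) (hC y hy) (hD hy hx h.le)

/-! ### The phase response function and the splitting of its derivative. -/

section PhaseResponse

variable {Φ : ℝ} {K : ℝ → ℝ}

lemma IsPhaseResponse.contDiff_deriv (hK : IsPhaseResponse Φ K) : ContDiff ℝ 1 (deriv K) :=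
  ((contDiff_succ_iff_deriv (n := 1)).1 hK.contDiff).2.2

lemma IsPhaseResponse.differentiable (hK : IsPhaseResponse Φ K) : Differentiable ℝ K :=
  hK.contDiff.differentiable (by simp)

lemma IsPhaseResponse.hasDerivAt (hK : IsPhaseResponse Φ K) (x : ℝ) :
    HasDerivAt K (deriv K x) x := (hK.differentiable x).hasDerivAt

lemma IsPhaseResponse.continuous (hK : IsPhaseResponse Φ K) : Continuous K :=
  hK.contDiff.continuous

lemma IsPhaseResponse.continuous_deriv (hK : IsPhaseResponse Φ K) : Continuous (deriv K) :=
  hK.contDiff_deriv.continuous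

lemma IsPhaseResponse.continuous_deriv_deriv (hK : IsPhaseResponse Φ K) :
    Continuous (deriv (deriv K)) := hK.contDiff_deriv.continuous_deriv le_rfl

lemma IsPhaseResponse.hasDerivAt_deriv (hK : IsPhaseResponse Φ K) (x : ℝ) :
    HasDerivAt (deriv K) (deriv (deriv K) x) x :=
  (hK.contDiff_deriv.differentiable (by simp) x).hasDerivAt

/-- On `[0, Φ]` the derivative of `K` is `k_max` minus a non-increasing and a non-decreasing
non-negative function. -/
lemma IsPhaseResponse.exists_deriv_eq_sub (hK : IsPhaseResponse Φ K) :
    ∃ (D₁ D₂ : ℝ → ℝ) (C : ℝ), Continuous D₁ ∧ Continuous D₂ ∧ AntitoneOn D₁ (Icc 0 Φ) ∧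
      MonotoneOn D₂ (Icc 0 Φ) ∧ (∀ x ∈ Icc 0 Φ, 0 ≤ D₁ x) ∧ (∀ x ∈ Icc 0 Φ, 0 ≤ D₂ x) ∧
      (∀ x ∈ Icc 0 Φ, D₁ x ≤ C) ∧ (∀ x ∈ Icc 0 Φ, D₂ x ≤ C) ∧
      ∀ x, deriv K x = kMax Φ K - D₁ x - D₂ x := by
  have c2 := hK.continuous_deriv_deriv
  set p : ℝ → ℝ := fun x => max (deriv (deriv K) x) 0 with hp
  set m : ℝ → ℝ := fun x => max (-deriv (deriv K) x) 0 with hm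
  have cp : Continuous p := c2.max continuous_const
  have cm : Continuous m := c2.neg.max continuous_const
  have ip : ∀ a b, IntervalIntegrable p volume a b := fun a b => cp.intervalIntegrable a b
  have im : ∀ a b, IntervalIntegrable m volume a b := fun a b => cm.intervalIntegrable a b
  have np : ∀ x, 0 ≤ p x := fun x => le_max_right _ _
  have nm : ∀ x, 0 ≤ m x := fun x => le_max_right _ _
  set P : ℝ → ℝ := fun x => ∫ y in (0 : ℝ)..x, p y with hP
  set M : ℝ → ℝ := fun x => ∫ y in (0 : ℝ)..x, m y with hM
  have cP : Continuous P := intervalIntegral.continuous_primitive ip 0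
  have cM : Continuous M := intervalIntegral.continuous_primitive im 0
  have mP : Monotone P := fun a b hab => by
    rw [← sub_nonneg, hP]
    simp only
    rw [intervalIntegral.integral_interval_sub_left (ip _ _) (ip _ _)]
    exact intervalIntegral.integral_nonneg hab fun x _ => np x
  have mM : Monotone M := fun a b hab => by
    rw [← sub_nonneg, hM]
    simp only
    rw [intervalIntegral.integral_interval_sub_left (im _ _) (im _ _)]
    exact intervalIntegral.integral_nonneg hab fun x _ => nm x
  have P0 : P 0 = 0 := by simp [hP]
  have M0 : M 0 = 0 := by simp [hM]
  -- `P` and `M` are the primitives of the positive and negative parts of `K''`, so `K' = K'(0) + P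
  -- - M = (K'(0) + P Φ) - (P Φ - P) - M`, and the bracket is `kMax`.
  refine ⟨fun x => P Φ - P x, M, max (P Φ) (M Φ), by fun_prop, cM, fun a _ b _ hab => ?_,
    mM.monotoneOn _, fun x hx => sub_nonneg.2 (mP hx.2), fun x hx => M0 ▸ mM hx.1,
    fun x hx => ?_, fun x hx => (mM hx.2).trans (le_max_right _ _), fun x => ?_⟩
  · exact sub_le_sub_left (mP hab) _
  · have := mP hx.1
    rw [P0] at this
    exact (by linarith : P Φ - P x ≤ P Φ).trans (le_max_left _ _)
  · have h1 : ∫ y in (0 : ℝ)..x, deriv (deriv K) y = deriv K x - deriv K 0 :=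
      intervalIntegral.integral_eq_sub_of_hasDerivAt (fun y _ => hK.hasDerivAt_deriv y)
        (c2.intervalIntegrable _ _)
    have h2 : P x - M x = ∫ y in (0 : ℝ)..x, deriv (deriv K) y := by
      rw [hP, hM]
      simp only
      rw [← intervalIntegral.integral_sub (ip _ _) (im _ _)]
      refine intervalIntegral.integral_congr ?_
      intro y _
      simp only [hp, hm]
      rcases le_total 0 (deriv (deriv K) y) with h | h
      · rw [max_eq_left h, max_eq_right (by linarith), sub_zero]
      · rw [max_eq_right h, max_eq_left (by linarith), zero_sub, neg_neg]
    have h3 : kMax Φ K = deriv K 0 + P Φ := rfl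
    rw [h3]
    linarith

lemma IsPhaseResponse.deriv_le_kMax (hK : IsPhaseResponse Φ K) {x : ℝ} (hx : x ∈ Icc 0 Φ) :
    deriv K x ≤ kMax Φ K := by
  obtain ⟨D₁, D₂, C, -, -, -, -, h1, h2, -, -, e⟩ := hK.exists_deriv_eq_sub
  linarith [e x, h1 x hx, h2 x hx]

end PhaseResponse

/-! ### Time intervals and solutions along characteristics. -/

lemma zero_mem_timeInterval {T : EReal} (hT : 0 < T) : (0 : ℝ) ∈ timeInterval T :=
  ⟨le_rfl, by simpa using hT⟩

lemma mem_timeInterval_of_le {T : EReal} {s t : ℝ} (ht : t ∈ timeInterval T) (h0 : 0 ≤ s)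
    (hst : s ≤ t) : s ∈ timeInterval T :=
  ⟨h0, lt_of_le_of_lt (EReal.coe_le_coe_iff.2 hst) ht.2⟩

lemma exists_gt_mem_timeInterval {T : EReal} {t : ℝ} (ht : t ∈ timeInterval T) :
    ∃ b > t, b ∈ timeInterval T := by
  obtain ⟨b, h1, h2⟩ := EReal.lt_iff_exists_real_btwn.1 ht.2
  have : t < b := EReal.coe_lt_coe_iff.1 h1
  exact ⟨b, this, ht.1.trans this.le, h2⟩

lemma timeInterval_mem_nhds {T : EReal} {t : ℝ} (ht : t ∈ timeInterval T) (h0 : 0 < t) :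
    timeInterval T ∈ 𝓝 t := by
  obtain ⟨b, hb, hbT⟩ := exists_gt_mem_timeInterval ht
  filter_upwards [Icc_mem_nhds h0 hb] with s hs
  exact mem_timeInterval_of_le hbT hs.1 hs.2

lemma convex_timeInterval (T : EReal) : Convex ℝ (timeInterval T) := by
  refine OrdConnected.convex ⟨fun a ha b hb x hx => ?_⟩
  exact mem_timeInterval_of_le hb (ha.1.trans hx.1) hx.2

lemma uniqueDiffOn_timeInterval {T : EReal} (hT : 0 < T) : UniqueDiffOn ℝ (timeInterval T) := by
  refine uniqueDiffOn_convex (convex_timeInterval T) ?_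
  obtain ⟨b, hb, hbT⟩ := exists_gt_mem_timeInterval (zero_mem_timeInterval hT)
  exact ⟨b / 2, mem_interior_iff_mem_nhds.2 (timeInterval_mem_nhds
    (mem_timeInterval_of_le hbT (by linarith) (by linarith)) (by linarith))⟩

lemma timeInterval_top : timeInterval ⊤ = Ici 0 := by
  ext τ
  simp [timeInterval]

/-- Solutions of the system on `[0, T)`, with the density `u = ∂_η Q` and the rate `n = 1 / N`,
where the equation is imposed along characteristics. No sign conditions are imposed. -/
structure IsRegularSolution (Φ : ℝ) (K : ℝ → ℝ) (T : EReal) (Q u : ℝ → ℝ → ℝ) (n : ℝ → ℝ) :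
    Prop where
  continuousOn : ContinuousOn (fun p : ℝ × ℝ => Q p.1 p.2) (timeInterval T ×ˢ Icc 0 1)
  continuousOn_density : ContinuousOn (fun p : ℝ × ℝ => u p.1 p.2) (timeInterval T ×ˢ Icc 0 1)
  continuousOn_rate : ContinuousOn n (timeInterval T)
  hasDerivWithinAt : ∀ τ ∈ timeInterval T, ∀ η ∈ Icc (0 : ℝ) 1,
    HasDerivWithinAt (Q τ) (u τ η) (Icc 0 1) η
  hasDerivAt_char : ∀ t ∈ timeInterval T, 0 < t → ∀ x ∈ Ioo (0 : ℝ) 1,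
    HasDerivAt (fun r => Q (t + r) (x + r)) (n t + K (Q t x)) 0
  left : ∀ τ ∈ timeInterval T, Q τ 0 = 0
  right : ∀ τ ∈ timeInterval T, Q τ 1 = Φ
  density_left : ∀ τ ∈ timeInterval T, u τ 0 = n τ + K 0
  density_right : ∀ τ ∈ timeInterval T, u τ 1 = n τ + K Φ

lemma IsRegularSolution.mono {Φ : ℝ} {K : ℝ → ℝ} {T T' : EReal} {Q u : ℝ → ℝ → ℝ} {n : ℝ → ℝ}
    (h : IsRegularSolution Φ K T Q u n) (hT : T' ≤ T) : IsRegularSolution Φ K T' Q u n := by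
  have hs : timeInterval T' ⊆ timeInterval T := fun t ht => ⟨ht.1, ht.2.trans_le hT⟩
  exact ⟨h.continuousOn.mono (prod_mono hs le_rfl), h.continuousOn_density.mono (prod_mono hs le_rfl),
    h.continuousOn_rate.mono hs, fun τ hτ => h.hasDerivWithinAt τ (hs hτ),
    fun t ht => h.hasDerivAt_char t (hs ht), fun τ hτ => h.left τ (hs hτ),
    fun τ hτ => h.right τ (hs hτ), fun τ hτ => h.density_left τ (hs hτ),
    fun τ hτ => h.density_right τ (hs hτ)⟩

section Regular

variable {Φ : ℝ} {K : ℝ → ℝ} {T : EReal} {Q u : ℝ → ℝ → ℝ} {n : ℝ → ℝ}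

/-- The density satisfies `∂_τ u + ∂_η u = K'(Q) u` along characteristics. -/
lemma IsRegularSolution.hasDerivAt_density_char (hK : IsPhaseResponse Φ K)
    (h : IsRegularSolution Φ K T Q u n) {t x : ℝ} (ht : t ∈ timeInterval T) (ht0 : 0 < t)
    (hx : x ∈ Ioo (0 : ℝ) 1) :
    HasDerivAt (fun r => u (t + r) (x + r)) (deriv K (Q t x) * u t x) 0 := by
  obtain ⟨b, hb, hbT⟩ := exists_gt_mem_timeInterval ht
  -- The factor `2` leaves room for moving the foot point of the characteristic by `ρ` and then
  -- following it for a time `ρ`.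
  obtain ⟨ρ, hρ, hρ1, hρ2, hρ3, hρ4⟩ : ∃ ρ > 0, 2 * ρ < t ∧ 2 * ρ < b - t ∧ 2 * ρ < x ∧
      2 * ρ < 1 - x := by
    have h1 : 0 < b - t := by linarith
    have h2 : 0 < 1 - x := by linarith [hx.2]
    have h3 := hx.1
    refine ⟨min (min t (b - t)) (min x (1 - x)) / 4, by positivity, ?_⟩
    have m1 := min_le_left (min t (b - t)) (min x (1 - x))
    have m2 := min_le_right (min t (b - t)) (min x (1 - x))
    have m3 := min_le_left t (b - t)
    have m4 := min_le_right t (b - t)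
    have m5 := min_le_left x (1 - x)
    have m6 := min_le_right x (1 - x)
    refine ⟨?_, ?_, ?_, ?_⟩ <;> linarith
  have memT : ∀ s, |s| ≤ ρ → t + s ∈ timeInterval T := fun s hs => by
    rw [abs_le] at hs
    exact mem_timeInterval_of_le hbT (by linarith) (by linarith)
  have memX : ∀ y s, |y - x| ≤ ρ → |s| ≤ ρ → y + s ∈ Ioo (0 : ℝ) 1 := fun y s hy hs => by
    rw [abs_le] at hs hy
    exact ⟨by linarith, by linarith⟩
  have cK := hK.continuous
  have cK' := hK.continuous_deriv
  set g : ℝ → ℝ → ℝ := fun t x => deriv K (Q t x) * u t x with hg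
  have cg : ContinuousOn (fun p : ℝ × ℝ => g p.1 p.2) (timeInterval T ×ˢ Icc 0 1) :=
    (cK'.comp_continuousOn h.continuousOn).mul h.continuousOn_density
  have maps : ∀ y, |y - x| ≤ ρ → MapsTo (fun s => (t + s, y + s)) (Icc (-ρ) ρ)
      (timeInterval T ×ˢ Icc 0 1) := fun y hy s hs => by
    have hs' := abs_le.2 hs
    exact ⟨memT s hs', Ioo_subset_Icc_self (memX y s hy hs')⟩
  have cont : ∀ y, |y - x| ≤ ρ → ContinuousOn (fun s => n (t + s) + K (Q (t + s) (y + s)))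
      (Icc (-ρ) ρ) := fun y hy => by
    refine ContinuousOn.add ?_ ?_
    · exact h.continuousOn_rate.comp (by fun_prop) fun s hs => memT s (abs_le.2 hs)
    · exact (cK.comp_continuousOn h.continuousOn).comp
        (f := fun s => (t + s, y + s)) (by fun_prop) (maps y hy)
  have contg : ContinuousOn (fun s => g (t + s) (x + s)) (Icc (-ρ) ρ) :=
    cg.comp (f := fun s => (t + s, x + s)) (by fun_prop) (maps x (by simp [hρ.le]))
  have sub_uIcc : ∀ r, |r| ≤ ρ → uIcc 0 r ⊆ Icc (-ρ) ρ := fun r hr s hs => by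
    rw [abs_le] at hr
    rcases le_total 0 r with h' | h'
    · rw [uIcc_of_le h'] at hs; exact ⟨by linarith [hs.1], by linarith [hs.2]⟩
    · rw [uIcc_of_ge h'] at hs; exact ⟨by linarith [hs.1], by linarith [hs.2]⟩
  have int_eq : ∀ r y, |r| ≤ ρ → |y - x| ≤ ρ →
      ∫ s in (0 : ℝ)..r, (n (t + s) + K (Q (t + s) (y + s))) = Q (t + r) (y + r) - Q t y := by
    intro r y hr hy
    rw [intervalIntegral.integral_eq_sub_of_hasDerivAt (f := fun s => Q (t + s) (y + s))]
    · simp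
    · intro s hs
      have hs' := abs_le.2 (sub_uIcc r hr hs)
      have := h.hasDerivAt_char (t + s) (memT s hs') (by rw [abs_le] at hs'; linarith) (y + s)
        (memX y s hy hs')
      have h2 := this.comp_of_eq s ((hasDerivAt_id s).sub_const s) (by simp)
      rw [mul_one] at h2
      refine h2.congr_of_eventuallyEq (Eventually.of_forall fun r => ?_)
      simp
    · exact ((cont y hy).mono (sub_uIcc r hr)).intervalIntegrable
  obtain ⟨C, hC⟩ : ∃ C, ∀ s y, |s| ≤ ρ → |y - x| ≤ ρ → ‖g (t + s) (y + s)‖ ≤ C := by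
    have hcomp : IsCompact (Icc (t - ρ) (t + ρ) ×ˢ Icc (0 : ℝ) 1) :=
      isCompact_Icc.prod isCompact_Icc
    obtain ⟨C, hC⟩ := hcomp.exists_bound_of_continuousOn (cg.mono (prod_mono (fun s hs =>
      mem_timeInterval_of_le hbT (by linarith [hs.1]) (by linarith [hs.2])) le_rfl))
    refine ⟨C, fun s y hs hy => hC (t + s, y + s) ⟨?_, Ioo_subset_Icc_self (memX y s hy hs)⟩⟩
    rw [abs_le] at hs
    exact ⟨by linarith, by linarith⟩
  -- `u` need not be differentiable in `η`, so the equation for `Q` cannot be differentiated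
  -- directly. Its integrated form along characteristics is differentiated in the foot point `y`
  -- instead, under the integral sign.
  have density_eq : ∀ r, |r| < ρ →
      u (t + r) (x + r) - u t x = ∫ s in (0 : ℝ)..r, g (t + s) (x + s) := by
    intro r hr
    have hx0 : |x - x| ≤ ρ := by simp [hρ.le]
    have dQ : ∀ s y, |s| ≤ ρ → |y - x| ≤ ρ →
        HasDerivAt (fun y => Q (t + s) (y + s)) (u (t + s) (y + s)) y := fun s y hs hy => by
      have hm := memX y s hy hs
      have := (h.hasDerivWithinAt (t + s) (memT s hs) (y + s)
        (Ioo_subset_Icc_self hm)).hasDerivAt (Icc_mem_nhds hm.1 hm.2)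
      simpa using this.comp_add_const y s
    have d1 : HasDerivAt (fun y => Q (t + r) (y + r) - Q t y) (u (t + r) (x + r) - u t x) x := by
      have := dQ 0 x (by simp [hρ.le]) hx0
      simp only [add_zero] at this
      exact (dQ r x hr.le hx0).sub this
    have d2 := (intervalIntegral.hasDerivAt_integral_of_dominated_loc_of_deriv_le
      (μ := volume) (a := 0) (b := r) (x₀ := x) (s := Metric.ball x ρ)
      (F := fun y s => n (t + s) + K (Q (t + s) (y + s)))
      (F' := fun y s => g (t + s) (y + s)) (bound := fun _ => C)
      (Metric.ball_mem_nhds x hρ) ?_ ?_ ?_ ?_ (by simp) ?_).2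
    · refine d1.unique (d2.congr_of_eventuallyEq ?_)
      filter_upwards [Metric.ball_mem_nhds x hρ] with y hy
      rw [Metric.mem_ball, Real.dist_eq] at hy
      exact (int_eq r y hr.le hy.le).symm
    · filter_upwards [Metric.ball_mem_nhds x hρ] with y hy
      rw [Metric.mem_ball, Real.dist_eq] at hy
      exact ((cont y hy.le).mono (uIoc_subset_uIcc.trans (sub_uIcc r hr.le))).aestronglyMeasurable
        measurableSet_uIoc
    · exact ((cont x hx0).mono (sub_uIcc r hr.le)).intervalIntegrable
    · exact (contg.mono (uIoc_subset_uIcc.trans (sub_uIcc r hr.le))).aestronglyMeasurable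
        measurableSet_uIoc
    · refine Eventually.of_forall fun s hs y hy => ?_
      rw [Metric.mem_ball, Real.dist_eq] at hy
      exact hC s y (abs_le.2 (sub_uIcc r hr.le (uIoc_subset_uIcc hs))) hy.le
    · refine Eventually.of_forall fun s hs y hy => ?_
      rw [Metric.mem_ball, Real.dist_eq] at hy
      have hs' := abs_le.2 (sub_uIcc r hr.le (uIoc_subset_uIcc hs))
      exact ((hK.hasDerivAt _).comp y (dQ s y hs' hy.le)).const_add _
  have h0 : Ioo (-ρ) ρ ∈ 𝓝 (0 : ℝ) := Ioo_mem_nhds (by linarith) hρ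
  have hcg : ContinuousOn (fun s => g (t + s) (x + s)) (Ioo (-ρ) ρ) :=
    contg.mono Ioo_subset_Icc_self
  have key := intervalIntegral.integral_hasDerivAt_right (a := 0) (b := 0)
    (f := fun s => g (t + s) (x + s)) (by simp)
    (hcg.stronglyMeasurableAtFilter isOpen_Ioo 0 (mem_of_mem_nhds h0)) (hcg.continuousAt h0)
  have key' := key.add_const (u t x)
  simp only [add_zero] at key'
  refine key'.congr_of_eventuallyEq ?_
  filter_upwards [h0] with r hr
  linarith [density_eq r (abs_lt.2 hr)]

lemma IsRegularSolution.mapsTo (h : IsRegularSolution Φ K T Q u n) {τ : ℝ}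
    (hτ : τ ∈ timeInterval T) (hu : ∀ η ∈ Icc (0 : ℝ) 1, 0 ≤ u τ η) :
    MapsTo (Q τ) (Icc 0 1) (Icc 0 Φ) := by
  have hm : MonotoneOn (Q τ) (Icc 0 1) := by
    refine monotoneOn_of_hasDerivWithinAt_nonneg (convex_Icc 0 1)
      (fun η hη => (h.hasDerivWithinAt τ hτ η hη).continuousWithinAt)
      (fun η hη => (h.hasDerivWithinAt τ hτ η (interior_subset hη)).mono interior_subset)
      fun η hη => hu η (interior_subset hη)
  intro η hη
  have h0 := hm (left_mem_Icc.2 zero_le_one) hη hη.1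
  have h1 := hm hη (right_mem_Icc.2 zero_le_one) hη.2
  rw [h.left τ hτ] at h0
  rw [h.right τ hτ] at h1
  exact ⟨h0, h1⟩

end Regular

/-! ### Contraction of densities in `L¹`. -/

lemma continuousOn_parametric_integral {v : ℝ → ℝ → ℝ} {a b : ℝ} (hab : a ≤ b)
    (cv : ContinuousOn (fun p : ℝ × ℝ => v p.1 p.2) (Icc a b ×ˢ Icc 0 1)) :
    ContinuousOn (fun t => ∫ η in (0 : ℝ)..1, v t η) (Icc a b) := by
  have hc : Continuous (fun p : ℝ × ℝ => v (projIcc a b hab p.1) (projIcc 0 1 zero_le_one p.2)) :=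
    cv.comp_continuous (f := fun p : ℝ × ℝ => ((projIcc a b hab p.1 : ℝ),
      (projIcc 0 1 zero_le_one p.2 : ℝ)))
      (by
        refine Continuous.prodMk ?_ ?_
        · exact continuous_subtype_val.comp (continuous_projIcc.comp continuous_fst)
        · exact continuous_subtype_val.comp (continuous_projIcc.comp continuous_snd))
      fun p => ⟨Subtype.coe_prop _, Subtype.coe_prop _⟩
  have := intervalIntegral.continuous_parametric_intervalIntegral_of_continuous' (μ := volume)
    (f := fun t η => v (projIcc a b hab t) (projIcc 0 1 zero_le_one η)) hc 0 1
  refine this.continuousOn.congr fun t ht => ?_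
  refine intervalIntegral.integral_congr ?_
  intro η hη
  rw [uIcc_of_le zero_le_one] at hη
  simp only [projIcc_of_mem hab ht, projIcc_of_mem zero_le_one hη]

section Contraction

variable {Φ : ℝ} {K : ℝ → ℝ} {T : EReal} {Q₁ u₁ Q₂ u₂ : ℝ → ℝ → ℝ} {n₁ n₂ : ℝ → ℝ}

/-- The differential inequality behind the contraction. The terms of `D₁` and `D₂` are compared with
sign integrals that vanish, at a cost of `C * ε` each; the constant part of `K'` costs `-kMax * ε`.
-/
lemma IsRegularSolution.integral_softSign_le {ε : ℝ} (hε : 0 < ε) (hK : IsPhaseResponse Φ K)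
    (hk : kMax Φ K < 0) {D₁ D₂ : ℝ → ℝ} {C : ℝ} (cD₁ : Continuous D₁) (cD₂ : Continuous D₂)
    (mD₁ : AntitoneOn D₁ (Icc 0 Φ)) (mD₂ : MonotoneOn D₂ (Icc 0 Φ))
    (pD₁ : ∀ x ∈ Icc 0 Φ, 0 ≤ D₁ x) (pD₂ : ∀ x ∈ Icc 0 Φ, 0 ≤ D₂ x)
    (bD₁ : ∀ x ∈ Icc 0 Φ, D₁ x ≤ C) (bD₂ : ∀ x ∈ Icc 0 Φ, D₂ x ≤ C)
    (eK : ∀ x, deriv K x = kMax Φ K - D₁ x - D₂ x)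
    (h₁ : IsRegularSolution Φ K T Q₁ u₁ n₁) (h₂ : IsRegularSolution Φ K T Q₂ u₂ n₂)
    {τ : ℝ} (hτ : τ ∈ timeInterval T)
    (p₁ : ∀ η ∈ Icc (0 : ℝ) 1, 0 ≤ u₁ τ η) (p₂ : ∀ η ∈ Icc (0 : ℝ) 1, 0 ≤ u₂ τ η) :
    ∫ η in (0 : ℝ)..1, softSign ε (u₁ τ η - u₂ τ η) *
        (deriv K (Q₁ τ η) * u₁ τ η - deriv K (Q₂ τ η) * u₂ τ η)
      ≤ kMax Φ K * (∫ η in (0 : ℝ)..1, √((u₁ τ η - u₂ τ η) ^ 2 + ε ^ 2))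
        + (2 * C - kMax Φ K) * ε := by
  have m₁ := h₁.mapsTo hτ p₁
  have m₂ := h₂.mapsTo hτ p₂
  have slice : ∀ {f : ℝ → ℝ → ℝ},
      ContinuousOn (fun p : ℝ × ℝ => f p.1 p.2) (timeInterval T ×ˢ Icc 0 1) →
      ContinuousOn (f τ) (Icc 0 1) := fun hf =>
    hf.comp (f := fun x : ℝ => (τ, x)) (by fun_prop) fun x hx => ⟨hτ, hx⟩
  have cQ₁ := slice h₁.continuousOn
  have cQ₂ := slice h₂.continuousOn
  have cu₁ := slice h₁.continuousOn_density
  have cu₂ := slice h₂.continuousOn_density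
  have cj : ContinuousOn (fun η => √((u₁ τ η - u₂ τ η) ^ 2 + ε ^ 2)) (Icc 0 1) :=
    Real.continuous_sqrt.comp_continuousOn (((cu₁.sub cu₂).pow 2).add continuousOn_const)
  have csoft : ContinuousOn (fun η => softSign ε (u₁ τ η - u₂ τ η)) (Icc 0 1) :=
    (cu₁.sub cu₂).div cj fun η _ => (sqrt_sq_add_pos hε _).ne'
  have cX : ∀ {D : ℝ → ℝ}, Continuous D →
      ContinuousOn (fun η => D (Q₁ τ η) * u₁ τ η - D (Q₂ τ η) * u₂ τ η) (Icc 0 1) := fun hD =>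
    ((hD.comp_continuousOn cQ₁).mul cu₁).sub ((hD.comp_continuousOn cQ₂).mul cu₂)
  have ii : ∀ {f : ℝ → ℝ}, ContinuousOn f (Icc 0 1) → IntervalIntegrable f volume 0 1 :=
    fun hf => ContinuousOn.intervalIntegrable (by rwa [uIcc_of_le zero_le_one])
  have iS : ∀ {D : ℝ → ℝ}, Continuous D → IntervalIntegrable
      (fun η => Real.sign (Q₁ τ η - Q₂ τ η) * (D (Q₁ τ η) * u₁ τ η - D (Q₂ τ η) * u₂ τ η))
      volume 0 1 := fun hD => intervalIntegrable_sign_mul (cQ₁.sub cQ₂) (cX hD)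
  have zS : ∀ {D : ℝ → ℝ}, Continuous D → ∫ η in (0 : ℝ)..1,
      Real.sign (Q₁ τ η - Q₂ τ η) * (D (Q₁ τ η) * u₁ τ η - D (Q₂ τ η) * u₂ τ η) = 0 :=
    fun hD => integral_sign_sub_mul_eq_zero hD (h₁.hasDerivWithinAt τ hτ)
      (h₂.hasDerivWithinAt τ hτ) cu₁ cu₂ m₁ m₂ (by rw [h₁.left τ hτ, h₂.left τ hτ])
      (by rw [h₁.right τ hτ, h₂.right τ hτ])
  -- Two integrals equal to zero are inserted so that the claim becomes a pointwise inequality.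
  have e : kMax Φ K * (∫ η in (0 : ℝ)..1, √((u₁ τ η - u₂ τ η) ^ 2 + ε ^ 2))
        + (2 * C - kMax Φ K) * ε = ∫ η in (0 : ℝ)..1,
        (kMax Φ K * √((u₁ τ η - u₂ τ η) ^ 2 + ε ^ 2) + (2 * C - kMax Φ K) * ε
          - Real.sign (Q₁ τ η - Q₂ τ η) * (D₁ (Q₁ τ η) * u₁ τ η - D₁ (Q₂ τ η) * u₂ τ η)
          + Real.sign (Q₁ τ η - Q₂ τ η) * (D₂ (Q₁ τ η) * u₁ τ η - D₂ (Q₂ τ η) * u₂ τ η)) := by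
    rw [intervalIntegral.integral_add ((((ii cj).const_mul _).add (by simp)).sub (iS cD₁)) (iS cD₂),
      intervalIntegral.integral_sub (((ii cj).const_mul _).add (by simp)) (iS cD₁),
      intervalIntegral.integral_add ((ii cj).const_mul _) (by simp), zS cD₁, zS cD₂]
    simp
  rw [e]
  refine intervalIntegral.integral_mono_on zero_le_one
    (ii (csoft.mul (cX hK.continuous_deriv)))
    (((((ii cj).const_mul _).add (by simp)).sub (iS cD₁)).add (iS cD₂)) fun η hη => ?_
  have i1 := softSign_mul_ge_of_antitoneOn hε mD₁ pD₁ bD₁ (m₁ hη) (m₂ hη) (p₁ η hη) (p₂ η hη)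
  have i2 := softSign_mul_ge_of_monotoneOn hε mD₂ pD₂ bD₂ (m₁ hη) (m₂ hη) (p₁ η hη) (p₂ η hη)
  have i3 := softSign_mul_self_ge hε (u₁ τ η - u₂ τ η)
  have i4 := mul_le_mul_of_nonpos_left i3 hk.le
  rw [eK, eK]
  linarith

/-- Contraction of the densities in `L¹(0, 1)`. -/
theorem IsRegularSolution.integral_abs_sub_le (hK : IsPhaseResponse Φ K) (hk : kMax Φ K < 0)
    (h₁ : IsRegularSolution Φ K T Q₁ u₁ n₁) (h₂ : IsRegularSolution Φ K T Q₂ u₂ n₂)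
    (p₁ : ∀ t ∈ timeInterval T, ∀ η ∈ Icc (0 : ℝ) 1, 0 ≤ u₁ t η)
    (p₂ : ∀ t ∈ timeInterval T, ∀ η ∈ Icc (0 : ℝ) 1, 0 ≤ u₂ t η)
    {τ : ℝ} (hτ : τ ∈ timeInterval T) :
    ∫ η in (0 : ℝ)..1, |u₁ τ η - u₂ τ η|
      ≤ Real.exp (kMax Φ K * τ) * ∫ η in (0 : ℝ)..1, |u₁ 0 η - u₂ 0 η| := by
  obtain ⟨D₁, D₂, C, cD₁, cD₂, mD₁, mD₂, pD₁, pD₂, bD₁, bD₂, eK⟩ := hK.exists_deriv_eq_sub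
  set k := kMax Φ K with hkdef
  have sub : Icc 0 τ ⊆ timeInterval T := fun s hs => mem_timeInterval_of_le hτ hs.1 hs.2
  set F : ℝ → ℝ := fun t => ∫ η in (0 : ℝ)..1, |u₁ t η - u₂ t η| with hF
  have bound : ∀ ε > 0, F τ ≤ gronwallBound (F 0 + ε) k ((2 * C - k) * ε) (τ - 0) := by
    intro ε hε
    -- A smooth substitute for `|u₁ - u₂|`, differentiable along characteristics with derivative
    -- `γ`; Grönwall is applied to its integral before `ε → 0`.
    set v : ℝ → ℝ → ℝ := fun t η => √((u₁ t η - u₂ t η) ^ 2 + ε ^ 2) with hv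
    set γ : ℝ → ℝ → ℝ := fun t η => softSign ε (u₁ t η - u₂ t η) *
      (deriv K (Q₁ t η) * u₁ t η - deriv K (Q₂ t η) * u₂ t η) with hγ
    have cv : ContinuousOn (fun p : ℝ × ℝ => v p.1 p.2) (timeInterval T ×ˢ Icc 0 1) :=
      Real.continuous_sqrt.comp_continuousOn
        (((h₁.continuousOn_density.sub h₂.continuousOn_density).pow 2).add continuousOn_const)
    have cγ : ContinuousOn (fun p : ℝ × ℝ => γ p.1 p.2) (timeInterval T ×ˢ Icc 0 1) :=
      ((h₁.continuousOn_density.sub h₂.continuousOn_density).div cv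
        fun p _ => (sqrt_sq_add_pos hε _).ne').mul
      (((hK.continuous_deriv.comp_continuousOn h₁.continuousOn).mul h₁.continuousOn_density).sub
        ((hK.continuous_deriv.comp_continuousOn h₂.continuousOn).mul h₂.continuousOn_density))
    have slice : ∀ {f : ℝ → ℝ → ℝ} {t : ℝ}, t ∈ Icc 0 τ →
        ContinuousOn (fun p : ℝ × ℝ => f p.1 p.2) (timeInterval T ×ˢ Icc 0 1) →
        IntervalIntegrable (f t) volume 0 1 := fun ht hf => by
      refine ContinuousOn.intervalIntegrable ?_
      rw [uIcc_of_le zero_le_one]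
      exact hf.comp (f := fun x : ℝ => (_, x)) (by fun_prop) fun x hx => ⟨sub ht, hx⟩
    have cabs : ContinuousOn (fun p : ℝ × ℝ => |u₁ p.1 p.2 - u₂ p.1 p.2|)
        (timeInterval T ×ˢ Icc 0 1) :=
      (h₁.continuousOn_density.sub h₂.continuousOn_density).abs
    have m0 : (0 : ℝ) ∈ Icc 0 τ := ⟨le_rfl, hτ.1⟩
    have mτ : τ ∈ Icc 0 τ := ⟨hτ.1, le_rfl⟩
    have low : F τ ≤ ∫ η in (0 : ℝ)..1, v τ η :=
      intervalIntegral.integral_mono_on zero_le_one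
        (slice (f := fun t η => |u₁ t η - u₂ t η|) mτ cabs) (slice mτ cv)
        fun η _ => abs_le_sqrt_sq_add _ _
    refine low.trans ?_
    refine le_gronwallBound_of_liminf_deriv_right_le (f := fun t => ∫ η in (0 : ℝ)..1, v t η)
      (f' := fun t => ∫ η in (0 : ℝ)..1, γ t η) (a := 0) (b := τ) ?_ ?_ ?_ ?_ τ mτ
    · exact continuousOn_parametric_integral hτ.1 (cv.mono (prod_mono sub le_rfl))
    · intro t ht r hr
      refine HasDerivWithinAt.liminf_right_slope_le (hasDerivWithinAt_integral_transport ht.2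
        (cv.mono (prod_mono ?_ le_rfl)) (cγ.mono (prod_mono ?_ le_rfl)) ?_ ?_) hr
      · exact fun s hs => sub ⟨ht.1.trans hs.1, hs.2⟩
      · exact fun s hs => sub ⟨ht.1.trans hs.1, hs.2⟩
      -- At both ends `u₁ - u₂` equals `n₁ - n₂`: the boundary terms `K 0` and `K Φ` cancel in the
      -- difference.
      · have htT := sub ⟨ht.1, ht.2.le⟩
        simp only [hv, h₁.density_left t htT, h₁.density_right t htT, h₂.density_left t htT,
          h₂.density_right t htT]
        congr 3
        ring
      · intro s hs x hx
        have hsT := sub ⟨ht.1.trans hs.1.le, hs.2.le⟩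
        have hs0 := ht.1.trans_lt hs.1
        have d := ((h₁.hasDerivAt_density_char hK hsT hs0 hx).sub
          (h₂.hasDerivAt_density_char hK hsT hs0 hx))
        have d2 := ((d.pow 2).add_const (ε ^ 2)).sqrt (by
          simp only [Pi.pow_apply, Pi.sub_apply]
          positivity)
        refine d2.congr_deriv ?_
        simp only [hγ, softSign, Pi.pow_apply, Pi.sub_apply, add_zero]
        have := (sqrt_sq_add_pos hε (u₁ s x - u₂ s x)).ne'
        field_simp
        push_cast
        ring
    · have : (∫ η in (0 : ℝ)..1, v 0 η) ≤ ∫ η in (0 : ℝ)..1, (|u₁ 0 η - u₂ 0 η| + ε) :=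
        intervalIntegral.integral_mono_on zero_le_one (slice m0 cv)
          ((slice (f := fun t η => |u₁ t η - u₂ t η|) m0 cabs).add (by simp))
          fun η _ => sqrt_sq_add_le hε _
      rw [intervalIntegral.integral_add (slice (f := fun t η => |u₁ t η - u₂ t η|) m0 cabs)
        (by simp)] at this
      simpa using this
    · intro t ht
      have htT := sub ⟨ht.1, ht.2.le⟩
      exact IsRegularSolution.integral_softSign_le hε hK hk cD₁ cD₂ mD₁ mD₂ pD₁ pD₂ bD₁ bD₂ eK
        h₁ h₂ htT (p₁ t htT) (p₂ t htT)
  rw [sub_zero] at bound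
  have lim : Tendsto (fun ε => gronwallBound (F 0 + ε) k ((2 * C - k) * ε) τ) (𝓝[>] 0)
      (𝓝 (F 0 * Real.exp (k * τ))) := by
    simp only [gronwallBound_of_K_ne_0 hk.ne]
    have hc : Continuous (fun ε => (F 0 + ε) * Real.exp (k * τ) +
        (2 * C - k) * ε / k * (Real.exp (k * τ) - 1)) := by fun_prop
    have := hc.tendsto 0
    simp only [add_zero, mul_zero, zero_div, zero_mul] at this
    exact this.mono_left nhdsWithin_le_nhds
  have := ge_of_tendsto lim (eventually_nhdsWithin_of_forall fun ε hε => bound ε hε)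
  rw [mul_comm]
  exact this

end Contraction

/-! ### Classical solutions are regular, and the resulting contraction. -/

lemma IsPhaseResponse.exists_lipschitz {Φ : ℝ} {K : ℝ → ℝ} (hK : IsPhaseResponse Φ K) :
    ∃ C, 0 ≤ C ∧ (∀ x, |deriv K x| ≤ C) ∧ ∀ x y, |K x - K y| ≤ C * |x - y| := by
  obtain ⟨C, hC⟩ := hK.deriv_bounded
  refine ⟨C, (abs_nonneg _).trans (hC 0), hC, fun x y => ?_⟩
  exact Convex.norm_image_sub_le_of_norm_deriv_le (fun z _ => hK.differentiable z)
    (fun z _ => hC z) convex_univ (mem_univ y) (mem_univ x)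

section Classical

variable {Φ : ℝ} {K : ℝ → ℝ} {T : EReal} {q : ℝ → ℝ} {Q : ℝ → ℝ → ℝ} {N : ℝ → ℝ}

/-- What is not part of the definition is `Q τ 1 = Φ` at later times and the value of the density at
`η = 0`. Both come from the equation at the boundary, where it holds by continuity from the
interior. -/
lemma IsClassicalSolution.isRegularSolution (hK : IsPhaseResponse Φ K)
    (h : IsClassicalSolution Φ K T q Q N) :
    IsRegularSolution Φ K T Q (fun τ => dEta (Q τ)) (fun τ => 1 / N τ) := by
  set S := timeInterval T with hS
  have uS : UniqueDiffOn ℝ S := uniqueDiffOn_timeInterval h.time_pos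
  have uI : UniqueDiffOn ℝ (Icc (0 : ℝ) 1) := uniqueDiffOn_Icc_zero_one
  have hu := uS.prod uI
  set f : ℝ × ℝ → ℝ := fun p => Q p.1 p.2 with hf
  have cf : ContinuousOn f (S ×ˢ Icc 0 1) := h.contDiffOn.continuousOn
  have cD := h.contDiffOn.continuousOn_fderivWithin hu le_rfl
  have hD : ∀ p ∈ S ×ˢ Icc (0 : ℝ) 1, HasFDerivWithinAt f (fderivWithin ℝ f (S ×ˢ Icc 0 1) p)
      (S ×ˢ Icc 0 1) p := fun p hp =>
    (h.contDiffOn.differentiableOn (by simp) p hp).hasFDerivWithinAt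
  set D := fderivWithin ℝ f (S ×ˢ Icc 0 1) with hDdef
  have dη : ∀ τ ∈ S, ∀ η ∈ Icc (0 : ℝ) 1, HasDerivWithinAt (Q τ) (D (τ, η) (0, 1)) (Icc 0 1) η := by
    intro τ hτ η hη
    exact (hD (τ, η) ⟨hτ, hη⟩).comp_hasDerivWithinAt (f := fun y : ℝ => (τ, y)) η
      ((hasDerivWithinAt_const η _ τ).prodMk (hasDerivWithinAt_id η _)) fun y hy => ⟨hτ, hy⟩
  have dτ : ∀ τ ∈ S, ∀ η ∈ Icc (0 : ℝ) 1,
      HasDerivWithinAt (fun s => Q s η) (D (τ, η) (1, 0)) S τ := by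
    intro τ hτ η hη
    exact (hD (τ, η) ⟨hτ, hη⟩).comp_hasDerivWithinAt (f := fun s : ℝ => (s, η)) τ
      ((hasDerivWithinAt_id τ _).prodMk (hasDerivWithinAt_const τ _ η)) fun y hy => ⟨hy, hη⟩
  have eη : ∀ τ ∈ S, ∀ η ∈ Icc (0 : ℝ) 1, dEta (Q τ) η = D (τ, η) (0, 1) := fun τ hτ η hη =>
    (dη τ hτ η hη).derivWithin (uI η hη)
  have cN : ContinuousOn (fun τ => 1 / N τ) S :=
    continuousOn_const.div h.continuousOn_rate fun τ hτ => (h.rate_pos τ hτ).ne'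
  have pde : ∀ τ ∈ S, ∀ η ∈ Icc (0 : ℝ) 1,
      D (τ, η) (1, 0) + D (τ, η) (0, 1) = 1 / N τ + K (Q τ η) := by
    intro τ hτ
    have cslice : ContinuousOn (fun η => D (τ, η)) (Icc 0 1) :=
      cD.comp (f := fun y : ℝ => (τ, y)) (by fun_prop) fun y hy => ⟨hτ, hy⟩
    refine EqOn.of_subset_closure (s := Ioo (0 : ℝ) 1) (t := Icc 0 1) ?_ ?_ ?_
      Ioo_subset_Icc_self (by rw [closure_Ioo zero_ne_one])
    · intro η hη
      have hη' := Ioo_subset_Icc_self hη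
      have := h.pde τ hτ η hη
      rw [eη τ hτ η hη', (dτ τ hτ η hη').derivWithin (uS τ hτ)] at this
      exact this
    · exact (cslice.clm_apply continuousOn_const).add (cslice.clm_apply continuousOn_const)
    · refine continuousOn_const.add (hK.continuous.comp_continuousOn ?_)
      exact cf.comp (f := fun y : ℝ => (τ, y)) (by fun_prop) fun y hy => ⟨hτ, hy⟩
  -- Combined with the formula for the rate, the equation at `η = 1` reads `∂_τ Q(τ, 1) = K(Q(τ, 1))
  -- - K Φ`. The constant `Φ` solves this Lipschitz ODE with the same initial value.
  have right : ∀ τ ∈ S, Q τ 1 = Φ := by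
    intro τ hτ
    obtain ⟨C, -, -, hC⟩ := hK.exists_lipschitz
    have sub : Icc 0 τ ⊆ S := fun s hs => mem_timeInterval_of_le hτ hs.1 hs.2
    have d : ∀ t ∈ S, HasDerivWithinAt (fun s => Q s 1 - Φ) (K (Q t 1) - K Φ) S t := by
      intro t ht
      have h1 := (dτ t ht 1 (by simp)).sub_const Φ
      have h2 := pde t ht 1 (by simp)
      have h3 := h.rate t ht
      rw [eη t ht 1 (by simp)] at h3
      exact h1.congr_deriv (by linarith)
    have key := eq_zero_of_abs_deriv_le_mul_abs_self_of_eq_zero_right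
      (f := fun s => Q s 1 - Φ) (f' := fun t => K (Q t 1) - K Φ) (K := C) (a := 0) (b := τ)
      (fun t ht => ((d t (sub ht)).continuousWithinAt).mono sub) (fun t ht => ?_) ?_
      (fun t ht => hC _ _) τ ⟨hτ.1, le_rfl⟩
    · linarith [key]
    · refine (d t (sub ⟨ht.1, ht.2.le⟩)).mono_of_mem_nhdsWithin ?_
      refine mem_of_superset (Icc_mem_nhdsGE ht.2) fun s hs => ?_
      exact sub ⟨ht.1.trans hs.1, hs.2⟩
    · rw [h.initial 1 (by simp), h.datum.right, sub_self]
  refine ⟨cf, ?_, cN, fun τ hτ η hη => ?_, fun t ht ht0 x hx => ?_, h.left, right,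
    fun τ hτ => ?_, fun τ hτ => ?_⟩
  · refine (cD.clm_apply (continuousOn_const (c := ((0, 1) : ℝ × ℝ)))).congr fun p hp => ?_
    exact eη p.1 hp.1 p.2 hp.2
  · exact (dη τ hτ η hη).congr_deriv (eη τ hτ η hη).symm
  · have hx' := Ioo_subset_Icc_self hx
    have hnhds : S ×ˢ Icc (0 : ℝ) 1 ∈ 𝓝 (t, x) :=
      prod_mem_nhds (timeInterval_mem_nhds ht ht0) (Icc_mem_nhds hx.1 hx.2)
    have h1 := (hD (t, x) ⟨ht, hx'⟩).hasFDerivAt hnhds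
    have h2 : HasDerivAt (fun r : ℝ => (t + r, x + r)) ((1, 1) : ℝ × ℝ) 0 :=
      ((hasDerivAt_id (0 : ℝ)).const_add t).prodMk ((hasDerivAt_id (0 : ℝ)).const_add x)
    have h3 := HasFDerivAt.comp_hasDerivAt_of_eq (f := fun r : ℝ => (t + r, x + r)) 0 h1 h2
      (by simp)
    refine h3.congr_deriv ?_
    rw [← pde t ht x hx', ← map_add]
    simp
  -- `Q` vanishes identically on `η = 0`, so only `∂_η Q` survives in the equation there.
  · have h0 : D (τ, 0) (1, 0) = 0 := by
      have h1 := (dτ τ hτ 0 (by simp)).derivWithin (uS τ hτ)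
      rw [← h1, derivWithin_congr (f := fun _ => (0 : ℝ)) (fun s hs => h.left s hs) (h.left τ hτ)]
      simp
    have := pde τ hτ 0 (by simp)
    rw [eη τ hτ 0 (by simp)]
    rw [h.left τ hτ, h0] at this
    linarith
  · have := h.rate τ hτ
    linarith

lemma dEta_nonneg_of_monotoneOn {q : ℝ → ℝ} (hq : MonotoneOn q (Icc 0 1)) (η : ℝ) :
    0 ≤ dEta q η := hq.derivWithin_nonneg

/-- Contraction of classical solutions with respect to `bvDist`. -/
theorem IsClassicalSolution.bvDist_le (hK : IsPhaseResponse Φ K) (hk : kMax Φ K < 0)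
    {q' : ℝ → ℝ} {Q' : ℝ → ℝ → ℝ} {N' : ℝ → ℝ} {T' : EReal}
    (h : IsClassicalSolution Φ K T q Q N) (h' : IsClassicalSolution Φ K T' q' Q' N') (hT : T' ≤ T)
    {τ : ℝ} (hτ : τ ∈ timeInterval T') :
    bvDist (Q' τ) (Q τ) ≤ Real.exp (kMax Φ K * τ) * bvDist (Q' 0) (Q 0) :=
  IsRegularSolution.integral_abs_sub_le hK hk (h'.isRegularSolution hK)
    ((h.isRegularSolution hK).mono hT)
    (fun t ht η _ => dEta_nonneg_of_monotoneOn (h'.monotoneOn t ht) η)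
    (fun t ht η _ => dEta_nonneg_of_monotoneOn (h.monotoneOn t ⟨ht.1, ht.2.trans_le hT⟩) η) hτ

end Classical

/-- Functions with `q(0) = 0` are determined by their derivative in `L¹(0, 1)`. -/
lemma eqOn_of_integral_abs_sub_nonpos {q₁ q₂ u₁ u₂ : ℝ → ℝ}
    (h₁ : ∀ η ∈ Icc (0 : ℝ) 1, HasDerivWithinAt q₁ (u₁ η) (Icc 0 1) η)
    (h₂ : ∀ η ∈ Icc (0 : ℝ) 1, HasDerivWithinAt q₂ (u₂ η) (Icc 0 1) η)
    (c₁ : ContinuousOn u₁ (Icc 0 1)) (c₂ : ContinuousOn u₂ (Icc 0 1)) (h0 : q₁ 0 = q₂ 0)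
    (hd : ∫ η in (0 : ℝ)..1, |u₁ η - u₂ η| ≤ 0) : EqOn q₁ q₂ (Icc 0 1) := by
  intro η hη
  have ii : ∀ {f : ℝ → ℝ}, ContinuousOn f (Icc 0 1) → ∀ {a b : ℝ}, 0 ≤ a → a ≤ b → b ≤ 1 →
      IntervalIntegrable f volume a b := fun hf a b ha hab hb =>
    ContinuousOn.intervalIntegrable (by
      rw [uIcc_of_le hab]
      exact hf.mono (Icc_subset_Icc ha hb))
  have e : ∫ z in (0 : ℝ)..η, (u₁ z - u₂ z) = (q₁ η - q₂ η) - (q₁ 0 - q₂ 0) := by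
    refine intervalIntegral.integral_eq_sub_of_hasDerivAt_of_le (f := fun z => q₁ z - q₂ z)
      hη.1 ?_ ?_ (ii (c₁.sub c₂) le_rfl hη.1 hη.2)
    · intro z hz
      have hz' : z ∈ Icc (0 : ℝ) 1 := ⟨hz.1, hz.2.trans hη.2⟩
      exact (((h₁ z hz').sub (h₂ z hz')).continuousWithinAt).mono (Icc_subset_Icc_right hη.2)
    · intro z hz
      have hz' : z ∈ Icc (0 : ℝ) 1 := ⟨hz.1.le, hz.2.le.trans hη.2⟩
      exact ((h₁ z hz').sub (h₂ z hz')).hasDerivAt (Icc_mem_nhds hz.1 (hz.2.trans_le hη.2))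
  have h1 : |∫ z in (0 : ℝ)..η, (u₁ z - u₂ z)| ≤ ∫ z in (0 : ℝ)..η, |u₁ z - u₂ z| :=
    intervalIntegral.norm_integral_le_integral_norm (f := fun z => u₁ z - u₂ z) (μ := volume) hη.1
  have h2 : 0 ≤ ∫ z in η..1, |u₁ z - u₂ z| :=
    intervalIntegral.integral_nonneg hη.2 fun z _ => abs_nonneg _
  have h3 := intervalIntegral.integral_add_adjacent_intervals
    (ii (c₁.sub c₂).abs le_rfl hη.1 hη.2) (ii (c₁.sub c₂).abs hη.1 hη.2 le_rfl)
  simp only [Pi.sub_apply] at h3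
  have h4 : |∫ z in (0 : ℝ)..η, (u₁ z - u₂ z)| = 0 :=
    le_antisymm (by linarith) (abs_nonneg _)
  rw [abs_eq_zero, e, h0] at h4
  linarith

/-! ### Positivity of the density and of the rate. -/

/-- A linear differential inequality preserves the sign. -/
lemma exists_pos_mul_le_of_linear {U a b : ℝ → ℝ} {ℓ : ℝ} (hℓ : 0 ≤ ℓ)
    (cU : ContinuousOn U (Icc 0 ℓ)) (ca : ContinuousOn a (Icc 0 ℓ))
    (hd : ∀ r ∈ Ioo 0 ℓ, HasDerivAt U (a r * U r + b r) r) (hb : ∀ r ∈ Ioo 0 ℓ, 0 ≤ b r) :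
    ∃ E > 0, E * U 0 ≤ U ℓ := by
  set a' : ℝ → ℝ := fun r => a (projIcc 0 ℓ hℓ r) with ha'
  have ca' : Continuous a' := ca.comp_continuous
    (continuous_subtype_val.comp continuous_projIcc) fun r => Subtype.coe_prop _
  set A : ℝ → ℝ := fun r => ∫ s in (0 : ℝ)..r, a' s with hA
  have dA : ∀ r, HasDerivAt A (a' r) r := fun r => (ca'.integral_hasStrictDerivAt 0 r).hasDerivAt
  have cA : Continuous A := continuous_iff_continuousAt.2 fun r => (dA r).continuousAt
  -- Integrating factor: the derivative of this product is `b r * exp (-A r) ≥ 0`.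
  have mono : MonotoneOn (fun r => U r * Real.exp (-A r)) (Icc 0 ℓ) := by
    refine monotoneOn_of_hasDerivWithinAt_nonneg (convex_Icc _ _)
      (f' := fun r => b r * Real.exp (-A r))
      (cU.mul (Real.continuous_exp.comp cA.neg).continuousOn) (fun r hr => ?_) fun r hr => ?_
    · rw [interior_Icc] at hr
      refine (((hd r hr).mul (dA r).neg.exp).congr_deriv ?_).hasDerivWithinAt
      have : a' r = a r := by simp [ha', projIcc_of_mem hℓ (Ioo_subset_Icc_self hr)]
      rw [this]
      simp only [Pi.neg_apply]
      ring
    · rw [interior_Icc] at hr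
      exact mul_nonneg (hb r hr) (Real.exp_nonneg _)
  have := mono (left_mem_Icc.2 hℓ) (right_mem_Icc.2 hℓ) hℓ
  have A0 : A 0 = 0 := by simp [hA]
  simp only [A0, neg_zero, Real.exp_zero, mul_one] at this
  refine ⟨Real.exp (A ℓ), Real.exp_pos _, ?_⟩
  calc Real.exp (A ℓ) * U 0 ≤ Real.exp (A ℓ) * (U ℓ * Real.exp (-A ℓ)) :=
        mul_le_mul_of_nonneg_left this (Real.exp_nonneg _)
    _ = U ℓ := by
        rw [mul_left_comm, ← Real.exp_add]
        simp

section Positivity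

variable {Φ : ℝ} {K : ℝ → ℝ} {T : EReal} {Q u : ℝ → ℝ → ℝ} {n : ℝ → ℝ}

/-- Comparison along a characteristic for a quantity with linear evolution. -/
lemma exists_pos_mul_le_along_characteristic {v a b : ℝ → ℝ → ℝ} {s y ℓ : ℝ}
    (hs0 : 0 ≤ s) (hs : s + ℓ ∈ timeInterval T) (hy0 : 0 ≤ y) (hy : y + ℓ ≤ 1) (hℓ : 0 ≤ ℓ)
    (cv : ContinuousOn (fun p : ℝ × ℝ => v p.1 p.2) (timeInterval T ×ˢ Icc 0 1))
    (ca : ContinuousOn (fun p : ℝ × ℝ => a p.1 p.2) (timeInterval T ×ˢ Icc 0 1))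
    (hd : ∀ r ∈ Ioo 0 ℓ, HasDerivAt (fun r' => v (s + r + r') (y + r + r'))
      (a (s + r) (y + r) * v (s + r) (y + r) + b (s + r) (y + r)) 0)
    (hb : ∀ r ∈ Ioo 0 ℓ, 0 ≤ b (s + r) (y + r)) :
    ∃ E > 0, E * v s y ≤ v (s + ℓ) (y + ℓ) := by
  have maps : MapsTo (fun r => (s + r, y + r)) (Icc 0 ℓ) (timeInterval T ×ˢ Icc 0 1) :=
    fun r hr => ⟨mem_timeInterval_of_le hs (by linarith [hr.1]) (by linarith [hr.2]),
      by linarith [hr.1], by linarith [hr.2]⟩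
  have := exists_pos_mul_le_of_linear (U := fun r => v (s + r) (y + r))
    (a := fun r => a (s + r) (y + r)) (b := fun r => b (s + r) (y + r)) hℓ
    (cv.comp (f := fun r => (s + r, y + r)) (by fun_prop) maps)
    (ca.comp (f := fun r => (s + r, y + r)) (by fun_prop) maps) (fun r hr => ?_) hb
  · simpa using this
  · have h2 := (hd r hr).comp_of_eq r ((hasDerivAt_id r).sub_const r) (by simp)
    rw [mul_one] at h2
    refine h2.congr_of_eventuallyEq (Eventually.of_forall fun s => ?_)
    simp

/-- Along characteristics `u` solves a homogeneous linear ODE. Traced backwards, a characteristic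
meets either the initial line or `η = 0`, where `u = n + K 0` is non-negative as long as `n` is. -/
lemma IsRegularSolution.density_nonneg (hK : IsPhaseResponse Φ K) (hΦ : 0 < Φ)
    (h : IsRegularSolution Φ K T Q u n) (h0 : ∀ η ∈ Icc (0 : ℝ) 1, 0 ≤ u 0 η) {t : ℝ}
    (ht : t ∈ timeInterval T) (hn : ∀ s, 0 ≤ s → s < t → 0 ≤ n s) {s η : ℝ} (hs : 0 ≤ s)
    (hst : s < t) (hη : η ∈ Icc (0 : ℝ) 1) : 0 ≤ u s η := by
  have ca : ContinuousOn (fun p : ℝ × ℝ => deriv K (Q p.1 p.2)) (timeInterval T ×ˢ Icc 0 1) :=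
    hK.continuous_deriv.comp_continuousOn h.continuousOn
  have hsT : s ∈ timeInterval T := mem_timeInterval_of_le ht hs hst.le
  have along : ∀ s' y ℓ, 0 ≤ s' → s' + ℓ = s → 0 ≤ y → y + ℓ = η → 0 ≤ ℓ → 0 ≤ u s' y →
      0 ≤ u s η := by
    intro s' y ℓ hs' es hy ey hℓ hu
    obtain ⟨E, hE, hle⟩ := exists_pos_mul_le_along_characteristic (v := u)
      (a := fun t x => deriv K (Q t x)) (b := fun _ _ => 0) hs' (es ▸ hsT) hy (ey ▸ hη.2) hℓ
      h.continuousOn_density ca (fun r hr => by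
        have := h.hasDerivAt_density_char hK (t := s' + r) (x := y + r)
          (mem_timeInterval_of_le hsT (by linarith [hr.1]) (by linarith [hr.2]))
          (by linarith [hr.1]) ⟨by linarith [hr.1], by linarith [hr.2, hη.2]⟩
        simpa using this) (fun _ _ => le_rfl)
    rw [es, ey] at hle
    exact (mul_nonneg hE.le hu).trans hle
  rcases le_total s η with hsη | hsη
  · exact along 0 (η - s) s le_rfl (by ring) (by linarith) (by ring) hs
      (h0 _ ⟨by linarith, by linarith [hη.2]⟩)
  · refine along (s - η) 0 η (by linarith) (by ring) le_rfl (by ring) hη.1 ?_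
    have hm : s - η ∈ timeInterval T := mem_timeInterval_of_le hsT (by linarith) (by linarith [hη.1])
    rw [h.density_left _ hm]
    have := hn (s - η) (by linarith) (by linarith [hη.1])
    have := hK.pos 0 ⟨le_rfl, hΦ.le⟩
    linarith

/-- If `H = u - K(Q)` is initially positive, the rate stays positive. -/
lemma IsRegularSolution.rate_pos (hK : IsPhaseResponse Φ K) (hk : kMax Φ K < 0) (hΦ : 0 < Φ)
    (h : IsRegularSolution Φ K T Q u n) (h0 : ∀ η ∈ Icc (0 : ℝ) 1, 0 ≤ u 0 η)
    (hH : ∀ η ∈ Icc (0 : ℝ) 1, 0 < u 0 η - K (Q 0 η)) {τ : ℝ} (hτ : τ ∈ timeInterval T) :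
    0 < n τ := by
  by_contra hneg
  push Not at hneg
  have subτ : Icc 0 τ ⊆ timeInterval T := fun s hs => mem_timeInterval_of_le hτ hs.1 hs.2
  have hcomp : IsCompact (Icc 0 τ ∩ n ⁻¹' Iic 0) :=
    isCompact_Icc.of_isClosed_subset
      ((h.continuousOn_rate.mono subτ).preimage_isClosed_of_isClosed isClosed_Icc isClosed_Iic)
      inter_subset_left
  -- `t` is the first time at which `n ≤ 0`. The contradiction comes from following `H = u - K(Q)`
  -- along the characteristic that ends at `(t, 1)`, where `H = n`.
  obtain ⟨t, ⟨htτ, htn⟩, hleast⟩ := hcomp.exists_isLeast ⟨τ, ⟨hτ.1, le_rfl⟩, hneg⟩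
  have htT := subτ htτ
  have hpos : ∀ s, 0 ≤ s → s < t → 0 < n s := fun s hs hst => by
    by_contra hc
    exact absurd (hleast ⟨⟨hs, hst.le.trans htτ.2⟩, not_lt.1 hc⟩) (not_le.2 hst)
  have rate_eq : ∀ s ∈ timeInterval T, n s = u s 1 - K (Q s 1) := fun s hs => by
    rw [h.density_right s hs, h.right s hs]
    ring
  have left_eq : ∀ s ∈ timeInterval T, n s = u s 0 - K (Q s 0) := fun s hs => by
    rw [h.density_left s hs, h.left s hs]
    ring
  have cH : ContinuousOn (fun p : ℝ × ℝ => u p.1 p.2 - K (Q p.1 p.2))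
      (timeInterval T ×ˢ Icc 0 1) :=
    h.continuousOn_density.sub (hK.continuous.comp_continuousOn h.continuousOn)
  have ca : ContinuousOn (fun p : ℝ × ℝ => deriv K (Q p.1 p.2)) (timeInterval T ×ˢ Icc 0 1) :=
    hK.continuous_deriv.comp_continuousOn h.continuousOn
  have along : ∀ s y ℓ, 0 ≤ s → s + ℓ = t → 0 ≤ y → y + ℓ = 1 → 0 ≤ ℓ →
      0 < u s y - K (Q s y) → 0 < n t := by
    intro s y ℓ hs es hy ey hℓ hu
    have hd : ∀ r ∈ Ioo 0 ℓ, HasDerivAt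
        (fun r' => u (s + r + r') (y + r + r') - K (Q (s + r + r') (y + r + r')))
        (deriv K (Q (s + r) (y + r)) * (u (s + r) (y + r) - K (Q (s + r) (y + r))) +
          -(deriv K (Q (s + r) (y + r)) * n (s + r))) 0 := by
      intro r hr
      have hm : s + r ∈ timeInterval T :=
        mem_timeInterval_of_le htT (by linarith [hr.1]) (by linarith [hr.2])
      have hp : 0 < s + r := by linarith [hr.1]
      have hx : y + r ∈ Ioo (0 : ℝ) 1 := ⟨by linarith [hr.1], by linarith [hr.2]⟩
      have d1 := h.hasDerivAt_density_char hK hm hp hx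
      have d2 := HasDerivAt.comp_of_eq (h₂ := K) 0 (hK.hasDerivAt (Q (s + r) (y + r)))
        (h.hasDerivAt_char _ hm hp _ hx) (by simp)
      exact (d1.sub d2).congr_deriv (by ring)
    -- Before `t` the density is non-negative, so `Q` stays in `[0, Φ]`, where `K' ≤ kMax < 0`.
    have hb : ∀ r ∈ Ioo 0 ℓ, 0 ≤ -(deriv K (Q (s + r) (y + r)) * n (s + r)) := by
      intro r hr
      have hst : s + r < t := by linarith [hr.2]
      have hs0 : 0 ≤ s + r := by linarith [hr.1]
      have hm : s + r ∈ timeInterval T := mem_timeInterval_of_le htT hs0 hst.le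
      have hQ := h.mapsTo hm fun η hη => h.density_nonneg hK hΦ h0 htT
        (fun s hs hst => (hpos s hs hst).le) hs0 hst hη
      have hd := hK.deriv_le_kMax
        (hQ (x := y + r) ⟨by linarith [hr.1], by linarith [hr.2]⟩)
      have := hpos (s + r) hs0 hst
      nlinarith
    obtain ⟨E, hE, hle⟩ := exists_pos_mul_le_along_characteristic
      (v := fun t x => u t x - K (Q t x)) (a := fun t x => deriv K (Q t x))
      (b := fun t x => -(deriv K (Q t x) * n t)) hs (es ▸ htT) hy ey.le hℓ cH ca hd hb
    rw [es, ey] at hle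
    rw [rate_eq t htT]
    exact (mul_pos hE hu).trans_le hle
  have hcontra : 0 < n t := by
    -- The characteristic through `(t, 1)` starts on the initial line if `t ≤ 1`, and otherwise at
    -- `(t - 1, 0)`, where `H = n (t - 1) > 0`.
    rcases le_total t 1 with ht1 | ht1
    · exact along 0 (1 - t) t le_rfl (by ring) (by linarith) (by ring) htτ.1
        (hH _ ⟨by linarith, by linarith [htτ.1]⟩)
    · refine along (t - 1) 0 1 (by linarith) (by ring) le_rfl (by ring) zero_le_one ?_
      rw [← left_eq (t - 1) (mem_timeInterval_of_le htT (by linarith) (by linarith))]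
      exact hpos (t - 1) (by linarith) (by linarith)
  exact absurd hcontra (not_lt.2 htn)

end Positivity

/-! ### The steady state. -/

section SteadyState

variable {Φ : ℝ} {K : ℝ → ℝ}

/-- Intermediate value theorem in `c ∈ [0, Φ]`: at `c = Φ` the integrand is at most `1 / Φ`. The
truncation `max c 0` only serves to make the integral continuous in `c` on the whole line. -/
lemma exists_integral_one_div_add_eq_one {k : ℝ → ℝ} (hΦ : 0 < Φ) (ck : Continuous k)
    (pk : ∀ x, 0 < k x) (h : 1 < ∫ x in (0 : ℝ)..Φ, 1 / k x) :
    ∃ c > 0, ∫ x in (0 : ℝ)..Φ, 1 / (k x + c) = 1 := by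
  set J : ℝ → ℝ := fun c => ∫ x in (0 : ℝ)..Φ, 1 / (k x + max c 0) with hJ
  have pos : ∀ c x, 0 < k x + max c 0 := fun c x =>
    add_pos_of_pos_of_nonneg (pk x) (le_max_right _ _)
  have cJ : Continuous J := by
    refine intervalIntegral.continuous_parametric_intervalIntegral_of_continuous'
      (f := fun c x => 1 / (k x + max c 0)) ?_ 0 Φ
    refine Continuous.div continuous_const ?_ fun p => (pos p.1 p.2).ne'
    exact (ck.comp continuous_snd).add (continuous_fst.max continuous_const)
  have J0 : 1 < J 0 := by simpa [hJ] using h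
  have J1 : J Φ ≤ 1 := by
    have : J Φ ≤ ∫ _ in (0 : ℝ)..Φ, 1 / Φ := by
      refine intervalIntegral.integral_mono_on hΦ.le ?_ (by simp) fun x _ => ?_
      · exact (Continuous.div continuous_const (ck.add continuous_const)
          fun x => (pos Φ x).ne').intervalIntegrable _ _
      · rw [max_eq_left hΦ.le]
        exact one_div_le_one_div_of_le hΦ (by linarith [pk x])
    refine this.trans ?_
    rw [intervalIntegral.integral_const, smul_eq_mul, sub_zero, mul_one_div_cancel hΦ.ne']
  obtain ⟨c, hc, e⟩ := intermediate_value_Icc' hΦ.le cJ.continuousOn ⟨J1, J0.le⟩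
  have hc0 : c ≠ 0 := by
    rintro rfl
    exact J0.ne' e
  refine ⟨c, lt_of_le_of_ne hc.1 hc0.symm, ?_⟩
  simpa only [hJ, max_eq_left hc.1] using e

/-- A positive bounded continuous autonomous vector field on the line has a global integral
curve, parametrised by travel time. -/
lemma exists_hasDerivAt_of_pos {F : ℝ → ℝ} (cF : Continuous F) (pF : ∀ x, 0 < F x) {B : ℝ}
    (bF : ∀ x, F x ≤ B) {a b : ℝ} (hab : ∫ x in a..b, 1 / F x = 1) :
    ∃ S : ℝ → ℝ, StrictMono S ∧ (∀ y, HasDerivAt S (F (S y)) y) ∧ S 0 = a ∧ S 1 = b := by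
  set t : ℝ → ℝ := fun x => ∫ y in a..x, 1 / F y with ht
  have cg : Continuous fun x => 1 / F x := continuous_const.div cF fun x => (pF x).ne'
  have dt : ∀ x, HasDerivAt t (1 / F x) x := fun x => (cg.integral_hasStrictDerivAt a x).hasDerivAt
  have ct : Continuous t := continuous_iff_continuousAt.2 fun x => (dt x).continuousAt
  have st : StrictMono t := strictMono_of_deriv_pos fun x => by
    rw [(dt x).deriv]
    exact one_div_pos.2 (pF x)
  have hB : 0 < B := (pF 0).trans_le (bF 0)
  -- As `F ≤ B`, the travel time `t` grows at least linearly, so it is onto `ℝ`; the integral curve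
  -- is its inverse.
  have mt : Monotone fun x => t x - 1 / B * x := by
    refine monotone_of_deriv_nonneg (fun x => ((dt x).sub
      ((hasDerivAt_id x).const_mul (1 / B))).differentiableAt) fun x => ?_
    have : HasDerivAt (fun x => t x - 1 / B * x) (1 / F x - 1 / B * 1) x :=
      (dt x).sub ((hasDerivAt_id x).const_mul (1 / B))
    rw [this.deriv, mul_one]
    exact sub_nonneg.2 (one_div_le_one_div_of_le (pF x) (bF x))
  have surj : Function.Surjective t := by
    refine ct.surjective ?_ ?_
    · refine tendsto_atTop_mono' _ (f₁ := fun x => t 0 + 1 / B * x) ?_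
        (tendsto_atTop_add_const_left _ _ (tendsto_id.const_mul_atTop (one_div_pos.2 hB)))
      filter_upwards [eventually_ge_atTop 0] with x hx
      have := mt hx
      simp only [mul_zero, sub_zero] at this
      linarith
    · refine tendsto_atBot_mono' _ (f₂ := t) (f₁ := fun x => t 0 + 1 / B * x) ?_
        (tendsto_atBot_add_const_left _ _ (tendsto_id.const_mul_atBot (one_div_pos.2 hB)))
      filter_upwards [eventually_le_atBot 0] with x hx
      have := mt hx
      simp only [mul_zero, sub_zero] at this
      linarith
  set e := st.orderIsoOfSurjective t surj with he
  have te : ∀ x, e x = t x := fun x => rfl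
  refine ⟨e.symm, e.symm.strictMono, fun y => ?_, ?_, ?_⟩
  · have := HasDerivAt.of_local_left_inverse (f := t) (g := e.symm) (a := y)
      e.symm.continuous.continuousAt (dt _) (one_div_pos.2 (pF _)).ne'
      (Eventually.of_forall fun z => e.apply_symm_apply z)
    simpa using this
  · rw [OrderIso.symm_apply_eq, te, ht]
    simp
  · rw [OrderIso.symm_apply_eq, te, ht]
    exact hab.symm

/-- A steady state is an integral curve of `K + c`, `c = 1 / Ns`, that takes exactly the time `1`
from `0` to `Φ`. `K` is replaced by its constant continuation `k` beyond `[0, Φ]`, which is positive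
and bounded on the line. -/
theorem exists_isSteadyState (hΦ : 0 < Φ) (hK : IsPhaseResponse Φ K)
    (hss : 1 < ∫ φ in (0 : ℝ)..Φ, 1 / K φ) : ∃ Qs Ns, IsSteadyState Φ K Qs Ns := by
  set k : ℝ → ℝ := fun x => K (projIcc 0 Φ hΦ.le x) with hk
  have ck : Continuous k := hK.continuous.comp (continuous_subtype_val.comp continuous_projIcc)
  have pk : ∀ x, 0 < k x := fun x => hK.pos _ (Subtype.coe_prop _)
  have ek : ∀ x ∈ Icc 0 Φ, k x = K x := fun x hx => by simp [hk, projIcc_of_mem hΦ.le hx]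
  have hkint : 1 < ∫ φ in (0 : ℝ)..Φ, 1 / k φ := by
    rwa [intervalIntegral.integral_congr (g := fun φ => 1 / K φ)]
    intro x hx
    rw [uIcc_of_le hΦ.le] at hx
    simp only [ek x hx]
  obtain ⟨c, hc, hint⟩ := exists_integral_one_div_add_eq_one hΦ ck pk hkint
  obtain ⟨B, hB⟩ := (isCompact_Icc (a := (0 : ℝ)) (b := Φ)).exists_bound_of_continuousOn
    hK.continuous.continuousOn
  obtain ⟨S, sS, dS, S0, S1⟩ := exists_hasDerivAt_of_pos (F := fun x => k x + c)
    (ck.add continuous_const) (fun x => add_pos (pk x) hc) (B := B + c)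
    (fun x => add_le_add_left ((le_abs_self _).trans (hB _ (Subtype.coe_prop _))) _) hint
  have cS : Continuous S := continuous_iff_continuousAt.2 fun x => (dS x).continuousAt
  have hS1 : ContDiff ℝ 1 S := by
    rw [contDiff_one_iff_deriv]
    refine ⟨fun x => (dS x).differentiableAt, ?_⟩
    rw [show deriv S = fun x => k (S x) + c from funext fun x => (dS x).deriv]
    exact (ck.comp cS).add continuous_const
  have mS : MapsTo S (Icc 0 1) (Icc 0 Φ) := fun η hη =>
    ⟨S0 ▸ sS.monotone hη.1, S1 ▸ sS.monotone hη.2⟩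
  have dE : ∀ η ∈ Icc (0 : ℝ) 1, dEta S η = K (S η) + c := fun η hη => by
    rw [dEta, (dS η).hasDerivWithinAt.derivWithin (uniqueDiffOn_Icc_zero_one η hη), ek _ (mS hη)]
  have dE1 : dEta S 1 = K Φ + c := by rw [dE 1 (by simp), S1]
  refine ⟨S, 1 / c, ⟨by simp, ⟨hS1.contDiffOn, sS.monotone.monotoneOn _, S0, S1, ?_⟩,
    (hS1.comp contDiff_snd).contDiffOn, fun _ _ => sS.monotone.monotoneOn _, continuousOn_const,
    fun _ _ => one_div_pos.2 hc, fun τ _ η hη => ?_, fun _ _ => S0, fun _ _ => ?_, fun _ _ => rfl,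
    fun _ _ => ?_⟩⟩
  · rw [dE1]; linarith
  · rw [dE η (Ioo_subset_Icc_self hη)]
    simp only [derivWithin_fun_const, one_div_one_div]
    simp
    ring
  · rw [dE1]; simp
  · rw [dE1]; linarith

end SteadyState

/-! ### The flow in Lagrangian coordinates. -/

open BoundedContinuousFunction

/-- Picard–Lindelöf together with the information that the solution stays in the ball. -/
lemma exists_hasDerivWithinAt_mem_closedBall {E : Type*} [NormedAddCommGroup E] [NormedSpace ℝ E]
    [CompleteSpace E] {f : ℝ → E → E} {tmin tmax : ℝ} {t₀ : Icc tmin tmax} {x₀ : E}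
    {a L K : NNReal} (hf : IsPicardLindelof f t₀ x₀ a 0 L K) :
    ∃ α : ℝ → E, α t₀ = x₀ ∧ ∀ t ∈ Icc tmin tmax,
      HasDerivWithinAt α (f t (α t)) (Icc tmin tmax) t ∧ α t ∈ Metric.closedBall x₀ a := by
  have hx : x₀ ∈ Metric.closedBall x₀ ((0 : NNReal) : ℝ) := Metric.mem_closedBall_self le_rfl
  obtain ⟨α, hα⟩ := ODE.FunSpace.exists_isFixedPt_next hf hx
  refine ⟨α.compProj, by rw [ODE.FunSpace.compProj_val, ← hα, ODE.FunSpace.next_apply₀],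
    fun t ht => ⟨?_, α.compProj_mem_closedBall hf.mul_max_le⟩⟩
  apply ODE.hasDerivWithinAt_picard_Icc t₀.2 hf.continuousOn_uncurry
    α.continuous_compProj.continuousOn (fun _ ht' => α.compProj_mem_closedBall hf.mul_max_le)
    x₀ ht |>.congr_of_mem _ ht
  intro t' ht'
  nth_rw 1 [← hα]
  rw [ODE.FunSpace.compProj_of_mem ht', ODE.FunSpace.next_apply]

lemma continuous_integral_boundedContinuousFunction (a : ℝ) :
    Continuous fun p : (ℝ →ᵇ ℝ) × ℝ => ∫ y in a..p.2, p.1 y := by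
  have : Continuous (Function.uncurry fun (p : (ℝ →ᵇ ℝ) × ℝ) (y : ℝ) => p.1 y) := by
    have h : Continuous fun r : (ℝ →ᵇ ℝ) × ℝ => r.1 r.2 := continuous_eval
    exact h.comp (f := fun r : ((ℝ →ᵇ ℝ) × ℝ) × ℝ => (r.1.1, r.2)) (by fun_prop)
  exact intervalIntegral.continuous_parametric_intervalIntegral_of_continuous this continuous_snd

/-- Integration over a bounded interval as a continuous linear functional. -/
noncomputable def integralCLM (a b : ℝ) : (ℝ →ᵇ ℝ) →L[ℝ] ℝ :=
  LinearMap.mkContinuous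
    { toFun := fun V => ∫ y in a..b, V y
      map_add' := fun V W => by
        simp only [BoundedContinuousFunction.coe_add, Pi.add_apply]
        exact intervalIntegral.integral_add (V.continuous.intervalIntegrable _ _)
          (W.continuous.intervalIntegrable _ _)
      map_smul' := fun c V => by simp }
    |b - a| (fun V => by
      rw [mul_comm]
      exact intervalIntegral.norm_integral_le_of_norm_le_const fun y _ => V.norm_coe_le_norm y)

section Flow

variable {Φ : ℝ} {K : ℝ → ℝ}

/-- The vector field governing the spatial derivative `V` of the flow: with `c` a cut-off of the
position and `b` the position from which the value `Φ` has been reached, it is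
`x ↦ K'(Φ + ∫_b^{c x} V) V(x)`. -/
noncomputable def flowField (Φ : ℝ) (K' : ℝ → ℝ) (c : C(ℝ, ℝ)) (b : ℝ) (hK' : Continuous K') {C : ℝ}
    (hC : ∀ x, |K' x| ≤ C) (V : ℝ →ᵇ ℝ) : ℝ →ᵇ ℝ :=
  BoundedContinuousFunction.ofNormedAddCommGroup
    (fun x => K' (Φ + ∫ y in b..c x, V y) * V x)
    ((hK'.comp (continuous_const.add ((intervalIntegral.continuous_primitive
      (fun a b => V.continuous.intervalIntegrable a b) b).comp c.continuous))).mul V.continuous)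
    (C * ‖V‖) fun x => by
      rw [norm_mul]
      exact mul_le_mul (hC _) (V.norm_coe_le_norm x) (norm_nonneg _)
        ((abs_nonneg _).trans (hC 0))

lemma flowField_apply {K' : ℝ → ℝ} (c : C(ℝ, ℝ)) (b : ℝ) (hK' : Continuous K') {C : ℝ}
    (hC : ∀ x, |K' x| ≤ C) (V : ℝ →ᵇ ℝ) (x : ℝ) :
    flowField Φ K' c b hK' hC V x = K' (Φ + ∫ y in b..c x, V y) * V x := rfl

lemma norm_flowField_le {K' : ℝ → ℝ} (c : C(ℝ, ℝ)) (b : ℝ) (hK' : Continuous K') {C : ℝ}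
    (hC : ∀ x, |K' x| ≤ C) (V : ℝ →ᵇ ℝ) : ‖flowField Φ K' c b hK' hC V‖ ≤ C * ‖V‖ := by
  refine (BoundedContinuousFunction.norm_le
    (mul_nonneg ((abs_nonneg _).trans (hC 0)) (norm_nonneg _))).2 fun x => ?_
  rw [flowField_apply, norm_mul]
  exact mul_le_mul (hC _) (V.norm_coe_le_norm x) (norm_nonneg _) ((abs_nonneg _).trans (hC 0))

/-- This is where the cut-off is needed: it bounds the length of the integration interval by `2 *
R`, so that the non-local term is Lipschitz in the supremum norm. -/
lemma dist_flowField_le {K' : ℝ → ℝ} {c : C(ℝ, ℝ)} {b R : ℝ} (hK' : Continuous K') {C C₂ : ℝ}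
    (hC : ∀ x, |K' x| ≤ C) (hC₂ : ∀ x y, |K' x - K' y| ≤ C₂ * |x - y|) (h0 : 0 ≤ C₂)
    (hb : |b| ≤ R) (hc : ∀ x, |c x| ≤ R) (V W : ℝ →ᵇ ℝ) :
    dist (flowField Φ K' c b hK' hC V) (flowField Φ K' c b hK' hC W)
      ≤ (C + C₂ * (2 * R) * ‖W‖) * dist V W := by
  have hC0 : 0 ≤ C := (abs_nonneg _).trans (hC 0)
  have hR : 0 ≤ R := (abs_nonneg _).trans hb
  refine (BoundedContinuousFunction.dist_le (by positivity)).2 fun x => ?_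
  rw [flowField_apply, flowField_apply, Real.dist_eq]
  set p := Φ + ∫ y in b..c x, V y with hp
  set r := Φ + ∫ y in b..c x, W y with hr
  have e : K' p * V x - K' r * W x = K' p * (V x - W x) + (K' p - K' r) * W x := by ring
  have h1 : |V x - W x| ≤ dist V W :=
    BoundedContinuousFunction.dist_coe_le_dist (f := V) (g := W) x
  have h2 : |W x| ≤ ‖W‖ := W.norm_coe_le_norm x
  have h3 : |p - r| ≤ dist V W * (2 * R) := by
    have : p - r = ∫ y in b..c x, (V y - W y) := by
      rw [hp, hr, intervalIntegral.integral_sub (V.continuous.intervalIntegrable _ _)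
        (W.continuous.intervalIntegrable _ _)]
      ring
    rw [this]
    refine (intervalIntegral.norm_integral_le_of_norm_le_const (C := dist V W)
      (f := fun y => V y - W y) (a := b) (b := c x)
      fun y _ => BoundedContinuousFunction.dist_coe_le_dist (f := V) (g := W) y).trans ?_
    refine mul_le_mul_of_nonneg_left ?_ dist_nonneg
    refine (abs_sub _ _).trans ?_
    linarith [hc x]
  rw [e]
  refine (abs_add_le _ _).trans ?_
  rw [abs_mul, abs_mul]
  have h4 : |K' p| * |V x - W x| ≤ C * dist V W := mul_le_mul (hC _) h1 (abs_nonneg _) hC0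
  have h5 : |K' p - K' r| * |W x| ≤ C₂ * (dist V W * (2 * R)) * ‖W‖ :=
    mul_le_mul ((hC₂ _ _).trans (mul_le_mul_of_nonneg_left h3 h0)) h2 (abs_nonneg _)
      (by positivity)
  linarith

lemma continuous_flowField {K' : ℝ → ℝ} {c : C(ℝ, ℝ)} {b : ℝ → ℝ} (hb : Continuous b)
    (hK' : Continuous K') {C C₂ : ℝ} (hC : ∀ x, |K' x| ≤ C)
    (hC₂ : ∀ x y, |K' x - K' y| ≤ C₂ * |x - y|) (h0 : 0 ≤ C₂) (V : ℝ →ᵇ ℝ) :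
    Continuous fun τ => flowField Φ K' c (b τ) hK' hC V := by
  have key : ∀ τ σ, dist (flowField Φ K' c (b τ) hK' hC V) (flowField Φ K' c (b σ) hK' hC V)
      ≤ C₂ * (‖V‖ * |b σ - b τ|) * ‖V‖ := fun τ σ => by
    refine (BoundedContinuousFunction.dist_le (by positivity)).2 fun x => ?_
    rw [flowField_apply, flowField_apply, Real.dist_eq, ← sub_mul, abs_mul]
    refine mul_le_mul ((hC₂ _ _).trans (mul_le_mul_of_nonneg_left ?_ h0)) (V.norm_coe_le_norm x)
      (abs_nonneg _) (by positivity)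
    rw [add_sub_add_left_eq_sub, intervalIntegral.integral_interval_sub_interval_comm
      (V.continuous.intervalIntegrable _ _) (V.continuous.intervalIntegrable _ _)
      (V.continuous.intervalIntegrable _ _), intervalIntegral.integral_same, sub_zero]
    exact intervalIntegral.norm_integral_le_of_norm_le_const fun y _ => V.norm_coe_le_norm y
  rw [continuous_iff_continuousAt]
  intro σ
  rw [ContinuousAt, tendsto_iff_dist_tendsto_zero]
  refine squeeze_zero (fun _ => dist_nonneg) (fun τ => key τ σ) ?_
  have hc : Continuous fun τ => C₂ * (‖V‖ * |b σ - b τ|) * ‖V‖ := by fun_prop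
  simpa using hc.tendsto σ

/-- The local flow of the phase equation whose rate is determined by the requirement that the
point `p (1 - τ)` reaches the value `Φ` at time `τ`. -/
structure IsFlow (Φ : ℝ) (K p p' : ℝ → ℝ) (ε R : ℝ) (Θ V : ℝ → ℝ → ℝ) (n : ℝ → ℝ) : Prop where
  hasDerivAt_space : ∀ τ ∈ Ioo (-ε) ε, ∀ x, HasDerivAt (Θ τ) (V τ x) x
  hasDerivAt_time : ∀ τ ∈ Ioo (-ε) ε, ∀ x ∈ Ioo (-R) R,
    HasDerivAt (fun s => Θ s x) (n τ + K (Θ τ x)) τ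
  continuousOn : ContinuousOn (fun q : ℝ × ℝ => Θ q.1 q.2) (Ioo (-ε) ε ×ˢ univ)
  continuousOn_space : ContinuousOn (fun q : ℝ × ℝ => V q.1 q.2) (Ioo (-ε) ε ×ˢ univ)
  continuousOn_rate : ContinuousOn n (Ioo (-ε) ε)
  space_pos : ∀ τ ∈ Ioo (-ε) ε, ∀ x, 0 < V τ x
  initial : ∀ x, Θ 0 x = x
  space_initial : ∀ x, V 0 x = 1
  firing : ∀ τ, Θ τ (p (1 - τ)) = Φ
  rate : ∀ τ, n τ = V τ (p (1 - τ)) * p' (1 - τ) - K Φ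
  neg : ∀ τ ∈ Ioo (-ε) ε, Θ τ (-R) < 0
  pos : ∀ τ ∈ Ioo (-ε) ε, 0 < Θ τ R
  mem : ∀ y ∈ Icc (0 : ℝ) 2, p y ∈ Ioo (-R) R

lemma hasStrictFDerivAt_of_partials {f a b : ℝ → ℝ → ℝ} {x y : ℝ}
    (ha : ∀ᶠ q : ℝ × ℝ in 𝓝 (x, y), HasDerivAt (fun s => f s q.2) (a q.1 q.2) q.1)
    (hb : ∀ᶠ q : ℝ × ℝ in 𝓝 (x, y), HasDerivAt (f q.1) (b q.1 q.2) q.2)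
    (ca : ContinuousAt (fun q : ℝ × ℝ => a q.1 q.2) (x, y))
    (cb : ContinuousAt (fun q : ℝ × ℝ => b q.1 q.2) (x, y)) :
    HasStrictFDerivAt (fun q : ℝ × ℝ => f q.1 q.2)
      (a x y • ContinuousLinearMap.fst ℝ ℝ ℝ + b x y • ContinuousLinearMap.snd ℝ ℝ ℝ) (x, y) := by
  have cspan : Continuous fun r : ℝ => ContinuousLinearMap.toSpanSingleton ℝ r :=
    (ContinuousLinearMap.toSpanSingletonCLE (𝕜 := ℝ) (E := ℝ)).continuous
  have key := hasStrictFDerivAt_uncurry_coprod (u := (x, y)) (f := f)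
    (f₁ := fun s t => ContinuousLinearMap.toSpanSingleton ℝ (a s t))
    (f₂ := fun s t => ContinuousLinearMap.toSpanSingleton ℝ (b s t))
    (ha.mono fun q hq => hq.hasFDerivAt) (hb.mono fun q hq => hq.hasFDerivAt)
    (ContinuousAt.comp (f := fun q : ℝ × ℝ => a q.1 q.2) cspan.continuousAt ca)
    (ContinuousAt.comp (f := fun q : ℝ × ℝ => b q.1 q.2) cspan.continuousAt cb)
  refine key.congr_fderiv ?_
  ext <;> simp [Function.HasUncurry.uncurry]

/-- Joint differentiability is what allows both `V` and the end point of the integral to move with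
time, as they do for the end point `p (1 - τ)`. -/
lemma hasStrictFDerivAt_integral_of_curve {V V' : ℝ → ℝ →ᵇ ℝ} {I : Set ℝ} (hI : IsOpen I)
    (hV : ∀ τ ∈ I, HasDerivAt V (V' τ) τ) (hV' : ContinuousOn V' I) {τ : ℝ} (hτ : τ ∈ I)
    (x : ℝ) :
    HasStrictFDerivAt (fun q : ℝ × ℝ => ∫ y in (0 : ℝ)..q.2, V q.1 y)
      ((∫ y in (0 : ℝ)..x, V' τ y) • ContinuousLinearMap.fst ℝ ℝ ℝ +
        V τ x • ContinuousLinearMap.snd ℝ ℝ ℝ) (τ, x) := by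
  have cV : ContinuousOn V I := fun τ hτ => (hV τ hτ).continuousAt.continuousWithinAt
  have hmem : ∀ᶠ q : ℝ × ℝ in 𝓝 (τ, x), q.1 ∈ I :=
    continuous_fst.continuousAt.eventually (hI.mem_nhds hτ)
  have pair : ∀ {W : ℝ → ℝ →ᵇ ℝ}, ContinuousOn W I →
      ContinuousAt (fun q : ℝ × ℝ => (W q.1, q.2)) (τ, x) := fun hW =>
    (ContinuousAt.comp (f := Prod.fst) (hW.continuousAt (hI.mem_nhds hτ))
      continuous_fst.continuousAt).prodMk continuous_snd.continuousAt
  have ceval : Continuous fun r : (ℝ →ᵇ ℝ) × ℝ => r.1 r.2 := continuous_eval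
  refine hasStrictFDerivAt_of_partials (f := fun τ x => ∫ y in (0 : ℝ)..x, V τ y)
    (a := fun τ x => ∫ y in (0 : ℝ)..x, V' τ y) (b := fun τ x => V τ x) ?_ ?_ ?_ ?_
  · filter_upwards [hmem] with q hq
    exact (integralCLM 0 q.2).hasFDerivAt.comp_hasDerivAt q.1 (hV q.1 hq)
  · filter_upwards [hmem] with q hq
    exact ((V q.1).continuous.integral_hasStrictDerivAt 0 q.2).hasDerivAt
  · exact ContinuousAt.comp (f := fun q : ℝ × ℝ => (V' q.1, q.2))
      (continuous_integral_boundedContinuousFunction 0).continuousAt (pair hV')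
  · exact ContinuousAt.comp (f := fun q : ℝ × ℝ => (V q.1, q.2)) ceval.continuousAt (pair cV)

end Flow

lemma IsPhaseResponse.exists_lipschitz_deriv {Φ : ℝ} {K : ℝ → ℝ} (hK : IsPhaseResponse Φ K) :
    ∃ C, 0 ≤ C ∧ ∀ x y, |deriv K x - deriv K y| ≤ C * |x - y| := by
  obtain ⟨C, hC⟩ := hK.deriv_deriv_bounded
  refine ⟨C, (abs_nonneg _).trans (hC 0), fun x y => ?_⟩
  exact Convex.norm_image_sub_le_of_norm_deriv_le
    (fun z _ => hK.contDiff_deriv.differentiable (by simp) z)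
    (fun z _ => hC z) convex_univ (mem_univ y) (mem_univ x)

/-- Solve for the spatial derivative `V` first, in an ODE that does not contain the rate; recover
`Θ` by integrating `V` from the firing position, and `n` by differentiating `Θ τ (p (1 - τ)) = Φ` in
`τ`. The restriction on `ε` involves only the bound for `K'`, not the datum `p`. -/
theorem exists_isFlow {Φ : ℝ} {K p p' : ℝ → ℝ} (hΦ : 0 < Φ) (hK : IsPhaseResponse Φ K) {C : ℝ}
    (hC : ∀ x, |deriv K x| ≤ C) {ε : ℝ} (hε : 0 < ε) (hε1 : ε ≤ 1) (hCε : C * (3 / 2) * ε ≤ 1 / 2)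
    (dp : ∀ y, HasDerivAt p (p' y) y) (cp' : Continuous p') (p1 : p 1 = Φ) :
    ∃ R Θ V n, IsFlow Φ K p p' ε R Θ V n := by
  have cp : Continuous p := continuous_iff_continuousAt.2 fun y => (dp y).continuousAt
  have hC0 : 0 ≤ C := (abs_nonneg _).trans (hC 0)
  obtain ⟨C₂, hC₂0, hC₂⟩ := hK.exists_lipschitz_deriv
  obtain ⟨B, hB⟩ := (isCompact_Icc (a := (0 : ℝ)) (b := 2)).exists_bound_of_continuousOn
    cp.continuousOn
  have hB0 : 0 ≤ B := (norm_nonneg _).trans (hB 0 (by simp))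
  -- Large enough for a root of `Θ τ` in `(-R, R)`: since `V ≥ 1 / 2` and `|b τ| ≤ B`, one has `Θ τ
  -- (-R) ≤ Φ - (R - B) / 2 = -1 / 2`.
  set R : ℝ := B + 2 * Φ + 1 with hR
  have hRR : -R ≤ R := by linarith
  set c : C(ℝ, ℝ) := ⟨fun x => projIcc (-R) R hRR x,
    continuous_subtype_val.comp continuous_projIcc⟩ with hc
  have c_eq : ∀ x ∈ Icc (-R) R, c x = x := fun x hx => by
    simp [hc, projIcc_of_mem hRR hx]
  have c_abs : ∀ x, |c x| ≤ R := fun x => abs_le.2 (projIcc (-R) R hRR x).2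
  set b : ℝ → ℝ := fun τ => p (1 - τ) with hb
  have cb : Continuous b := by fun_prop
  have b_abs : ∀ τ ∈ Icc (-ε) ε, |b τ| ≤ B := fun τ hτ =>
    hB _ ⟨by linarith [hτ.2], by linarith [hτ.1]⟩
  set f : ℝ → (ℝ →ᵇ ℝ) → (ℝ →ᵇ ℝ) := fun τ W =>
    flowField Φ (deriv K) c (b τ) hK.continuous_deriv hC W with hf
  set x₀ : ℝ →ᵇ ℝ := BoundedContinuousFunction.const ℝ 1 with hx₀
  have ball_norm : ∀ W ∈ Metric.closedBall x₀ ((1 / 2 : NNReal) : ℝ), ‖W‖ ≤ 3 / 2 := by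
    intro W hW
    have h1 : ‖x₀‖ ≤ 1 := (BoundedContinuousFunction.norm_const_le (1 : ℝ)).trans (by simp)
    have h2 : ‖W - x₀‖ ≤ 1 / 2 := by simpa [dist_eq_norm] using hW
    calc ‖W‖ = ‖x₀ + (W - x₀)‖ := by rw [add_sub_cancel]
      _ ≤ ‖x₀‖ + ‖W - x₀‖ := norm_add_le _ _
      _ ≤ 3 / 2 := by linarith
  have h0mem : (0 : ℝ) ∈ Icc (-ε) ε := ⟨by linarith, hε.le⟩
  have hR0 : 0 ≤ R := by linarith
  have hL : 0 ≤ C + C₂ * (2 * R) * (3 / 2) := by positivity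
  -- On the ball of radius `1 / 2` about the constant `1` the field is bounded by `C * (3 / 2)`,
  -- which is all that limits `ε`. The Lipschitz constant depends on `R`, hence on `p`, but does not
  -- restrict the time.
  have PL : IsPicardLindelof f (⟨0, h0mem⟩ : Icc (-ε) ε) x₀ (1 / 2) 0
      (⟨C * (3 / 2), by positivity⟩ : NNReal) (⟨C + C₂ * (2 * R) * (3 / 2), hL⟩ : NNReal) := by
    refine ⟨fun τ hτ => ?_, fun W _ => ?_, fun τ hτ W hW => ?_, ?_⟩
    · refine LipschitzOnWith.of_dist_le_mul fun V _ W hW => ?_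
      refine (dist_flowField_le hK.continuous_deriv hC hC₂ hC₂0
        ((b_abs τ hτ).trans (by linarith)) c_abs V W).trans ?_
      refine mul_le_mul_of_nonneg_right ?_ dist_nonneg
      have := mul_le_mul_of_nonneg_left (ball_norm W hW) (show 0 ≤ C₂ * (2 * R) by positivity)
      change C + C₂ * (2 * R) * ‖W‖ ≤ C + C₂ * (2 * R) * (3 / 2)
      linarith
    · exact (continuous_flowField cb hK.continuous_deriv hC hC₂ hC₂0 W).continuousOn
    · exact (norm_flowField_le c (b τ) hK.continuous_deriv hC W).trans
        (mul_le_mul_of_nonneg_left (ball_norm W hW) hC0)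
    · simp only [sub_zero, zero_sub, neg_neg, max_self]
      change C * (3 / 2) * ε ≤ ((1 / 2 : NNReal) : ℝ) - ((0 : NNReal) : ℝ)
      simpa using hCε
  obtain ⟨V, hV0, hV⟩ := exists_hasDerivWithinAt_mem_closedBall PL
  have sub : Ioo (-ε) ε ⊆ Icc (-ε) ε := Ioo_subset_Icc_self
  have dV : ∀ τ ∈ Ioo (-ε) ε, HasDerivAt V (f τ (V τ)) τ := fun τ hτ =>
    (hV τ (sub hτ)).1.hasDerivAt (Icc_mem_nhds hτ.1 hτ.2)
  have cV : ContinuousOn V (Ioo (-ε) ε) := fun τ hτ => (dV τ hτ).continuousAt.continuousWithinAt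
  have cV' : ContinuousOn (fun τ => f τ (V τ)) (Ioo (-ε) ε) :=
    PL.continuousOn_uncurry.comp (f := fun τ => (τ, V τ)) (continuousOn_id.prodMk cV)
      fun τ hτ => ⟨sub hτ, (hV τ (sub hτ)).2⟩
  have V_lower : ∀ τ ∈ Ioo (-ε) ε, ∀ x, 1 / 2 ≤ V τ x := by
    intro τ hτ x
    have h1 : dist (V τ) x₀ ≤ 1 / 2 := by simpa using (hV τ (sub hτ)).2
    have h2 := (BoundedContinuousFunction.dist_coe_le_dist (f := V τ) (g := x₀) x).trans h1
    rw [Real.dist_eq, abs_le] at h2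
    have : x₀ x = 1 := rfl
    linarith [h2.1]
  have ii : ∀ τ r s, IntervalIntegrable (V τ) volume r s := fun τ r s =>
    (V τ).continuous.intervalIntegrable r s
  set Θ : ℝ → ℝ → ℝ := fun τ x => Φ + ∫ y in b τ..x, V τ y with hΘ
  set n : ℝ → ℝ := fun τ => V τ (b τ) * p' (1 - τ) - K Φ with hn
  have Θ_eq : ∀ τ x, Θ τ x = Φ + (∫ y in (0 : ℝ)..x, V τ y) - ∫ y in (0 : ℝ)..b τ, V τ y := by
    intro τ x
    simp only [hΘ]
    rw [← intervalIntegral.integral_interval_sub_left (ii τ 0 x) (ii τ 0 (b τ))]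
    ring
  have dΘx : ∀ τ x, HasDerivAt (Θ τ) (V τ x) x := fun τ x =>
    (((V τ).continuous.integral_hasStrictDerivAt (b τ) x).hasDerivAt).const_add Φ
  have b_mem : ∀ τ ∈ Ioo (-ε) ε, b τ ∈ Ioo (-R) R := fun τ hτ => by
    have := abs_le.1 (b_abs τ (sub hτ))
    exact ⟨by linarith, by linarith⟩
  have firing : ∀ τ, Θ τ (b τ) = Φ := fun τ => by simp [hΘ]
  have V0 : V 0 = x₀ := hV0
  have cprim : ∀ {g : ℝ × ℝ → ℝ}, ContinuousOn g (Ioo (-ε) ε ×ˢ univ) →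
      ContinuousOn (fun q : ℝ × ℝ => ∫ y in (0 : ℝ)..g q, V q.1 y) (Ioo (-ε) ε ×ˢ univ) := by
    intro g hg
    exact (continuous_integral_boundedContinuousFunction 0).comp_continuousOn
      (f := fun q : ℝ × ℝ => (V q.1, g q))
      ((cV.comp continuousOn_fst fun q hq => hq.1).prodMk hg)
  have ceval : Continuous fun r : (ℝ →ᵇ ℝ) × ℝ => r.1 r.2 := continuous_eval
  refine ⟨R, Θ, fun τ => V τ, n, fun τ _ x => dΘx τ x, fun τ hτ x hx => ?_, ?_, ?_, ?_,
    fun τ hτ x => by linarith [V_lower τ hτ x], fun x => ?_, fun x => ?_, firing, fun τ => rfl,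
    fun τ hτ => ?_, fun τ hτ => ?_, fun y hy => ?_⟩
  · have hbτ : HasDerivAt (fun s => (s, b s)) ((1, p' (1 - τ) * -1) : ℝ × ℝ) τ :=
      (hasDerivAt_id τ).prodMk ((dp (1 - τ)).comp τ ((hasDerivAt_id τ).const_sub 1))
    have hxτ : HasDerivAt (fun s => (s, x)) ((1, 0) : ℝ × ℝ) τ :=
      (hasDerivAt_id τ).prodMk (hasDerivAt_const τ x)
    have s1 := (hasStrictFDerivAt_integral_of_curve isOpen_Ioo dV cV' hτ
      x).hasFDerivAt.comp_hasDerivAt (f := fun s => (s, x)) τ hxτ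
    have s2 := (hasStrictFDerivAt_integral_of_curve isOpen_Ioo dV cV' hτ
      (b τ)).hasFDerivAt.comp_hasDerivAt (f := fun s => (s, b s)) τ hbτ
    have s3 := ((s1.const_add Φ).sub s2)
    have s4 : HasDerivAt (fun s => Θ s x) _ τ :=
      s3.congr_of_eventuallyEq (Eventually.of_forall fun s => Θ_eq s x)
    refine s4.congr_deriv ?_
    -- Between `b τ` and `x` the cut-off is inactive, so the integrand is `K'(Θ) V = ∂_x K(Θ)`. The
    -- moving end point contributes `V τ (b τ) * p' (1 - τ)`, and with `Θ τ (b τ) = Φ` the sum is `n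
    -- τ + K (Θ τ x)`.
    have e1 : ∫ y in b τ..x, f τ (V τ) y = K (Θ τ x) - K (Θ τ (b τ)) := by
      have e2 : ∫ y in b τ..x, f τ (V τ) y = ∫ y in b τ..x, deriv K (Θ τ y) * V τ y := by
        refine intervalIntegral.integral_congr ?_
        intro y hy
        have hy' : y ∈ Icc (-R) R := by
          refine (ordConnected_Icc.uIcc_subset ?_ ?_) hy
          · exact Ioo_subset_Icc_self (b_mem τ hτ)
          · exact Ioo_subset_Icc_self hx
        simp only [hf, flowField_apply, hΘ]
        rw [c_eq y hy']
      rw [e2]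
      refine intervalIntegral.integral_eq_sub_of_hasDerivAt (f := fun y => K (Θ τ y))
        (fun y _ => (hK.hasDerivAt _).comp y (dΘx τ y)) ?_
      refine Continuous.intervalIntegrable ?_ _ _
      exact (hK.continuous_deriv.comp (continuous_iff_continuousAt.2 fun y =>
        (dΘx τ y).continuousAt)).mul (V τ).continuous
    rw [firing, ← intervalIntegral.integral_interval_sub_left
      ((f τ (V τ)).continuous.intervalIntegrable 0 x)
      ((f τ (V τ)).continuous.intervalIntegrable 0 (b τ))] at e1
    simp [hn]
    linarith
  · refine ContinuousOn.congr (f := fun q : ℝ × ℝ => Φ + (∫ y in (0 : ℝ)..q.2, V q.1 y) -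
      ∫ y in (0 : ℝ)..b q.1, V q.1 y) ?_ fun q _ => Θ_eq q.1 q.2
    exact (continuousOn_const.add (cprim continuousOn_snd)).sub
      (cprim (cb.comp continuous_fst).continuousOn)
  · exact ceval.comp_continuousOn (f := fun q : ℝ × ℝ => (V q.1, q.2))
      ((cV.comp continuousOn_fst fun q hq => hq.1).prodMk continuousOn_snd)
  · refine ContinuousOn.sub (ContinuousOn.mul ?_ (by fun_prop)) continuousOn_const
    exact ceval.comp_continuousOn (f := fun τ : ℝ => (V τ, b τ)) (cV.prodMk cb.continuousOn)
  · have e : ∀ y, V 0 y = 1 := fun y => by rw [V0]; rfl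
    have hb0 : b 0 = Φ := by simp [hb, p1]
    simp only [hΘ, e, hb0]
    simp
  · rw [V0]; rfl
  · have h1 : (1 / 2) * (b τ - -R) ≤ ∫ y in (-R)..b τ, V τ y := by
      have := intervalIntegral.integral_mono_on (a := -R) (b := b τ) (f := fun _ => (1 / 2 : ℝ))
        (b_mem τ hτ).1.le (by simp) (ii τ _ _) fun y _ => V_lower τ hτ y
      rw [intervalIntegral.integral_const, smul_eq_mul] at this
      linarith
    have h2 := (abs_le.1 (b_abs τ (sub hτ))).1
    simp only [hΘ]
    rw [intervalIntegral.integral_symm]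
    linarith
  · have h1 : 0 ≤ ∫ y in b τ..R, V τ y :=
      intervalIntegral.integral_nonneg (b_mem τ hτ).2.le fun y _ => by
        linarith [V_lower τ hτ y]
    simp only [hΘ]
    linarith
  · have := abs_le.1 (hB y hy)
    exact ⟨by linarith, by linarith⟩

/-! ### Entry labels: roots of the flow, and gluing at a point. -/

/-- The derivative of a zero of a strictly differentiable function of two real variables. -/
lemma hasDerivAt_of_implicit {f : ℝ → ℝ → ℝ} {a b s x : ℝ}
    (df : HasStrictFDerivAt (fun q : ℝ × ℝ => f q.1 q.2)
      (a • ContinuousLinearMap.fst ℝ ℝ ℝ + b • ContinuousLinearMap.snd ℝ ℝ ℝ) (s, x))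
    (hb : b ≠ 0) {z : ℝ → ℝ} (hz : z s = x)
    (hev : ∀ᶠ s' in 𝓝 s, ∀ y, f s' y = f s x → z s' = y) : HasDerivAt z (-a / b) s := by
  set L := a • ContinuousLinearMap.fst ℝ ℝ ℝ + b • ContinuousLinearMap.snd ℝ ℝ ℝ with hL
  have hinv : (L ∘L .inr ℝ ℝ ℝ).IsInvertible := by
    refine ⟨ContinuousLinearEquiv.unitsEquivAut ℝ (Units.mk0 b hb), ?_⟩
    ext
    simp [hL]
  have hψ := df.hasStrictFDerivAt_implicitFunctionOfProdDomain hinv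
  have hψe := df.eventually_apply_implicitFunctionOfProdDomain hinv
  set ψ := df.implicitFunctionOfProdDomain hinv
  have hzψ : z =ᶠ[𝓝 s] ψ := by
    filter_upwards [hev, hψe] with s' h1 h2
    exact h1 _ h2
  have dz : HasDerivAt z _ s := hψ.hasFDerivAt.hasDerivAt.congr_of_eventuallyEq hzψ
  refine dz.congr_deriv ?_
  -- The abstract derivative `d` is not computed; the chain rule along the constant level `f s' (z
  -- s')` gives `a + b * d = 0`.
  set d := (-(L ∘L .inr ℝ ℝ ℝ).inverse ∘L (L ∘L .inl ℝ ℝ ℝ)) 1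
  have hcurve : HasDerivAt (fun s' => (s', z s')) ((1, d) : ℝ × ℝ) s := (hasDerivAt_id s).prodMk dz
  have h1 := HasFDerivAt.comp_hasDerivAt_of_eq (f := fun s' => (s', z s')) s df.hasFDerivAt hcurve
    (by simp [hz])
  have h2 : HasDerivAt (fun s' => f s' (z s')) 0 s := by
    refine (hasDerivAt_const s (f s x)).congr_of_eventuallyEq ?_
    filter_upwards [hzψ, hψe] with s' e1 e2
    rw [e1]
    exact e2
  have h3 := h1.unique h2
  simp [hL] at h3
  rw [eq_div_iff hb]
  linarith

section Glue

variable {f g h : ℝ → ℝ} {c d : ℝ}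

lemma hasDerivAt_of_glue (hf : HasDerivAt f d c) (hg : HasDerivAt g d c)
    (ef : ∀ x ≤ c, h x = f x) (eg : ∀ x, c ≤ x → h x = g x) : HasDerivAt h d c := by
  have h1 : HasDerivWithinAt h d (Iic c) c :=
    hf.hasDerivWithinAt.congr (fun x hx => ef x hx) (ef c le_rfl)
  have h2 : HasDerivWithinAt h d (Ici c) c :=
    hg.hasDerivWithinAt.congr (fun x hx => eg x hx) (eg c le_rfl)
  have := h1.union h2
  rwa [Iic_union_Ici, hasDerivWithinAt_univ] at this

lemma continuousAt_of_glue (hf : ContinuousAt f c) (hg : ContinuousAt g c)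
    (ef : ∀ x ≤ c, h x = f x) (eg : ∀ x, c ≤ x → h x = g x) : ContinuousAt h c := by
  have h1 : ContinuousWithinAt h (Iic c) c :=
    hf.continuousWithinAt.congr (fun x hx => ef x hx) (ef c le_rfl)
  have h2 : ContinuousWithinAt h (Ici c) c :=
    hg.continuousWithinAt.congr (fun x hx => eg x hx) (eg c le_rfl)
  have := h1.union h2
  rwa [Iic_union_Ici, continuousWithinAt_univ] at this

end Glue

section Root

variable {Φ ε R : ℝ} {K p p' : ℝ → ℝ} {Θ V : ℝ → ℝ → ℝ} {n : ℝ → ℝ}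

lemma IsFlow.strictMono (h : IsFlow Φ K p p' ε R Θ V n) {τ : ℝ} (hτ : τ ∈ Ioo (-ε) ε) :
    StrictMono (Θ τ) := strictMono_of_deriv_pos fun x => by
  rw [(h.hasDerivAt_space τ hτ x).deriv]
  exact h.space_pos τ hτ x

lemma IsFlow.hasStrictFDerivAt (hK : Continuous K) (h : IsFlow Φ K p p' ε R Θ V n) {τ x : ℝ}
    (hτ : τ ∈ Ioo (-ε) ε) (hx : x ∈ Ioo (-R) R) :
    HasStrictFDerivAt (fun q : ℝ × ℝ => Θ q.1 q.2)
      ((n τ + K (Θ τ x)) • ContinuousLinearMap.fst ℝ ℝ ℝ +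
        V τ x • ContinuousLinearMap.snd ℝ ℝ ℝ) (τ, x) := by
  have h1 : ∀ᶠ q : ℝ × ℝ in 𝓝 (τ, x), q.1 ∈ Ioo (-ε) ε :=
    continuous_fst.continuousAt.eventually (isOpen_Ioo.mem_nhds hτ)
  have h2 : ∀ᶠ q : ℝ × ℝ in 𝓝 (τ, x), q.2 ∈ Ioo (-R) R :=
    continuous_snd.continuousAt.eventually (isOpen_Ioo.mem_nhds hx)
  have hnhds : Ioo (-ε) ε ×ˢ (univ : Set ℝ) ∈ 𝓝 (τ, x) :=
    prod_mem_nhds (isOpen_Ioo.mem_nhds hτ) univ_mem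
  refine hasStrictFDerivAt_of_partials (f := Θ) (a := fun τ x => n τ + K (Θ τ x)) (b := V)
    ?_ ?_ ?_ ?_
  · filter_upwards [h1, h2] with q q1 q2 using h.hasDerivAt_time q.1 q1 q.2 q2
  · filter_upwards [h1] with q q1 using h.hasDerivAt_space q.1 q1 q.2
  · have c1 : ContinuousAt (fun q : ℝ × ℝ => n q.1) (τ, x) :=
      ContinuousAt.comp (f := Prod.fst) (h.continuousOn_rate.continuousAt
        (isOpen_Ioo.mem_nhds hτ)) continuous_fst.continuousAt
    exact c1.add (hK.continuousAt.comp (h.continuousOn.continuousAt hnhds))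
  · exact h.continuousOn_space.continuousAt hnhds

/-- The position from which the phase `0` has been reached at time `s`. -/
lemma IsFlow.exists_root (hK : Continuous K) (h : IsFlow Φ K p p' ε R Θ V n) (hε : 0 < ε) :
    ∃ z : ℝ → ℝ, (∀ s ∈ Ioo (-ε) ε, z s ∈ Ioo (-R) R ∧ Θ s (z s) = 0 ∧
      HasDerivAt z (-(n s + K 0) / V s (z s)) s) ∧ z 0 = 0 := by
  have ex : ∀ s ∈ Ioo (-ε) ε, ∃ x ∈ Ioo (-R) R, Θ s x = 0 := by
    intro s hs
    have hm := h.strictMono hs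
    have hR : -R ≤ R := (hm.lt_iff_lt.1 ((h.neg s hs).trans (h.pos s hs))).le
    exact intermediate_value_Ioo hR (fun x _ => (h.hasDerivAt_space s hs x).continuousAt.continuousWithinAt)
      ⟨h.neg s hs, h.pos s hs⟩
  choose! z hz using ex
  refine ⟨z, fun s hs => ⟨(hz s hs).1, (hz s hs).2, ?_⟩, ?_⟩
  · have hd := h.hasStrictFDerivAt hK hs (hz s hs).1
    rw [(hz s hs).2] at hd
    refine hasDerivAt_of_implicit (f := Θ) hd (h.space_pos s hs _).ne' rfl ?_
    filter_upwards [isOpen_Ioo.mem_nhds hs] with s' hs' y hy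
    rw [(hz s hs).2, ← (hz s' hs').2] at hy
    exact ((h.strictMono hs').injective hy).symm
  · have h0 : (0 : ℝ) ∈ Ioo (-ε) ε := ⟨by linarith, hε⟩
    have := (hz 0 h0).2
    rwa [h.initial] at this

end Root

/-! ### Strong solutions for a short time. -/

/-- Solutions of class `C¹` on `S × [0, 1]`, described through their partial derivatives. -/
structure IsStrongSolution (Φ : ℝ) (K : ℝ → ℝ) (S : Set ℝ) (Q u : ℝ → ℝ → ℝ) (n : ℝ → ℝ) :
    Prop where
  continuousOn : ContinuousOn (fun p : ℝ × ℝ => Q p.1 p.2) (S ×ˢ Icc 0 1)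
  continuousOn_density : ContinuousOn (fun p : ℝ × ℝ => u p.1 p.2) (S ×ˢ Icc 0 1)
  continuousOn_rate : ContinuousOn n S
  hasDerivWithinAt_space : ∀ τ ∈ S, ∀ η ∈ Icc (0 : ℝ) 1,
    HasDerivWithinAt (Q τ) (u τ η) (Icc 0 1) η
  hasDerivWithinAt_time : ∀ τ ∈ S, ∀ η ∈ Icc (0 : ℝ) 1,
    HasDerivWithinAt (fun s => Q s η) (n τ + K (Q τ η) - u τ η) S τ
  left : ∀ τ ∈ S, Q τ 0 = 0
  right : ∀ τ ∈ S, Q τ 1 = Φ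
  density_left : ∀ τ ∈ S, u τ 0 = n τ + K 0
  density_right : ∀ τ ∈ S, u τ 1 = n τ + K Φ

/-- Initial data of class `C¹` with the compatibility condition but without sign conditions. -/
structure IsStrongDatum (Φ : ℝ) (K q q' : ℝ → ℝ) : Prop where
  hasDerivWithinAt : ∀ η ∈ Icc (0 : ℝ) 1, HasDerivWithinAt q (q' η) (Icc 0 1) η
  continuousOn : ContinuousOn q' (Icc 0 1)
  left : q 0 = 0
  right : q 1 = Φ
  compat : q' 1 - q' 0 = K Φ - K 0

/-- Existence on a time interval whose length depends on a bound for `K'` only. -/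
theorem exists_isStrongSolution_Icc {Φ : ℝ} {K : ℝ → ℝ} (hΦ : 0 < Φ) (hK : IsPhaseResponse Φ K)
    {C δ : ℝ} (hC : ∀ x, |deriv K x| ≤ C) (hδ : 0 < δ) (hδ1 : 2 * δ ≤ 1)
    (hCδ : C * (3 / 2) * (2 * δ) ≤ 1 / 2) {q q' : ℝ → ℝ} (hq : IsStrongDatum Φ K q q') :
    ∃ Q u n, IsStrongSolution Φ K (Icc 0 δ) Q u n ∧ ∀ η ∈ Icc (0 : ℝ) 1, Q 0 η = q η := by
  obtain ⟨p, p', dp, cp', ep, ep'⟩ := exists_contDiff_extension hq.hasDerivWithinAt hq.continuousOn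
  have p0 : p 0 = 0 := (ep (by simp)).trans hq.left
  have p1 : p 1 = Φ := (ep (by simp)).trans hq.right
  have hcompat : p' 1 - p' 0 = K Φ - K 0 := by
    rw [ep' (by simp : (1 : ℝ) ∈ Icc (0 : ℝ) 1), ep' (by simp : (0 : ℝ) ∈ Icc (0 : ℝ) 1)]
    exact hq.compat
  have hε : 0 < 2 * δ := by linarith
  obtain ⟨R, Θ, V, n, h⟩ := exists_isFlow hΦ hK hC hε hδ1 hCδ dp cp' p1
  -- Twice the time step, so that `[0, δ]` lies in the open interval of the flow and all derivatives
  -- are two-sided.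
  set ε := 2 * δ with hεδ
  obtain ⟨z, hz, z0⟩ := h.exists_root hK.continuous hε
  have mem0 : (0 : ℝ) ∈ Ioo (-ε) ε := ⟨by linarith, hε⟩
  have cz : ContinuousOn z (Ioo (-ε) ε) := fun s hs => (hz s hs).2.2.continuousAt.continuousWithinAt
  have cz' : ContinuousOn (fun s => -(n s + K 0) / V s (z s)) (Ioo (-ε) ε) := by
    refine ContinuousOn.div (h.continuousOn_rate.add continuousOn_const).neg ?_
      fun s hs => (h.space_pos s hs _).ne'
    exact h.continuousOn_space.comp (f := fun s => (s, z s)) (continuousOn_id.prodMk cz)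
      fun s hs => ⟨hs, trivial⟩
  -- `Z s` labels the characteristic `τ - η = s`: for `s ≤ 0` it starts in the initial datum, for `s
  -- > 0` it enters through `η = 0` at time `s`. The solution is `Q τ η = Θ τ (Z (τ - η))`.
  set Z : ℝ → ℝ := fun s => if s ≤ 0 then p (-s) else z s with hZ
  set Z' : ℝ → ℝ := fun s => if s ≤ 0 then -p' (-s) else -(n s + K 0) / V s (z s) with hZ'
  have Zneg : ∀ s ≤ 0, Z s = p (-s) := fun s hs => if_pos hs
  have Z'neg : ∀ s ≤ 0, Z' s = -p' (-s) := fun s hs => if_pos hs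
  have Zpos : ∀ s, 0 ≤ s → Z s = z s := fun s hs => by
    rcases hs.eq_or_lt with rfl | hs
    · rw [Zneg 0 le_rfl, neg_zero, p0, z0]
    · exact if_neg (not_le.2 hs)
  -- As `V 0 = 1` and `n 0 = p' 1 - K Φ`, this is exactly the compatibility condition.
  have deriv_match : -p' (-0) = -(n 0 + K 0) / V 0 (z 0) := by
    rw [h.space_initial, h.rate, h.space_initial, neg_zero, sub_zero]
    linarith
  have Z'pos : ∀ s, 0 ≤ s → Z' s = -(n s + K 0) / V s (z s) := fun s hs => by
    rcases hs.eq_or_lt with rfl | hs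
    · rw [Z'neg 0 le_rfl, deriv_match]
    · exact if_neg (not_le.2 hs)
  have dneg : ∀ s, HasDerivAt (fun s => p (-s)) (-p' (-s)) s := fun s => by
    exact ((dp (-s)).comp s (hasDerivAt_neg s)).congr_deriv (by ring)
  have dZ : ∀ s < ε, HasDerivAt Z (Z' s) s := by
    intro s hs
    rcases lt_trichotomy s 0 with hs0 | rfl | hs0
    · rw [Z'neg s hs0.le]
      refine (dneg s).congr_of_eventuallyEq ?_
      filter_upwards [Iio_mem_nhds hs0] with r hr using Zneg r (le_of_lt hr)
    · rw [Z'neg 0 le_rfl]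
      exact hasDerivAt_of_glue (dneg 0) (deriv_match ▸ (hz 0 mem0).2.2) Zneg Zpos
    · rw [Z'pos s hs0.le]
      refine (hz s ⟨by linarith, hs⟩).2.2.congr_of_eventuallyEq ?_
      filter_upwards [Ioi_mem_nhds hs0] with r hr using Zpos r (le_of_lt hr)
  have cZ : ContinuousOn Z (Iio ε) := fun s hs => (dZ s hs).continuousAt.continuousWithinAt
  have cneg : Continuous fun s => -p' (-s) := by fun_prop
  have cZ' : ContinuousOn Z' (Iio ε) := by
    refine fun s hs => ContinuousAt.continuousWithinAt ?_
    rcases lt_trichotomy s 0 with hs0 | rfl | hs0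
    · refine cneg.continuousAt.congr ?_
      filter_upwards [Iio_mem_nhds hs0] with r hr using (Z'neg r (le_of_lt hr)).symm
    · exact continuousAt_of_glue cneg.continuousAt (cz'.continuousAt (isOpen_Ioo.mem_nhds mem0))
        Z'neg Z'pos
    · refine (cz'.continuousAt (isOpen_Ioo.mem_nhds ⟨by linarith, hs⟩)).congr ?_
      filter_upwards [Ioi_mem_nhds hs0] with r hr using (Z'pos r (le_of_lt hr)).symm
  have Zmem : ∀ s, -1 ≤ s → s < ε → Z s ∈ Ioo (-R) R := by
    intro s hs hs'
    rcases le_total s 0 with hs0 | hs0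
    · rw [Zneg s hs0]
      exact h.mem _ ⟨by linarith, by linarith⟩
    · rw [Zpos s hs0]
      exact (hz s ⟨by linarith, hs'⟩).1
  have memI : ∀ τ ∈ Icc 0 δ, τ ∈ Ioo (-ε) ε := fun τ hτ =>
    ⟨by linarith [hτ.1], by linarith [hτ.2]⟩
  have maps : MapsTo (fun r : ℝ × ℝ => r.1 - r.2) (Icc 0 δ ×ˢ Icc 0 1) (Iio ε) := fun r hr => by
    have := hr.1.2
    have := hr.2.1
    exact (by linarith : r.1 - r.2 < ε)
  have clabel : ContinuousOn (fun r : ℝ × ℝ => (r.1, Z (r.1 - r.2))) (Icc 0 δ ×ˢ Icc 0 1) :=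
    continuousOn_fst.prodMk (cZ.comp (by fun_prop) maps)
  have mlabel : MapsTo (fun r : ℝ × ℝ => (r.1, Z (r.1 - r.2))) (Icc 0 δ ×ˢ Icc 0 1)
      (Ioo (-ε) ε ×ˢ univ) := fun r hr => ⟨memI _ hr.1, trivial⟩
  -- As `δ < 1`, the oscillators firing during the time step all stem from the initial datum.
  have firing : ∀ τ ∈ Icc 0 δ, Z (τ - 1) = p (1 - τ) := fun τ hτ => by
    rw [Zneg _ (by linarith [hτ.2]), neg_sub]
  refine ⟨fun τ η => Θ τ (Z (τ - η)), fun τ η => -(V τ (Z (τ - η)) * Z' (τ - η)), n,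
    ⟨h.continuousOn.comp clabel mlabel,
      ((h.continuousOn_space.comp clabel mlabel).mul (cZ'.comp (by fun_prop) maps)).neg,
      h.continuousOn_rate.mono memI, fun τ hτ η hη => ?_, fun τ hτ η hη => ?_, fun τ hτ => ?_,
      fun τ hτ => ?_, fun τ hτ => ?_, fun τ hτ => ?_⟩, fun η hη => ?_⟩
  · have h1 := (dZ (τ - η) (maps (x := (τ, η)) ⟨hτ, hη⟩)).comp η
      ((hasDerivAt_id η).const_sub τ)
    have h2 := (h.hasDerivAt_space τ (memI τ hτ) (Z (τ - η))).comp η h1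
    exact (h2.congr_deriv (by ring)).hasDerivWithinAt
  · have hs : τ - η < ε := maps (x := (τ, η)) ⟨hτ, hη⟩
    have h1 := (dZ (τ - η) hs).comp τ ((hasDerivAt_id τ).sub_const η)
    have hcurve := (hasDerivAt_id τ).prodMk h1
    have hd := (h.hasStrictFDerivAt hK.continuous (memI τ hτ)
      (Zmem (τ - η) (by linarith [hτ.1, hη.2]) hs)).hasFDerivAt
    have h2 := HasFDerivAt.comp_hasDerivAt_of_eq τ hd hcurve (by simp)
    refine (h2.congr_deriv ?_).hasDerivWithinAt
    simp
  · rw [sub_zero, Zpos τ hτ.1, (hz τ (memI τ hτ)).2.1]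
  · rw [firing τ hτ, h.firing]
  · have := (h.space_pos τ (memI τ hτ) (z τ)).ne'
    rw [sub_zero, Zpos τ hτ.1, Z'pos τ hτ.1]
    field_simp
  · rw [firing τ hτ, Z'neg _ (by linarith [hτ.2]), neg_sub, h.rate]
    ring
  · simp only
    rw [h.initial, Zneg _ (by linarith [hη.1])]
    rw [zero_sub, neg_neg, ep hη]

/-! ### Restarting, gluing and iterating in time. -/

section Gluing

variable {Φ : ℝ} {K : ℝ → ℝ} {S S' : Set ℝ} {Q u Q' u' : ℝ → ℝ → ℝ} {n n' : ℝ → ℝ}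

/-- Compatibility holds automatically at every time, because the two boundary values of the density
share the same rate; this makes the time step repeatable. -/
lemma IsStrongSolution.restart (h : IsStrongSolution Φ K S Q u n) {τ : ℝ} (hτ : τ ∈ S) :
    IsStrongDatum Φ K (Q τ) (u τ) where
  hasDerivWithinAt := h.hasDerivWithinAt_space τ hτ
  continuousOn := h.continuousOn_density.comp (f := fun η => (τ, η)) (by fun_prop)
    fun η hη => ⟨hτ, hη⟩
  left := h.left τ hτ
  right := h.right τ hτ
  compat := by
    have h1 := h.density_left τ hτ
    have h2 := h.density_right τ hτ
    linarith

lemma IsStrongSolution.density_eq (h : IsStrongSolution Φ K S Q u n)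
    (h' : IsStrongSolution Φ K S' Q' u' n') {τ τ' : ℝ} (hτ : τ ∈ S) (hτ' : τ' ∈ S')
    (hQ : EqOn (Q τ) (Q' τ') (Icc 0 1)) : EqOn (u τ) (u' τ') (Icc 0 1) := fun η hη =>
  (uniqueDiffOn_Icc_zero_one η hη).eq_deriv _ (h.hasDerivWithinAt_space τ hτ η hη)
    ((h'.hasDerivWithinAt_space τ' hτ' η hη).congr hQ (hQ hη))

lemma IsStrongSolution.rate_eq (h : IsStrongSolution Φ K S Q u n)
    (h' : IsStrongSolution Φ K S' Q' u' n') {τ τ' : ℝ} (hτ : τ ∈ S) (hτ' : τ' ∈ S')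
    (hQ : EqOn (Q τ) (Q' τ') (Icc 0 1)) : n τ = n' τ' := by
  have h1 := h.density_right τ hτ
  have h2 := h'.density_right τ' hτ'
  have h3 := h.density_eq h' hτ hτ' hQ (right_mem_Icc.2 zero_le_one)
  linarith

lemma IsStrongSolution.shift (h : IsStrongSolution Φ K S Q u n) (a : ℝ) :
    IsStrongSolution Φ K ((fun τ => τ - a) ⁻¹' S) (fun τ => Q (τ - a)) (fun τ => u (τ - a))
      (fun τ => n (τ - a)) where
  continuousOn := h.continuousOn.comp (f := fun p : ℝ × ℝ => (p.1 - a, p.2)) (by fun_prop)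
    fun p hp => ⟨hp.1, hp.2⟩
  continuousOn_density := h.continuousOn_density.comp (f := fun p : ℝ × ℝ => (p.1 - a, p.2))
    (by fun_prop) fun p hp => ⟨hp.1, hp.2⟩
  continuousOn_rate := h.continuousOn_rate.comp (by fun_prop) fun τ hτ => hτ
  hasDerivWithinAt_space := fun τ hτ => h.hasDerivWithinAt_space _ hτ
  hasDerivWithinAt_time := fun τ hτ η hη => by
    have h1 := (h.hasDerivWithinAt_time _ hτ η hη).comp τ
      (((hasDerivAt_id τ).sub_const a).hasDerivWithinAt (s := (fun τ => τ - a) ⁻¹' S))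
      fun s hs => hs
    exact h1.congr_deriv (mul_one _)
  left := fun τ hτ => h.left _ hτ
  right := fun τ hτ => h.right _ hτ
  density_left := fun τ hτ => h.density_left _ hτ
  density_right := fun τ hτ => h.density_right _ hτ

lemma IsStrongSolution.congr (h : IsStrongSolution Φ K S Q u n)
    (hQ : ∀ τ ∈ S, EqOn (Q' τ) (Q τ) (Icc 0 1)) (hu : ∀ τ ∈ S, EqOn (u' τ) (u τ) (Icc 0 1))
    (hn : EqOn n' n S) : IsStrongSolution Φ K S Q' u' n' where
  continuousOn := h.continuousOn.congr fun p hp => hQ p.1 hp.1 hp.2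
  continuousOn_density := h.continuousOn_density.congr fun p hp => hu p.1 hp.1 hp.2
  continuousOn_rate := h.continuousOn_rate.congr hn
  hasDerivWithinAt_space := fun τ hτ η hη => by
    rw [hu τ hτ hη]
    exact (h.hasDerivWithinAt_space τ hτ η hη).congr (hQ τ hτ) (hQ τ hτ hη)
  hasDerivWithinAt_time := fun τ hτ η hη => by
    rw [hu τ hτ hη, hn hτ, hQ τ hτ hη]
    exact (h.hasDerivWithinAt_time τ hτ η hη).congr (fun s hs => hQ s hs hη) (hQ τ hτ hη)
  left := fun τ hτ => by rw [hQ τ hτ (left_mem_Icc.2 zero_le_one), h.left τ hτ]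
  right := fun τ hτ => by rw [hQ τ hτ (right_mem_Icc.2 zero_le_one), h.right τ hτ]
  density_left := fun τ hτ => by
    rw [hu τ hτ (left_mem_Icc.2 zero_le_one), hn hτ, h.density_left τ hτ]
  density_right := fun τ hτ => by
    rw [hu τ hτ (right_mem_Icc.2 zero_le_one), hn hτ, h.density_right τ hτ]

/-- Two pieces are allowed at each point because consecutive closed time intervals are
neighbourhoods of their common end point only together. -/
lemma continuousOn_prod_of_cover {ι : Type*} {f : ℝ × ℝ → ℝ} {P : ι → Set ℝ} {t : Set ℝ}
    (hf : ∀ i, ContinuousOn f (P i ×ˢ t))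
    (hP : ∀ τ ∈ S, ∃ i j, τ ∈ P i ∧ τ ∈ P j ∧ P i ∪ P j ∈ 𝓝[S] τ) :
    ContinuousOn f (S ×ˢ t) := by
  rintro ⟨τ, η⟩ ⟨hτ, hη⟩
  obtain ⟨i, j, hi, hj, hij⟩ := hP τ hτ
  have h1 := (hf i (τ, η) ⟨hi, hη⟩).union (hf j (τ, η) ⟨hj, hη⟩)
  rw [← union_prod] at h1
  refine h1.mono_of_mem_nhdsWithin ?_
  rw [nhdsWithin_prod_eq]
  exact prod_mem_prod hij self_mem_nhdsWithin

lemma IsStrongSolution.of_cover {ι : Type*} {P : ι → Set ℝ}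
    (h : ∀ i, IsStrongSolution Φ K (P i) Q u n)
    (hP : ∀ τ ∈ S, ∃ i j, τ ∈ P i ∧ τ ∈ P j ∧ P i ∪ P j ∈ 𝓝[S] τ) :
    IsStrongSolution Φ K S Q u n := by
  have hP' : ∀ τ ∈ S, ∃ i, τ ∈ P i := fun τ hτ =>
    let ⟨i, _, hi, _⟩ := hP τ hτ
    ⟨i, hi⟩
  refine ⟨continuousOn_prod_of_cover (fun i => (h i).continuousOn) hP,
    continuousOn_prod_of_cover (fun i => (h i).continuousOn_density) hP, fun τ hτ => ?_,
    fun τ hτ => ?_, fun τ hτ η hη => ?_, fun τ hτ => ?_, fun τ hτ => ?_, fun τ hτ => ?_,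
    fun τ hτ => ?_⟩
  · obtain ⟨i, j, hi, hj, hij⟩ := hP τ hτ
    exact (((h i).continuousOn_rate τ hi).union
      ((h j).continuousOn_rate τ hj)).mono_of_mem_nhdsWithin hij
  · obtain ⟨i, hi⟩ := hP' τ hτ
    exact (h i).hasDerivWithinAt_space τ hi
  · obtain ⟨i, j, hi, hj, hij⟩ := hP τ hτ
    exact (((h i).hasDerivWithinAt_time τ hi η hη).union
      ((h j).hasDerivWithinAt_time τ hj η hη)).mono_of_mem_nhdsWithin hij
  · obtain ⟨i, hi⟩ := hP' τ hτ
    exact (h i).left τ hi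
  · obtain ⟨i, hi⟩ := hP' τ hτ
    exact (h i).right τ hi
  · obtain ⟨i, hi⟩ := hP' τ hτ
    exact (h i).density_left τ hi
  · obtain ⟨i, hi⟩ := hP' τ hτ
    exact (h i).density_right τ hi

lemma exists_cover_Icc {δ : ℝ} (hδ : 0 < δ) (τ : ℝ) (hτ : τ ∈ Ici (0 : ℝ)) :
    ∃ i j : ℕ, τ ∈ Icc (i * δ) ((i + 1) * δ) ∧ τ ∈ Icc (j * δ) ((j + 1) * δ) ∧
      Icc (i * δ) ((i + 1) * δ) ∪ Icc (j * δ) ((j + 1) * δ) ∈ 𝓝[Ici 0] τ := by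
  set m := ⌊τ / δ⌋₊ with hm
  have h1 : m * δ ≤ τ := (le_div_iff₀ hδ).1 (Nat.floor_le (div_nonneg hτ hδ.le))
  have h2 : τ < (m + 1) * δ := (div_lt_iff₀ hδ).1 (Nat.lt_floor_add_one _)
  rcases h1.eq_or_lt with h3 | h3
  · rcases Nat.eq_zero_or_pos m with h0 | h0
    · refine ⟨m, m, ⟨h1, h2.le⟩, ⟨h1, h2.le⟩, ?_⟩
      rw [union_self]
      filter_upwards [self_mem_nhdsWithin, nhdsWithin_le_nhds (Iio_mem_nhds h2)] with s hs hs'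
      rw [h0] at hs' ⊢
      exact ⟨by simpa using hs, le_of_lt hs'⟩
    · obtain ⟨l, hl⟩ := Nat.exists_eq_add_of_le' h0
      have hl' : (m : ℝ) = l + 1 := by rw [hl]; push_cast; ring
      rw [hl'] at h1 h2 h3
      refine ⟨l, m, ⟨by linarith, h3.ge⟩, ⟨by rw [hl']; exact h1, by rw [hl']; exact h2.le⟩, ?_⟩
      have h4 : (l : ℝ) * δ < τ := by linarith
      filter_upwards [nhdsWithin_le_nhds (Ioo_mem_nhds h4 h2)] with s hs
      rcases le_total s ((l + 1) * δ) with h5 | h5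
      · exact Or.inl ⟨hs.1.le, h5⟩
      · exact Or.inr ⟨by rw [hl']; exact h5, by rw [hl']; exact hs.2.le⟩
  · refine ⟨m, m, ⟨h1, h2.le⟩, ⟨h1, h2.le⟩, ?_⟩
    rw [union_self]
    exact nhdsWithin_le_nhds (Icc_mem_nhds h3 h2)

/-- A solution operator for a fixed time step can be iterated. -/
lemma exists_isStrongSolution_Ici {δ : ℝ} (hδ : 0 < δ)
    (hstep : ∀ q q' : ℝ → ℝ, IsStrongDatum Φ K q q' → ∃ Q u n,
      IsStrongSolution Φ K (Icc 0 δ) Q u n ∧ ∀ η ∈ Icc (0 : ℝ) 1, Q 0 η = q η)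
    {q q' : ℝ → ℝ} (hq : IsStrongDatum Φ K q q') :
    ∃ Q u n, IsStrongSolution Φ K (Ici 0) Q u n ∧ ∀ η ∈ Icc (0 : ℝ) 1, Q 0 η = q η := by
  let X := {s : (ℝ → ℝ → ℝ) × (ℝ → ℝ → ℝ) × (ℝ → ℝ) //
    IsStrongSolution Φ K (Icc 0 δ) s.1 s.2.1 s.2.2}
  have hnext : ∀ s : X, ∃ t : X, ∀ η ∈ Icc (0 : ℝ) 1, t.1.1 0 η = s.1.1 δ η := fun s => by
    obtain ⟨Q, u, n, h, h0⟩ := hstep _ _ (s.2.restart (right_mem_Icc.2 hδ.le))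
    exact ⟨⟨(Q, u, n), h⟩, h0⟩
  choose next hnext using hnext
  obtain ⟨Q₀, u₀, n₀, h₀, hQ₀⟩ := hstep q q' hq
  let σ : ℕ → X := fun m => m.rec ⟨(Q₀, u₀, n₀), h₀⟩ fun _ s => next s
  have hσ : ∀ m, EqOn ((σ (m + 1)).1.1 0) ((σ m).1.1 δ) (Icc 0 1) := fun m => hnext (σ m)
  let m : ℝ → ℕ := fun τ => ⌊τ / δ⌋₊
  have zmem : (0 : ℝ) ∈ Icc 0 δ := left_mem_Icc.2 hδ.le
  have dmem : δ ∈ Icc 0 δ := right_mem_Icc.2 hδ.le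
  -- The floor assigns the right end point of a piece to the next piece, at its local time `0`;
  -- there the values agree because each step starts from the final state of the previous one.
  have hm : ∀ (i : ℕ) (τ : ℝ), τ ∈ Icc (i * δ) ((i + 1) * δ) →
      m τ = i ∨ (m τ = i + 1 ∧ τ - (i + 1 : ℕ) * δ = 0 ∧ τ - i * δ = δ) := by
    intro i τ hτ
    have hnn : 0 ≤ τ / δ := div_nonneg ((by positivity : (0 : ℝ) ≤ i * δ).trans hτ.1) hδ.le
    rcases hτ.2.eq_or_lt with h1 | h1
    · right
      refine ⟨?_, ?_, ?_⟩
      · have : τ / δ = (i + 1 : ℕ) := by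
          rw [h1]; push_cast; field_simp
        simp only [m, this, Nat.floor_natCast]
      · rw [h1]; push_cast; ring
      · rw [h1]; ring
    · left
      exact (Nat.floor_eq_iff hnn).2 ⟨(le_div_iff₀ hδ).2 hτ.1, (div_lt_iff₀ hδ).2 h1⟩
  refine ⟨fun τ => (σ (m τ)).1.1 (τ - m τ * δ), fun τ => (σ (m τ)).1.2.1 (τ - m τ * δ),
    fun τ => (σ (m τ)).1.2.2 (τ - m τ * δ),
    IsStrongSolution.of_cover (P := fun i : ℕ => Icc (i * δ) ((i + 1) * δ)) (fun i => ?_)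
      (exists_cover_Icc hδ), fun η hη => ?_⟩
  · have hset : (fun τ => τ - i * δ) ⁻¹' Icc 0 δ = Icc (i * δ) ((i + 1) * δ) := by
      ext τ
      simp only [mem_preimage, mem_Icc]
      constructor <;> rintro ⟨h1, h2⟩ <;> constructor <;> linarith
    have hi := (σ i).2.shift (i * δ)
    rw [hset] at hi
    refine hi.congr (fun τ hτ => ?_) (fun τ hτ => ?_) (fun τ hτ => ?_)
    all_goals rcases hm i τ hτ with h1 | ⟨h1, h2, h3⟩
    · simp only [h1]; exact fun _ _ => rfl
    · simp only [h1, h2, h3]; exact hσ i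
    · simp only [h1]; exact fun _ _ => rfl
    · simp only [h1, h2, h3]; exact (σ (i + 1)).2.density_eq (σ i).2 zmem dmem (hσ i)
    · simp only [h1]
    · simp only [h1, h2, h3]; exact (σ (i + 1)).2.rate_eq (σ i).2 zmem dmem (hσ i)
  · have : m 0 = 0 := by simp [m]
    simp only [this, Nat.cast_zero, zero_mul, sub_zero]
    exact hQ₀ η hη

end Gluing

/-! ### Global existence, uniqueness and the steady state. -/

section Global

variable {Φ : ℝ} {K q : ℝ → ℝ} {Q u : ℝ → ℝ → ℝ} {n : ℝ → ℝ}

/-- There is a global solution for every `C¹` datum, if its sign properties are ignored. -/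
theorem IsStrongDatum.exists_isStrongSolution (hΦ : 0 < Φ) (hK : IsPhaseResponse Φ K)
    {q' : ℝ → ℝ} (hq : IsStrongDatum Φ K q q') :
    ∃ Q u n, IsStrongSolution Φ K (Ici 0) Q u n ∧ ∀ η ∈ Icc (0 : ℝ) 1, Q 0 η = q η := by
  obtain ⟨C, hC0, hC, -⟩ := hK.exists_lipschitz
  have hpos : 0 < 6 * (C + 1) := by positivity
  -- A step `δ` with `2 * δ ≤ 1` and `3 * C * δ ≤ 1 / 2`, as the local existence theorem requires;
  -- the summand `1` covers `C = 0`.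
  have hδ : 0 < 1 / (6 * (C + 1)) := by positivity
  refine exists_isStrongSolution_Ici hδ (fun q q' hq => ?_) hq
  refine exists_isStrongSolution_Icc hΦ hK hC hδ ?_ ?_ hq
  · rw [mul_one_div, div_le_one hpos]
    linarith
  · rw [show C * (3 / 2) * (2 * (1 / (6 * (C + 1)))) = 3 * C / (6 * (C + 1)) by ring,
      div_le_iff₀ hpos]
    linarith

lemma IsStrongSolution.continuousOn_time_deriv (hK : Continuous K)
    (h : IsStrongSolution Φ K (Ici 0) Q u n) :
    ContinuousOn (fun p : ℝ × ℝ => n p.1 + K (Q p.1 p.2) - u p.1 p.2) (Ici 0 ×ˢ Icc 0 1) :=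
  ((h.continuousOn_rate.comp continuousOn_fst fun _ hp => hp.1).add
    (hK.comp_continuousOn h.continuousOn)).sub h.continuousOn_density

lemma IsStrongSolution.isRegularSolution (hK : Continuous K)
    (h : IsStrongSolution Φ K (Ici 0) Q u n) : IsRegularSolution Φ K ⊤ Q u n := by
  refine ⟨?_, ?_, ?_, ?_, fun t _ ht0 x hx => ?_, ?_, ?_, ?_, ?_⟩
  · exact timeInterval_top ▸ h.continuousOn
  · exact timeInterval_top ▸ h.continuousOn_density
  · exact timeInterval_top ▸ h.continuousOn_rate
  · exact timeInterval_top ▸ h.hasDerivWithinAt_space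
  · have hnhds : Ici (0 : ℝ) ×ˢ Icc (0 : ℝ) 1 ∈ 𝓝 (t, x) :=
      prod_mem_nhds (Ici_mem_nhds ht0) (Icc_mem_nhds hx.1 hx.2)
    have h1 := (hasFDerivWithinAt_of_partials (convex_Ici 0) h.hasDerivWithinAt_time
      h.hasDerivWithinAt_space (h.continuousOn_time_deriv hK)
      (mem_of_mem_nhds hnhds)).hasFDerivAt hnhds
    have h2 : HasDerivAt (fun r : ℝ => (t + r, x + r)) ((1, 1) : ℝ × ℝ) 0 :=
      ((hasDerivAt_id (0 : ℝ)).const_add t).prodMk ((hasDerivAt_id (0 : ℝ)).const_add x)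
    have h3 := HasFDerivAt.comp_hasDerivAt_of_eq (f := fun r : ℝ => (t + r, x + r)) 0 h1 h2
      (by simp)
    refine h3.congr_deriv ?_
    simp
  · exact timeInterval_top ▸ h.left
  · exact timeInterval_top ▸ h.right
  · exact timeInterval_top ▸ h.density_left
  · exact timeInterval_top ▸ h.density_right

lemma IsStrongSolution.dEta_eq {S : Set ℝ} (h : IsStrongSolution Φ K S Q u n) {τ : ℝ}
    (hτ : τ ∈ S) {η : ℝ} (hη : η ∈ Icc (0 : ℝ) 1) : dEta (Q τ) η = u τ η :=
  (h.hasDerivWithinAt_space τ hτ η hη).derivWithin (uniqueDiffOn_Icc_zero_one η hη)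

lemma dEta_congr {q₁ q₂ : ℝ → ℝ} (h : EqOn q₁ q₂ (Icc 0 1)) {η : ℝ} (hη : η ∈ Icc (0 : ℝ) 1) :
    dEta q₁ η = dEta q₂ η :=
  derivWithin_congr h (h hη)

lemma IsInitialDatum.hasDerivWithinAt (hq : IsInitialDatum Φ K q) {η : ℝ}
    (hη : η ∈ Icc (0 : ℝ) 1) : HasDerivWithinAt q (dEta q η) (Icc 0 1) η :=
  (hq.contDiffOn.differentiableOn (by simp) η hη).hasDerivWithinAt

lemma IsCompatibleDatum.isStrongDatum (hq : IsCompatibleDatum Φ K q) :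
    IsStrongDatum Φ K q (dEta q) where
  hasDerivWithinAt := fun _ hη => hq.hasDerivWithinAt hη
  continuousOn := hq.contDiffOn.continuousOn_derivWithin uniqueDiffOn_Icc_zero_one le_rfl
  left := hq.left
  right := hq.right
  compat := hq.compat

/-- The positivity of `hInit` is propagated in the form `n > 0`. -/
lemma IsStrongSolution.isClassicalSolution (hΦ : 0 < Φ) (hK : IsPhaseResponse Φ K)
    (hk : kMax Φ K < 0) (hq : IsInitialDatum Φ K q) (hH : ∀ η ∈ Icc (0 : ℝ) 1, 0 < hInit K q η)
    (h : IsStrongSolution Φ K (Ici 0) Q u n) (h0 : ∀ η ∈ Icc (0 : ℝ) 1, Q 0 η = q η) :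
    IsClassicalSolution Φ K ⊤ q Q (fun τ => 1 / n τ) := by
  have hr := h.isRegularSolution hK.continuous
  have mem : ∀ τ : ℝ, 0 ≤ τ → τ ∈ timeInterval ⊤ := fun τ hτ => timeInterval_top ▸ hτ
  have hu0 : ∀ η ∈ Icc (0 : ℝ) 1, u 0 η = dEta q η := fun η hη => by
    rw [← h.dEta_eq self_mem_Ici hη, dEta_congr h0 hη]
  have u0 : ∀ η ∈ Icc (0 : ℝ) 1, 0 ≤ u 0 η := fun η hη => by
    rw [hu0 η hη]
    exact dEta_nonneg_of_monotoneOn hq.monotoneOn η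
  have hH0 : ∀ η ∈ Icc (0 : ℝ) 1, 0 < u 0 η - K (Q 0 η) := fun η hη => by
    rw [hu0 η hη, h0 η hη]
    exact hH η hη
  have npos : ∀ τ, 0 ≤ τ → 0 < n τ := fun τ hτ => hr.rate_pos hK hk hΦ u0 hH0 (mem τ hτ)
  -- `density_nonneg` reaches only times strictly before its final time, hence `τ + 1`.
  have unn : ∀ τ, 0 ≤ τ → ∀ η ∈ Icc (0 : ℝ) 1, 0 ≤ u τ η := fun τ hτ η hη =>
    hr.density_nonneg hK hΦ u0 (mem (τ + 1) (by linarith)) (fun s hs _ => (npos s hs).le) hτ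
      (lt_add_one τ) hη
  have one_mem : (1 : ℝ) ∈ Icc (0 : ℝ) 1 := right_mem_Icc.2 zero_le_one
  have hflux : ∀ τ, 0 ≤ τ → dEta (Q τ) 1 = n τ + K Φ := fun τ hτ => by
    rw [h.dEta_eq hτ one_mem, h.density_right τ hτ]
  refine ⟨by simp, hq, ?_, ?_, ?_, ?_, ?_, hr.left, ?_, h0, ?_⟩ <;> rw [timeInterval_top]
  · exact contDiffOn_of_partials (convex_Ici 0) (uniqueDiffOn_Ici 0) uniqueDiffOn_Icc_zero_one
      h.hasDerivWithinAt_time h.hasDerivWithinAt_space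
      (h.continuousOn_time_deriv hK.continuous) h.continuousOn_density
  · intro τ hτ
    exact monotoneOn_of_hasDerivWithinAt_nonneg (convex_Icc 0 1)
      (fun η hη => (h.hasDerivWithinAt_space τ hτ η hη).continuousWithinAt)
      (fun η hη => (h.hasDerivWithinAt_space τ hτ η (interior_subset hη)).mono interior_subset)
      fun η hη => unn τ hτ η (interior_subset hη)
  · exact continuousOn_const.div h.continuousOn_rate fun τ hτ => (npos τ hτ).ne'
  · exact fun τ hτ => one_div_pos.2 (npos τ hτ)
  · intro τ hτ η hη
    have hη' := Ioo_subset_Icc_self hη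
    rw [h.dEta_eq hτ hη',
      (h.hasDerivWithinAt_time τ hτ η hη').derivWithin (uniqueDiffOn_Ici 0 τ hτ), one_div_one_div]
    ring
  · intro τ hτ
    rw [one_div_one_div, hflux τ hτ]
    ring
  · intro τ hτ
    rw [hflux τ hτ]
    linarith [npos τ hτ]

/-- Two classical solutions at distance `0` at some time agree at that time. -/
lemma IsClassicalSolution.eq_of_bvDist_nonpos (hK : IsPhaseResponse Φ K) {q' : ℝ → ℝ}
    {Q' : ℝ → ℝ → ℝ} {N N' : ℝ → ℝ} {T T' : EReal} (h : IsClassicalSolution Φ K T q Q N)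
    (h' : IsClassicalSolution Φ K T' q' Q' N') {τ τ' : ℝ} (hτ : τ ∈ timeInterval T)
    (hτ' : τ' ∈ timeInterval T') (hd : bvDist (Q τ) (Q' τ') ≤ 0) :
    N τ = N' τ' ∧ EqOn (Q τ) (Q' τ') (Icc 0 1) := by
  have r := h.isRegularSolution hK
  have r' := h'.isRegularSolution hK
  have slice : ∀ {T : EReal} {Q u : ℝ → ℝ → ℝ} {n : ℝ → ℝ}, IsRegularSolution Φ K T Q u n →
      ∀ {τ}, τ ∈ timeInterval T → ContinuousOn (u τ) (Icc 0 1) :=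
    fun r τ hτ => r.continuousOn_density.comp (f := fun η => (τ, η)) (by fun_prop)
      fun η hη => ⟨hτ, hη⟩
  have heq : EqOn (Q τ) (Q' τ') (Icc 0 1) :=
    eqOn_of_integral_abs_sub_nonpos (r.hasDerivWithinAt τ hτ) (r'.hasDerivWithinAt τ' hτ')
      (slice r hτ) (slice r' hτ') ((h.left τ hτ).trans (h'.left τ' hτ').symm) hd
  refine ⟨?_, heq⟩
  have h1 := h.rate τ hτ
  rw [dEta_congr heq (right_mem_Icc.2 zero_le_one), ← h'.rate τ' hτ'] at h1
  simpa using h1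

lemma bvDist_eq_zero {q₁ q₂ : ℝ → ℝ} (h : EqOn q₁ q₂ (Icc 0 1)) : bvDist q₁ q₂ = 0 := by
  rw [bvDist, intervalIntegral.integral_congr (g := fun _ => 0), intervalIntegral.integral_zero]
  intro η hη
  rw [uIcc_of_le zero_le_one] at hη
  simp only [dEta_congr h hη, sub_self, abs_zero]

/-- The distance is zero at time `0` and stays so by contraction. -/
lemma IsClassicalSolution.eq_of_same_datum (hK : IsPhaseResponse Φ K) (hk : kMax Φ K < 0)
    {Q' : ℝ → ℝ → ℝ} {N N' : ℝ → ℝ} {T : EReal} (h : IsClassicalSolution Φ K ⊤ q Q N)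
    (h' : IsClassicalSolution Φ K T q Q' N') {τ : ℝ} (hτ : τ ∈ timeInterval T) :
    N' τ = N τ ∧ EqOn (Q' τ) (Q τ) (Icc 0 1) := by
  refine h'.eq_of_bvDist_nonpos hK h hτ (timeInterval_top ▸ hτ.1) ?_
  refine (h.bvDist_le hK hk h' le_top hτ).trans_eq ?_
  rw [bvDist_eq_zero fun η hη => (h'.initial η hη).trans (h.initial η hη).symm, mul_zero]

/-- The distance `d` of two steady states is constant in time, and contraction up to time `1` gives
`d ≤ exp (kMax) * d` with a factor below `1`. -/
lemma IsSteadyState.unique (hK : IsPhaseResponse Φ K) (hk : kMax Φ K < 0) {Qs Qs' : ℝ → ℝ}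
    {Ns Ns' : ℝ} (h : IsSteadyState Φ K Qs Ns) (h' : IsSteadyState Φ K Qs' Ns') :
    Ns' = Ns ∧ EqOn Qs' Qs (Icc 0 1) := by
  have mem : (1 : ℝ) ∈ timeInterval ⊤ := timeInterval_top ▸ mem_Ici.2 zero_le_one
  refine IsClassicalSolution.eq_of_bvDist_nonpos hK h' h mem mem ?_
  have h1 := IsClassicalSolution.bvDist_le hK hk h h' le_rfl mem
  have h2 : Real.exp (kMax Φ K * 1) < 1 := by
    rw [mul_one]
    simpa using Real.exp_lt_exp.2 hk
  by_contra! h3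
  exact absurd h1 (not_le.2 (mul_lt_of_lt_one_left h3 h2))

end Global

end PulseCoupled

theorem theorem5p2 (Φ : ℝ) (hΦ : 0 < Φ) (K : ℝ → ℝ)
    (hK : PulseCoupled.IsPhaseResponse Φ K)
    (hk : PulseCoupled.kMax Φ K < 0)
    (hss : 1 < ∫ φ in (0 : ℝ)..Φ, 1 / K φ)
    (q : ℝ → ℝ) (hq : PulseCoupled.IsCompatibleDatum Φ K q)
    (hH : ∀ η ∈ Set.Icc (0 : ℝ) 1, 0 < PulseCoupled.hInit K q η) :
    ∃ (Q : ℝ → ℝ → ℝ) (N : ℝ → ℝ) (Qs : ℝ → ℝ) (Ns : ℝ),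
      -- `(Q, N)` is a global classical solution
      PulseCoupled.IsClassicalSolution Φ K ⊤ q Q N ∧
      -- and the only one: a classical solution on any `[0, T)`, `T ≤ ∞`, agrees with it there
      (∀ (T : EReal) (Q' : ℝ → ℝ → ℝ) (N' : ℝ → ℝ),
        PulseCoupled.IsClassicalSolution Φ K T q Q' N' →
        ∀ τ ∈ PulseCoupled.timeInterval T,
          N' τ = N τ ∧ ∀ η ∈ Set.Icc (0 : ℝ) 1, Q' τ η = Q τ η) ∧
      -- `(Qs, Ns)` is a steady state, and the only one
      PulseCoupled.IsSteadyState Φ K Qs Ns ∧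
      (∀ (Qs' : ℝ → ℝ) (Ns' : ℝ), PulseCoupled.IsSteadyState Φ K Qs' Ns' →
        Ns' = Ns ∧ ∀ η ∈ Set.Icc (0 : ℝ) 1, Qs' η = Qs η) ∧
      -- exponential convergence
      ∀ τ : ℝ, 0 ≤ τ →
        PulseCoupled.bvDist (Q τ) Qs
          ≤ Real.exp (PulseCoupled.kMax Φ K * τ) * PulseCoupled.bvDist (Q 0) Qs := by
  obtain ⟨Q, u, n, hQ, h0⟩ := hq.isStrongDatum.exists_isStrongSolution hΦ hK
  have hsol := hQ.isClassicalSolution hΦ hK hk hq.toIsInitialDatum hH h0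
  obtain ⟨Qs, Ns, hs⟩ := PulseCoupled.exists_isSteadyState hΦ hK hss
  refine ⟨Q, fun τ => 1 / n τ, Qs, Ns, hsol, fun T Q' N' h' τ hτ => hsol.eq_of_same_datum hK hk h' hτ,
    hs, fun Qs' Ns' h' => hs.unique hK hk h', fun τ hτ => ?_⟩
  -- Convergence is contraction against the steady state, regarded as a classical solution constant
  -- in time.
  exact PulseCoupled.IsClassicalSolution.bvDist_le hK hk hs hsol le_rfl
    (PulseCoupled.timeInterval_top ▸ hτ)
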